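/- Let $M$ be a smooth manifold (finite-dimensional, Hausdorff, second countable, without boundary), let $E\to M$ be a smooth real vector bundle of finite rank $\ge 1$, and let $E^*$ be the total space of the dual bundle. For $s\in\Gamma(E)$ let $\hat s\in C^\infty(E^*)$ be the fibrewise linear function $\hat s(v)=v(s(x))$, $v\in E_x^*$, and let $\xi$ be the Euler vector field on $E^*$, with flow $v\mapsto e^tv$. Multivector fields act on differential forms by $i_{X_1\wedge\dots\wedge X_p}=i_{X_1}\cdots i_{X_p}$. For $P\in\mathfrak X^p$ put $L_P=i_Pd-(-1)^pd\,i_P$. The Schouten bracket of $P\in\mathfrak X^p$ and $Q\in\mathfrak X^q$, $p+q\ge1$, is the multivector field $[P,Q]\in\mathfrak X^{p+q-1}$ with $i_{[P,Q]}=L_Pi_Q-(-1)^{(p-1)q}i_QL_P$. A multivector field $P$ of degree $k\ge0$ on $E^*$ is called linear if $[\xi,P]=(1-k)P$. Let $\mathfrak X^k_{\mathrm{lin}}(E^*)$ be the space of linear multivector fields of degree $k$. Let $\mathrm{Der}^{-1}(E)=\Gamma(E)$. For $n\ge0$ let $\mathrm{Der}^n(E)$ be the space of alternating $\mathbb R$-multilinear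 maps $D:\Gamma(E)^{n+1}\to\Gamma(E)$ for which there is an alternating $C^\infty(M)$-multilinear map $\sigma_D:\Gamma(E)^n\to\Gamma(TM)$ with $$D(s_1,\dots,s_n,ft)=f\,D(s_1,\dots,s_n,t)+\sigma_D(s_1,\dots,s_n)(f)\,t\qquad(f\in C^\infty(M)).$$ For $D_1\in\mathrm{Der}^p(E)$ and $D_2\in\mathrm{Der}^q(E)$, $p+q\ge-1$, let $$(D_1\circ D_2)(s_0,\dots,s_{p+q})=\sum_{\sigma}\mathrm{sgn}(\sigma)\,D_1\big(D_2(s_{\sigma(0)},\dots,s_{\sigma(q)}),s_{\sigma(q+1)},\dots,s_{\sigma(p+q)}\big),$$ the sum running over the $(q+1,p)$-shuffles ($D_1\circ D_2=0$ if $p=-1$), and let $[D_1,D_2]_{CM}=(-1)^{pq}D_1\circ D_2-D_2\circ D_1$ be the Crainic–Moerdijk bracket. Then for every $k\ge0$ there is a linear isomorphism $\mathcal I_k:\mathfrak X^k_{\mathrm{lin}}(E^*)\to\mathrm{Der}^{k-1}(E)$ with $$\widehat{\mathcal I_k(P)(s_1,\dots,s_k)}=i_P(d\hat s_1\wedge\dots\wedge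 d\hat s_k)\qquad(s_1,\dots,s_k\in\Gamma(E)),$$ and the following hold. 1. Let $P\in\mathfrak X^p_{\mathrm{lin}}(E^*)$ and $Q\in\mathfrak X^q_{\mathrm{lin}}(E^*)$ with $p+q\ge1$. The Schouten bracket $[P,Q]$ exists, is unique and is linear, and $$\mathcal I_{p+q-1}([P,Q])=(-1)^{(p-1)(q-1)}[\mathcal I_p(P),\mathcal I_q(Q)]_{CM}.$$ 2. Let $\pi\in\mathfrak X^2_{\mathrm{lin}}(E^*)$ be a linear Poisson tensor, $[\pi,\pi]=0$, and let $m=\mathcal I_2(\pi)$. Then $[m,m]_{CM}=0$, and with $\delta_\pi=[\pi,\cdot]$ and $\delta_m=[m,\cdot]_{CM}$ $$\delta_m(\mathcal I_p(P))=(-1)^{p-1}\,\mathcal I_{p+1}(\delta_\pi P)\qquad(P\in\mathfrak X^p_{\mathrm{lin}}(E^*),\ p\ge0).$$ Consequently, for every $k\ge0$, the map $\mathcal I_k$ induces a linear isomorphism $$H^k_{\pi,\mathrm{lin}}(E^*)\;\cong\;H^{k-1}_{m,CM}(E),$$ where $H^k_{\pi,\mathrm{lin}}(E^*)$ is the cohomology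 at $\mathfrak X^k_{\mathrm{lin}}(E^*)$ of the complex $(\mathfrak X^\bullet_{\mathrm{lin}}(E^*),\delta_\pi)$, and $H^{k-1}_{m,CM}(E)$ is the cohomology at $\mathrm{Der}^{k-1}(E)$ of the complex $(\mathrm{Der}^\bullet(E),\delta_m)$. -/

import Mathlib

open scoped Manifold ContDiff Bundle

noncomputable section

namespace LinearPoisson

/-! ### Contraction of alternating forms with multivectors -/

section Contraction

variable {V : Type*} [AddCommGroup V] [Module ℝ V] [TopologicalSpace V]

/-- `(i_x η)(v₁, …, vₙ) = η(x, v₁, …, vₙ)`. -/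
def contractForm {n : ℕ} (x : V) (η : V [⋀^Fin (n + 1)]→L[ℝ] ℝ) : V [⋀^Fin n]→L[ℝ] ℝ where
  __ := η.toAlternatingMap.curryLeft x
  cont := η.cont.comp (continuous_const.matrixVecCons continuous_id)

theorem contractForm_apply {n : ℕ} (x : V) (η : V [⋀^Fin (n + 1)]→L[ℝ] ℝ) (v : Fin n → V) :
    contractForm x η v = η (Matrix.vecCons x v) := rfl

/-- The contraction `x ↦ i_x`, with `i_x` acting on alternating forms of all degrees. -/
def contractVector : V →ₗ[ℝ] Module.End ℝ (∀ n : ℕ, V [⋀^Fin n]→L[ℝ] ℝ) where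
  toFun x :=
    { toFun := fun η n => contractForm x (η (n + 1))
      map_add' := fun _ _ => rfl
      map_smul' := fun _ _ => rfl }
  map_add' x y := by
    ext η n v
    exact congrArg (fun g : V [⋀^Fin n]→ₗ[ℝ] ℝ => g v)
      ((η (n + 1)).toAlternatingMap.curryLeft.map_add x y)
  map_smul' c x := by
    ext η n v
    exact congrArg (fun g : V [⋀^Fin n]→ₗ[ℝ] ℝ => g v)
      ((η (n + 1)).toAlternatingMap.curryLeft.map_smul c x)

theorem contractVector_mul_self (x : V) : contractVector x * contractVector x = 0 := by
  ext η n v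
  exact congrArg (fun g : V [⋀^Fin n]→ₗ[ℝ] ℝ => g v)
    ((η (n + 1 + 1)).toAlternatingMap.curryLeft_same x)

/-- The contraction `P ↦ i_P` of alternating forms with multivectors; it is determined by
`i_{x₁ ∧ … ∧ xₚ} = i_{x₁} ∘ … ∘ i_{xₚ}` and by `i_c = c • id` for scalars `c`. -/
def contract : ExteriorAlgebra ℝ V →ₐ[ℝ] Module.End ℝ (∀ n : ℕ, V [⋀^Fin n]→L[ℝ] ℝ) :=
  ExteriorAlgebra.lift ℝ ⟨contractVector, contractVector_mul_self⟩

theorem contract_ιMulti_succ {p : ℕ} (x : Fin (p + 1) → V) :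
    contract (ExteriorAlgebra.ιMulti ℝ (p + 1) x) =
      contractVector (x 0) * contract (ExteriorAlgebra.ιMulti ℝ p (Matrix.vecTail x)) := by
  rw [ExteriorAlgebra.ιMulti_succ_apply, map_mul]
  congr 1
  exact ExteriorAlgebra.lift_ι_apply ℝ _ contractVector_mul_self (x 0)

/-- The contraction with a multivector of degree `p` lowers degrees by `p`. -/
theorem contract_eq_zero {p : ℕ} {P : ExteriorAlgebra ℝ V} (hP : P ∈ ⋀[ℝ]^p V) (n : ℕ)
    (η : ∀ n : ℕ, V [⋀^Fin n]→L[ℝ] ℝ) (hη : η (n + p) = 0) : contract P η n = 0 := by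
  rw [← ExteriorAlgebra.ιMulti_span_fixedDegree] at hP
  induction hP using Submodule.span_induction with
  | mem P hP =>
    obtain ⟨x, rfl⟩ := hP
    induction p generalizing n with
    | zero => simpa [ExteriorAlgebra.ιMulti_zero_apply] using hη
    | succ p ih =>
      rw [contract_ιMulti_succ]
      have h : contract (ExteriorAlgebra.ιMulti ℝ p (Matrix.vecTail x)) η (n + 1) = 0 := by
        apply ih
        rw [Nat.add_right_comm]
        exact hη
      ext v
      change contract (ExteriorAlgebra.ιMulti ℝ p (Matrix.vecTail x)) η (n + 1) _ = 0
      rw [h]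
      rfl
  | zero => simp
  | add P Q _ _ hP hQ => simp [hP, hQ]
  | smul c P _ hP => simp [hP]

/-- The form `α₁ ∧ … ∧ αₙ`, that is `(α₁ ∧ … ∧ αₙ)(v₁, …, vₙ) = det (αⱼ(vᵢ))`. -/
def wedge {n : ℕ} (α : Fin n → V →L[ℝ] ℝ) : V [⋀^Fin n]→L[ℝ] ℝ where
  __ := (Matrix.detRowAlternating (R := ℝ) (n := Fin n)).compLinearMap
    (LinearMap.pi fun i => (α i).toLinearMap)
  cont := by
    change Continuous fun v : Fin n → V => Matrix.det (Matrix.of fun i j => α j (v i))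
    fun_prop

theorem wedge_apply {n : ℕ} (α : Fin n → V →L[ℝ] ℝ) (v : Fin n → V) :
    wedge α v = Matrix.det (Matrix.of fun i j => α j (v i)) := rfl

end Contraction

/-! ### Insertion of alternating maps -/

section Insertion

variable {V : Type*} [AddCommGroup V] [Module ℝ V]

/-- An alternating map with `m + 1` arguments, as an alternating map of its last `m` arguments
with values in the endomorphisms, acting on the first argument. -/
def flipFirst {m : ℕ} (f : V [⋀^Fin (m + 1)]→ₗ[ℝ] V) : V [⋀^Fin m]→ₗ[ℝ] Module.End ℝ V where
  toFun v :=
    { toFun := fun x => f (Matrix.vecCons x v)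
      map_add' := fun x y => congrArg (fun g : V [⋀^Fin m]→ₗ[ℝ] V => g v) (f.curryLeft.map_add x y)
      map_smul' := fun c x =>
        congrArg (fun g : V [⋀^Fin m]→ₗ[ℝ] V => g v) (f.curryLeft.map_smul c x) }
  map_update_add' v i x y := by
    ext z
    exact (f.curryLeft z).map_update_add v i x y
  map_update_smul' v i c x := by
    ext z
    exact (f.curryLeft z).map_update_smul v i c x
  map_eq_zero_of_eq' v i j h hij := by
    ext z
    exact (f.curryLeft z).map_eq_zero_of_eq v h hij

/-- The insertion product
`(f ∘ g)(x₁, …, x_r) = ∑ (-1)^σ f (g (x_σ(1), …, x_σ(b)), x_σ(b+1), …, x_σ(r))`, `r = a + b - 1`,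
of alternating maps with `a` and `b` arguments. The sum runs over all `(b, a - 1)`-shuffles; it is
zero if `a = 0`. -/
def insertion {a b r : ℕ} (h : r + 1 = a + b)
    (f : V [⋀^Fin a]→ₗ[ℝ] V) (g : V [⋀^Fin b]→ₗ[ℝ] V) : V [⋀^Fin r]→ₗ[ℝ] V :=
  match a, h, f with
  | 0, _, _ => 0
  | m + 1, h, f =>
    ((TensorProduct.lift (LinearMap.id (R := ℝ) (M := Module.End ℝ V)).flip).compAlternatingMap
      (g.domCoprod (flipFirst f))).domDomCongr
        (finSumFinEquiv.trans (finCongr (by omega : b + m = r)))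

/-- The bijection between the argument positions and `{1, …, b} ⊔ {b + 1, …, b + m}`. -/
def splitEquiv {b m r : ℕ} (h : b + m = r) : Fin b ⊕ Fin m ≃ Fin r :=
  finSumFinEquiv.trans (finCongr h)

theorem insertion_apply {m b r : ℕ} (h : r + 1 = (m + 1) + b)
    (f : V [⋀^Fin (m + 1)]→ₗ[ℝ] V) (g : V [⋀^Fin b]→ₗ[ℝ] V) (x : Fin r → V) :
    insertion h f g x =
      ∑ σ : {σ : Equiv.Perm (Fin b ⊕ Fin m) //
          StrictMono (fun i => splitEquiv (by omega : b + m = r) (σ (Sum.inl i))) ∧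
          StrictMono (fun i => splitEquiv (by omega : b + m = r) (σ (Sum.inr i)))},
        Equiv.Perm.sign σ.1 •
          f (Matrix.vecCons
            (g fun i => x (splitEquiv (by omega : b + m = r) (σ.1 (Sum.inl i))))
            fun i => x (splitEquiv (by omega : b + m = r) (σ.1 (Sum.inr i)))) := by
  classical
  set e := splitEquiv (by omega : b + m = r) with he
  have key : Function.Bijective (fun σ : {σ : Equiv.Perm (Fin b ⊕ Fin m) //
      StrictMono (fun i => e (σ (Sum.inl i))) ∧ StrictMono (fun i => e (σ (Sum.inr i)))} =>
      (Quotient.mk'' σ.1 : Equiv.Perm.ModSumCongr (Fin b) (Fin m))) := by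
    have uniq : ∀ {n : ℕ} (τ : Equiv.Perm (Fin n)) (u : Fin n → Fin r), StrictMono u →
        StrictMono (u ∘ τ) → τ = 1 := by
      intro n τ u hu hτ
      have : StrictMono τ := fun i j hij => hu.lt_iff_lt.1 (hτ hij)
      ext i
      have := congrArg (fun f : Fin n ≃o Fin n => f i)
        (Subsingleton.elim (this.orderIsoOfSurjective τ τ.surjective) (OrderIso.refl _))
      simpa using congrArg Fin.val this
    constructor
    · rintro ⟨σ, hσ₁, hσ₂⟩ ⟨τ, hτ₁, hτ₂⟩ hστ
      obtain ⟨⟨sl, sr⟩, hs⟩ := QuotientGroup.leftRel_apply.mp (Quotient.exact' hστ)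
      have hs' : τ = σ * Equiv.Perm.sumCongrHom _ _ (sl, sr) := by rw [hs]; group
      have h1 : sl = 1 := uniq sl _ hσ₁ (by
        convert hτ₁ using 1
        ext i; simp [hs'])
      have h2 : sr = 1 := uniq sr _ hσ₂ (by
        convert hτ₂ using 1
        ext i; simp [hs'])
      apply Subtype.ext
      simp [hs', h1, h2, ← Prod.one_eq_mk]
    · intro q
      induction q using Quotient.inductionOn' with
      | h σ =>
      have sorted : ∀ {n : ℕ} (u : Fin n → Fin r), Function.Injective u →
          StrictMono (u ∘ Tuple.sort u) := fun u hu =>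
        (Tuple.monotone_sort u).strictMono_of_injective (hu.comp (Equiv.injective _))
      refine ⟨⟨σ * Equiv.Perm.sumCongrHom _ _
        (Tuple.sort fun i => e (σ (Sum.inl i)), Tuple.sort fun i => e (σ (Sum.inr i))), ?_, ?_⟩, ?_⟩
      · exact sorted (fun i => e (σ (Sum.inl i)))
          (e.injective.comp (σ.injective.comp Sum.inl_injective))
      · exact sorted (fun i => e (σ (Sum.inr i)))
          (e.injective.comp (σ.injective.comp Sum.inr_injective))
      · apply Quotient.sound'
        rw [QuotientGroup.leftRel_apply]
        exact ⟨(Tuple.sort fun i => e (σ (Sum.inl i)), Tuple.sort fun i => e (σ (Sum.inr i)))⁻¹,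
          by rw [map_inv]; group⟩
  have : insertion h f g x = (TensorProduct.lift (LinearMap.id (R := ℝ)
      (M := Module.End ℝ V)).flip) (∑ q : Equiv.Perm.ModSumCongr (Fin b) (Fin m),
        AlternatingMap.domCoprod.summand g (flipFirst f) q (fun i => x (e i))) := by
    simp only [insertion, AlternatingMap.domDomCongr_apply,
      LinearMap.compAlternatingMap_apply, AlternatingMap.domCoprod_apply, sum_apply]
    rfl
  rw [this, map_sum]
  refine (Fintype.sum_bijective _ key _ _ fun σ => ?_).symm
  rw [AlternatingMap.domCoprod.summand_mk'']
  simp only [smul_apply, MultilinearMap.domDomCongr_apply,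
    MultilinearMap.domCoprod_apply]
  rw [LinearMap.map_smul_of_tower]
  rfl

theorem insertion_zero_left {b r : ℕ} (h : r + 1 = 0 + b)
    (f : V [⋀^Fin 0]→ₗ[ℝ] V) (g : V [⋀^Fin b]→ₗ[ℝ] V) : insertion h f g = 0 := rfl

theorem insertion_add_left {a b r : ℕ} (h : r + 1 = a + b)
    (f f' : V [⋀^Fin a]→ₗ[ℝ] V) (g : V [⋀^Fin b]→ₗ[ℝ] V) :
    insertion h (f + f') g = insertion h f g + insertion h f' g := by
  cases a with
  | zero => simp [insertion_zero_left]
  | succ m => ext x; simp [insertion_apply, Finset.sum_add_distrib]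

theorem insertion_smul_left {a b r : ℕ} (h : r + 1 = a + b) (c : ℝ)
    (f : V [⋀^Fin a]→ₗ[ℝ] V) (g : V [⋀^Fin b]→ₗ[ℝ] V) :
    insertion h (c • f) g = c • insertion h f g := by
  cases a with
  | zero => simp [insertion_zero_left]
  | succ m =>
    ext x
    simp only [insertion_apply, AlternatingMap.smul_apply, Finset.smul_sum]
    exact Finset.sum_congr rfl fun σ _ => smul_comm _ _ _

theorem insertion_add_right {a b r : ℕ} (h : r + 1 = a + b)
    (f : V [⋀^Fin a]→ₗ[ℝ] V) (g g' : V [⋀^Fin b]→ₗ[ℝ] V) :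
    insertion h f (g + g') = insertion h f g + insertion h f g' := by
  cases a with
  | zero => simp [insertion_zero_left]
  | succ m =>
    ext x
    have := fun (y z : V) (v : Fin m → V) =>
      congrArg (fun k : V [⋀^Fin m]→ₗ[ℝ] V => k v) (f.curryLeft.map_add y z)
    simp only [AlternatingMap.curryLeft_apply_apply, AlternatingMap.add_apply] at this
    simp [insertion_apply, Finset.sum_add_distrib, this]

theorem insertion_smul_right {a b r : ℕ} (h : r + 1 = a + b) (c : ℝ)
    (f : V [⋀^Fin a]→ₗ[ℝ] V) (g : V [⋀^Fin b]→ₗ[ℝ] V) :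
    insertion h f (c • g) = c • insertion h f g := by
  cases a with
  | zero => simp [insertion_zero_left]
  | succ m =>
    ext x
    have := fun (y : V) (v : Fin m → V) =>
      congrArg (fun k : V [⋀^Fin m]→ₗ[ℝ] V => k v) (f.curryLeft.map_smul c y)
    simp only [AlternatingMap.curryLeft_apply_apply, AlternatingMap.smul_apply] at this
    simp only [insertion_apply, AlternatingMap.smul_apply, Finset.smul_sum, this]
    exact Finset.sum_congr rfl fun σ _ => smul_comm _ _ _

/-- The bracket of alternating maps with `a` and `b` arguments, `[f, g] = (-1)^{(a-1)(b-1)} f ∘ g - g ∘ f`. -/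
def cmBracket {a b r : ℕ} (h : r + 1 = a + b)
    (f : V [⋀^Fin a]→ₗ[ℝ] V) (g : V [⋀^Fin b]→ₗ[ℝ] V) : V [⋀^Fin r]→ₗ[ℝ] V :=
  (-1 : ℝ) ^ ((a + 1) * (b + 1)) • insertion h f g - insertion (by omega) g f

theorem cmBracket_add_right {a b r : ℕ} (h : r + 1 = a + b)
    (f : V [⋀^Fin a]→ₗ[ℝ] V) (g g' : V [⋀^Fin b]→ₗ[ℝ] V) :
    cmBracket h f (g + g') = cmBracket h f g + cmBracket h f g' := by
  simp only [cmBracket, insertion_add_left, insertion_add_right, smul_add]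
  abel

theorem cmBracket_smul_right {a b r : ℕ} (h : r + 1 = a + b) (c : ℝ)
    (f : V [⋀^Fin a]→ₗ[ℝ] V) (g : V [⋀^Fin b]→ₗ[ℝ] V) :
    cmBracket h f (c • g) = c • cmBracket h f g := by
  simp only [cmBracket, insertion_smul_left, insertion_smul_right, smul_sub]
  rw [smul_comm]

end Insertion

/-! ### Differential forms and multivector fields on a manifold -/

section Manifold

variable {EN : Type*} [NormedAddCommGroup EN] [NormedSpace ℝ EN]
  {HN : Type*} [TopologicalSpace HN] (J : ModelWithCorners ℝ EN HN)
  (N : Type*) [TopologicalSpace N] [ChartedSpace HN N]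

/-- Families of (not necessarily smooth) differential forms, one of every degree. -/
abbrev GradedForm : Type _ := ∀ (n : ℕ) (x : N), TangentSpace J x [⋀^Fin n]→L[ℝ] ℝ

/-- Multivector fields of degree `p`: sections, not necessarily smooth, of `Λᵖ TN`. -/
def MultivectorField (p : ℕ) : Type _ := ∀ x : N, ⋀[ℝ]^p (TangentSpace J x)

instance (p : ℕ) : AddCommGroup (MultivectorField J N p) :=
  inferInstanceAs (AddCommGroup (∀ x : N, ⋀[ℝ]^p (TangentSpace J x)))

instance (p : ℕ) : Module ℝ (MultivectorField J N p) :=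
  inferInstanceAs (Module ℝ (∀ x : N, ⋀[ℝ]^p (TangentSpace J x)))

variable {J N}

/-- The differential form `η` in the chart around `x₀`: its pullback under the inverse chart. -/
def inChart {n : ℕ} (η : ∀ x : N, TangentSpace J x [⋀^Fin n]→L[ℝ] ℝ) (x₀ : N) (y : EN) :
    EN [⋀^Fin n]→L[ℝ] ℝ :=
  (η ((extChartAt J x₀).symm y)).compContinuousLinearMap
    (mfderiv 𝓘(ℝ, EN) J (extChartAt J x₀).symm y ∘L
      (NormedSpace.fromTangentSpace y).symm.toContinuousLinearMap)

/-- Smoothness of a differential form: near each point, its expression in the chart is smooth. -/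
def IsSmoothForm {n : ℕ} (η : ∀ x : N, TangentSpace J x [⋀^Fin n]→L[ℝ] ℝ) : Prop :=
  ∀ x : N, ContDiffAt ℝ ∞ (inChart η x) (extChartAt J x x)

/-- The exterior derivative on a manifold without boundary; at `x` it is computed in the chart
around `x`. -/
def extD [J.Boundaryless] (η : GradedForm J N) : GradedForm J N
  | 0, _ => 0
  | n + 1, x =>
    (extDeriv (inChart (η n) x) (extChartAt J x x)).compContinuousLinearMap
      (mvfderiv J (extChartAt J x) x)

/-- The form `df₁ ∧ … ∧ dfᵣ`, considered as an element of degree `r`. -/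
def exactForm {r : ℕ} (f : Fin r → C^∞⟮J, N; 𝓘(ℝ, ℝ), ℝ⟯) : GradedForm J N := fun n x =>
  if h : n = r then wedge (fun i : Fin n => mvfderiv J (f (Fin.cast h i)) x) else 0

theorem exactForm_of_ne {r n : ℕ} (f : Fin r → C^∞⟮J, N; 𝓘(ℝ, ℝ), ℝ⟯) (h : n ≠ r) :
    exactForm f n = 0 := by
  funext x
  simp [exactForm, h]

/-- The contraction `i_P` of differential forms with the multivector field `P`. -/
def interior {p : ℕ} (P : MultivectorField J N p) (η : GradedForm J N) : GradedForm J N :=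
  fun n x => contract (P x : ExteriorAlgebra ℝ (TangentSpace J x)) (fun k => η k x) n

/-- The Lie derivative `L_P = i_P d - (-1)ᵖ d i_P`. -/
def lieDeriv [J.Boundaryless] {p : ℕ} (P : MultivectorField J N p) (η : GradedForm J N) :
    GradedForm J N :=
  interior P (extD η) - (-1 : ℝ) ^ p • extD (interior P η)

/-- Smoothness of a multivector field: its contraction with every form `df₁ ∧ … ∧ dfₘ` is
smooth. -/
def IsSmoothMultivector {p : ℕ} (P : MultivectorField J N p) : Prop :=
  ∀ (m : ℕ) (f : Fin m → C^∞⟮J, N; 𝓘(ℝ, ℝ), ℝ⟯) (n : ℕ),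
    IsSmoothForm (interior P (exactForm f) n)

/-- `R` is the Schouten bracket `[P, Q]`, that is `i_R = L_P i_Q - (-1)^{(p-1)q} i_Q L_P`, where
`r = p + q - 1`. It suffices to test this equation on the forms `df₁ ∧ … ∧ dfᵣ`, which span the
forms of degree `r` at every point, since `R` is determined by the contractions
`i_R (df₁ ∧ … ∧ dfᵣ)`. -/
def IsSchoutenBracket [J.Boundaryless] {p q r : ℕ} (P : MultivectorField J N p)
    (Q : MultivectorField J N q) (R : MultivectorField J N r) : Prop :=
  ∀ f : Fin r → C^∞⟮J, N; 𝓘(ℝ, ℝ), ℝ⟯,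
    interior R (exactForm f) =
      lieDeriv P (interior Q (exactForm f)) -
        (-1 : ℝ) ^ ((p + 1) * q) • interior Q (lieDeriv P (exactForm f))

/-! Linearity of these notions -/

theorem inChart_add {n : ℕ} (η θ : ∀ x : N, TangentSpace J x [⋀^Fin n]→L[ℝ] ℝ) (x : N) :
    inChart (η + θ) x = inChart η x + inChart θ x := rfl

theorem inChart_smul {n : ℕ} (c : ℝ) (η : ∀ x : N, TangentSpace J x [⋀^Fin n]→L[ℝ] ℝ) (x : N) :
    inChart (c • η) x = c • inChart η x := rfl

theorem IsSmoothForm.add {n : ℕ} {η θ : ∀ x : N, TangentSpace J x [⋀^Fin n]→L[ℝ] ℝ}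
    (hη : IsSmoothForm η) (hθ : IsSmoothForm θ) : IsSmoothForm (η + θ) := fun x => by
  rw [inChart_add]
  exact (hη x).add (hθ x)

theorem IsSmoothForm.smul {n : ℕ} {η : ∀ x : N, TangentSpace J x [⋀^Fin n]→L[ℝ] ℝ}
    (hη : IsSmoothForm η) (c : ℝ) : IsSmoothForm (c • η) := fun x => by
  rw [inChart_smul]
  exact (hη x).const_smul c

theorem interior_add_left {p : ℕ} (P Q : MultivectorField J N p) (η : GradedForm J N) :
    interior (P + Q) η = interior P η + interior Q η := by
  funext n x
  have h : (P + Q) x = P x + Q x := rfl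
  simp [interior, h]

theorem interior_smul_left {p : ℕ} (c : ℝ) (P : MultivectorField J N p) (η : GradedForm J N) :
    interior (c • P) η = c • interior P η := by
  funext n x
  have h : (c • P) x = c • P x := rfl
  simp [interior, h]

theorem interior_add_right {p : ℕ} (P : MultivectorField J N p) (η θ : GradedForm J N) :
    interior P (η + θ) = interior P η + interior P θ := by
  funext n x
  exact congrFun ((contract (P x : ExteriorAlgebra ℝ (TangentSpace J x))).map_add
    (fun k => η k x) (fun k => θ k x)) n

theorem interior_smul_right {p : ℕ} (P : MultivectorField J N p) (c : ℝ) (η : GradedForm J N) :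
    interior P (c • η) = c • interior P η := by
  funext n x
  exact congrFun ((contract (P x : ExteriorAlgebra ℝ (TangentSpace J x))).map_smul c
    (fun k => η k x)) n

theorem interior_eq_zero {p : ℕ} (P : MultivectorField J N p) {η : GradedForm J N} {n : ℕ}
    (hη : η (n + p) = 0) : interior P η n = 0 := by
  funext x
  exact contract_eq_zero (P x).2 n (fun k => η k x) (congrFun hη x)

theorem extD_smul [J.Boundaryless] (c : ℝ) (η : GradedForm J N) : extD (c • η) = c • extD η := by
  funext n x
  cases n with
  | zero => simp [extD]
  | succ n =>
    have : inChart ((c • η) n) x = c • inChart (η n) x := rfl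
    change (extDeriv (inChart ((c • η) n) x) (extChartAt J x x)).compContinuousLinearMap _ = _
    rw [this, extDeriv_smul]
    rfl

theorem extD_add [J.Boundaryless] {η θ : GradedForm J N} (hη : ∀ n, IsSmoothForm (η n))
    (hθ : ∀ n, IsSmoothForm (θ n)) : extD (η + θ) = extD η + extD θ := by
  funext n x
  cases n with
  | zero => simp [extD]
  | succ n =>
    have : inChart ((η + θ) n) x = inChart (η n) x + inChart (θ n) x := rfl
    change (extDeriv (inChart ((η + θ) n) x) (extChartAt J x x)).compContinuousLinearMap _ = _
    rw [this, extDeriv_add ((hη n x).differentiableAt (by simp)) ((hθ n x).differentiableAt (by simp))]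
    rfl

theorem interior_interior_exactForm {p q r : ℕ} (h : r + 1 = p + q) (P : MultivectorField J N p)
    (Q : MultivectorField J N q) (f : Fin r → C^∞⟮J, N; 𝓘(ℝ, ℝ), ℝ⟯) :
    interior P (interior Q (exactForm f)) = 0 := by
  funext n
  exact interior_eq_zero P (interior_eq_zero Q (exactForm_of_ne f (by omega)))

theorem extD_zero [J.Boundaryless] : extD (0 : GradedForm J N) = 0 := by
  simpa using extD_smul (0 : ℝ) (0 : GradedForm J N)

theorem IsSmoothMultivector.zero {p : ℕ} :
    IsSmoothMultivector (0 : MultivectorField J N p) := fun m f n x => by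
  have : interior (0 : MultivectorField J N p) (exactForm f) = 0 := by
    simpa using interior_smul_left (0 : ℝ) (0 : MultivectorField J N p) (exactForm f)
  rw [this]
  exact contDiffAt_const (c := (0 : EN [⋀^Fin n]→L[ℝ] ℝ))

theorem IsSmoothMultivector.add {p : ℕ} {P Q : MultivectorField J N p}
    (hP : IsSmoothMultivector P) (hQ : IsSmoothMultivector Q) :
    IsSmoothMultivector (P + Q) := fun m f n => by
  rw [interior_add_left]
  exact (hP m f n).add (hQ m f n)

theorem IsSmoothMultivector.smul {p : ℕ} {P : MultivectorField J N p}
    (hP : IsSmoothMultivector P) (c : ℝ) : IsSmoothMultivector (c • P) := fun m f n => by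
  rw [interior_smul_left]
  exact (hP m f n).smul c

theorem IsSchoutenBracket.smul [J.Boundaryless] {p q r : ℕ} {P : MultivectorField J N p}
    {Q : MultivectorField J N q} {R : MultivectorField J N r} (h : IsSchoutenBracket P Q R)
    (c : ℝ) : IsSchoutenBracket P (c • Q) (c • R) := fun f => by
  simp only [interior_smul_left, h f, lieDeriv, extD_smul, interior_smul_right, smul_sub]
  simp only [smul_comm c]

theorem IsSchoutenBracket.zero [J.Boundaryless] {p q r : ℕ} (P : MultivectorField J N p) :
    IsSchoutenBracket P (0 : MultivectorField J N q) (0 : MultivectorField J N r) := fun f => by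
  have h : ∀ (k : ℕ) (η : GradedForm J N), interior (0 : MultivectorField J N k) η = 0 :=
    fun k η => by simpa using interior_smul_left (0 : ℝ) (0 : MultivectorField J N k) η
  have h' : interior P (0 : GradedForm J N) = 0 := by
    simpa using interior_smul_right P (0 : ℝ) (0 : GradedForm J N)
  simp [h, h', lieDeriv, extD_zero]

theorem IsSchoutenBracket.add [J.Boundaryless] {p q r : ℕ} (hr : r + 1 = p + q)
    {P : MultivectorField J N p} {Q Q' : MultivectorField J N q} {R R' : MultivectorField J N r}
    (hQ : IsSmoothMultivector Q) (hQ' : IsSmoothMultivector Q')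
    (h : IsSchoutenBracket P Q R) (h' : IsSchoutenBracket P Q' R') :
    IsSchoutenBracket P (Q + Q') (R + R') := fun f => by
  have e : ∀ Q : MultivectorField J N q, lieDeriv P (interior Q (exactForm f)) =
      interior P (extD (interior Q (exactForm f))) := fun Q => by
    rw [lieDeriv, interior_interior_exactForm hr, extD_zero, smul_zero, sub_zero]
  rw [interior_add_left, h f, h' f, e, e, e, interior_add_left, interior_add_left,
    extD_add (fun n => hQ r f n) (fun n => hQ' r f n), interior_add_right, smul_add]
  abel

/-- The smooth multivector fields `P` of degree `p` with `[ξ, P] = c P`, for a vector field `ξ`. -/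
def homogeneousMultivector [J.Boundaryless] (ξ : MultivectorField J N 1) (p : ℕ) (c : ℝ) :
    Submodule ℝ (MultivectorField J N p) where
  carrier := {P | IsSmoothMultivector P ∧ IsSchoutenBracket ξ P (c • P)}
  add_mem' {P Q} hP hQ := by
    refine ⟨hP.1.add hQ.1, ?_⟩
    rw [smul_add]
    exact hP.2.add (Nat.add_comm p 1) hP.1 hQ.1 hQ.2
  zero_mem' := by
    refine ⟨IsSmoothMultivector.zero, ?_⟩
    rw [smul_zero]
    exact IsSchoutenBracket.zero _
  smul_mem' a P hP := by
    refine ⟨hP.1.smul a, ?_⟩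
    rw [smul_comm]
    exact hP.2.smul a

end Manifold

/-! ### Vector bundles: sections, the dual bundle, linear multivector fields -/

section VectorBundle

variable {EM : Type*} [NormedAddCommGroup EM] [NormedSpace ℝ EM]
  {HM : Type*} [TopologicalSpace HM] {I : ModelWithCorners ℝ EM HM}
  {M : Type*} [TopologicalSpace M] [ChartedSpace HM M]
  {F : Type*} [NormedAddCommGroup F] [NormedSpace ℝ F]
  {E : M → Type*} [∀ x, AddCommGroup (E x)] [∀ x, Module ℝ (E x)]
  [TopologicalSpace (Bundle.TotalSpace F E)] [∀ x, TopologicalSpace (E x)]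
  [FiberBundle F E] [VectorBundle ℝ F E]

/-- The smooth sections form a module over the smooth functions. -/
instance : SMul C^∞⟮I, M; 𝓘(ℝ, ℝ), ℝ⟯ Cₛ^∞⟮I; F, E⟯ where
  smul f s := ⟨fun x => f x • s x, f.contMDiff.smul_section s.contMDiff⟩

theorem smul_section_apply (f : C^∞⟮I, M; 𝓘(ℝ, ℝ), ℝ⟯) (s : Cₛ^∞⟮I; F, E⟯) (x : M) :
    (f • s) x = f x • s x := rfl

instance : Module C^∞⟮I, M; 𝓘(ℝ, ℝ), ℝ⟯ Cₛ^∞⟮I; F, E⟯ where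
  one_smul s := ContMDiffSection.ext fun x => one_smul ℝ (s x)
  mul_smul f g s := ContMDiffSection.ext fun x => mul_smul (f x) (g x) (s x)
  smul_zero f := ContMDiffSection.ext fun x => smul_zero (f x)
  smul_add f s t := ContMDiffSection.ext fun x => smul_add (f x) (s x) (t x)
  add_smul f g s := ContMDiffSection.ext fun x => add_smul (f x) (g x) (s x)
  zero_smul s := ContMDiffSection.ext fun x => zero_smul ℝ (s x)

variable (E) in
/-- The fibres of the dual bundle `E*`. -/
abbrev DualFiber (x : M) : Type _ := E x →L[ℝ] Bundle.Trivial M ℝ x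

variable (F E) in
/-- The total space of the dual bundle `E*`. -/
abbrev DualTotal : Type _ := Bundle.TotalSpace (F →L[ℝ] ℝ) (DualFiber E)

variable (I F) in
/-- The model of the manifold `E*`. -/
abbrev dualModel : ModelWithCorners ℝ (EM × (F →L[ℝ] ℝ)) (ModelProd HM (F →L[ℝ] ℝ)) :=
  I.prod 𝓘(ℝ, F →L[ℝ] ℝ)

variable [IsManifold I ∞ M] [ContMDiffVectorBundle ∞ F E I]

/-- The fibrewise linear function `ŝ` on `E*` given by a section `s` of `E`. -/
def hat (s : Cₛ^∞⟮I; F, E⟯) : C^∞⟮dualModel I F, DualTotal F E; 𝓘(ℝ, ℝ), ℝ⟯ where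
  val v := v.2 (s v.1)
  property := by
    have h1 : ContMDiff (dualModel I F) (I.prod 𝓘(ℝ, F →L[ℝ] ℝ)) ∞
        (fun v : DualTotal F E => Bundle.TotalSpace.mk' (F →L[ℝ] ℝ) (E := DualFiber E) v.1 v.2) :=
      contMDiff_id
    have h2 : ContMDiff (dualModel I F) (I.prod 𝓘(ℝ, F)) ∞
        (fun v : DualTotal F E => Bundle.TotalSpace.mk' F v.1 (s v.1)) :=
      s.contMDiff.comp (Bundle.contMDiff_proj (DualFiber E))
    have h3 := h1.clm_bundle_apply h2
    intro v
    have := (Bundle.contMDiffAt_totalSpace.1 (h3 v)).2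
    simpa using this

/-- The Euler vector field on `E*`: its value at `v` is the velocity of `t ↦ eᵗ v` at `t = 0`. -/
def euler : MultivectorField (dualModel I F) (DualTotal F E) 1 := fun v =>
  exteriorPower.ιMulti ℝ 1 fun _ =>
    (mfderiv 𝓘(ℝ, ℝ) (dualModel I F)
      (fun t : ℝ => (⟨v.1, Real.exp t • v.2⟩ : DualTotal F E)) 0
      ((NormedSpace.fromTangentSpace (0 : ℝ)).symm 1) :)

variable (I F E) in
/-- The space `𝔛^{k, 1-k}(E*)` of linear multivector fields of degree `k` on `E*`: the smooth
multivector fields `P` with `L_ξ P = [ξ, P] = (1 - k) P`, where `ξ` is the Euler vector field. -/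
def linearMultivector [I.Boundaryless] (k : ℕ) :
    Submodule ℝ (MultivectorField (dualModel I F) (DualTotal F E) k) :=
  homogeneousMultivector euler k (1 - k)

/-- The cocycles of degree `k` of the complex of linear multivector fields with differential
`[π₀, ·]`. -/
def poissonCocycles [I.Boundaryless] (π₀ : linearMultivector I F E 2) (k : ℕ) :
    Submodule ℝ (linearMultivector I F E k) where
  carrier := {P | IsSchoutenBracket π₀.1 P.1 (0 : MultivectorField _ _ (k + 1))}
  add_mem' {P Q} hP hQ := by
    have := IsSchoutenBracket.add (by omega) P.2.1 Q.2.1 hP hQ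
    rwa [add_zero] at this
  zero_mem' := IsSchoutenBracket.zero _
  smul_mem' c P hP := by
    have := IsSchoutenBracket.smul hP c
    rwa [smul_zero] at this

/-- The coboundaries of degree `k`: the linear multivector fields of the form `[π₀, P]`. -/
def poissonCoboundaries [I.Boundaryless] (π₀ : linearMultivector I F E 2) :
    ∀ k : ℕ, Submodule ℝ (linearMultivector I F E k)
  | 0 => ⊥
  | k + 1 =>
    { carrier := {R | ∃ P : linearMultivector I F E k, IsSchoutenBracket π₀.1 P.1 R.1}
      add_mem' := fun {_ _} ⟨P, hP⟩ ⟨Q, hQ⟩ =>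
        ⟨P + Q, IsSchoutenBracket.add (by omega) P.2.1 Q.2.1 hP hQ⟩
      zero_mem' := ⟨0, IsSchoutenBracket.zero _⟩
      smul_mem' := fun c _ ⟨P, hP⟩ => ⟨c • P, IsSchoutenBracket.smul hP c⟩ }

/-- The linear Poisson cohomology `H^k_{π,lin}(E*)`, cocycles modulo coboundaries. -/
abbrev PoissonCohomology [I.Boundaryless] (π₀ : linearMultivector I F E 2) (k : ℕ) : Type _ :=
  poissonCocycles π₀ k ⧸ (poissonCoboundaries π₀ k).submoduleOf (poissonCocycles π₀ k)

end VectorBundle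

/-! ### Multiderivations -/

section Multiderivation

variable {EM : Type*} [NormedAddCommGroup EM] [NormedSpace ℝ EM]
  {HM : Type*} [TopologicalSpace HM] {I : ModelWithCorners ℝ EM HM}
  {M : Type*} [TopologicalSpace M] [ChartedSpace HM M] [IsManifold I ∞ M]
  {F : Type*} [NormedAddCommGroup F] [NormedSpace ℝ F]
  {E : M → Type*} [∀ x, AddCommGroup (E x)] [∀ x, Module ℝ (E x)]
  [TopologicalSpace (Bundle.TotalSpace F E)] [∀ x, TopologicalSpace (E x)]
  [FiberBundle F E] [VectorBundle ℝ F E]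

/-- `σ` is a symbol of the alternating map `D` with `n + 1` arguments:
`D(s₁, …, sₙ, f s) = f D(s₁, …, sₙ, s) + σ(s₁, …, sₙ)(f) s`. Here `σ` is alternating and
`C^∞(M)`-multilinear with values in the smooth vector fields on `M`. -/
def IsSymbol {n : ℕ}
    (D : Cₛ^∞⟮I; F, E⟯ [⋀^Fin (n + 1)]→ₗ[ℝ] Cₛ^∞⟮I; F, E⟯)
    (σ : Cₛ^∞⟮I; F, E⟯ [⋀^Fin n]→ₗ[C^∞⟮I, M; 𝓘(ℝ, ℝ), ℝ⟯]
      Cₛ^∞⟮I; EM, (TangentSpace I : M → Type _)⟯) : Prop :=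
  ∀ (s : Fin n → Cₛ^∞⟮I; F, E⟯) (f : C^∞⟮I, M; 𝓘(ℝ, ℝ), ℝ⟯) (t : Cₛ^∞⟮I; F, E⟯) (x : M),
    D (Fin.snoc s (f • t)) x =
      f x • D (Fin.snoc s t) x + mvfderiv I f x (σ s x) • t x

variable (I F E) in
/-- The space `Der^{k-1}(E)` of multiderivations with `k` arguments: the alternating maps with a
symbol, and all sections of `E` (as alternating maps without arguments) for `k = 0`. -/
def multiDer : ∀ k : ℕ, Submodule ℝ (Cₛ^∞⟮I; F, E⟯ [⋀^Fin k]→ₗ[ℝ] Cₛ^∞⟮I; F, E⟯)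
  | 0 => ⊤
  | n + 1 =>
    { carrier := {D | ∃ σ, IsSymbol D σ}
      add_mem' := by
        rintro D D' ⟨σ, hσ⟩ ⟨σ', hσ'⟩
        refine ⟨σ + σ', fun s f t x => ?_⟩
        simp only [AlternatingMap.add_apply, ContMDiffSection.coe_add, Pi.add_apply, hσ s f t x,
          hσ' s f t x, smul_add, map_add, add_smul]
        abel
      zero_mem' := ⟨0, fun s f t x => by simp⟩
      smul_mem' := by
        rintro c D ⟨σ, hσ⟩
        refine ⟨algebraMap ℝ C^∞⟮I, M; 𝓘(ℝ, ℝ), ℝ⟯ c • σ, fun s f t x => ?_⟩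
        have h : mvfderiv I f x ((algebraMap ℝ C^∞⟮I, M; 𝓘(ℝ, ℝ), ℝ⟯ c • σ) s x) =
            c • mvfderiv I f x (σ s x) := (mvfderiv I f x).map_smul c (σ s x)
        rw [h]
        change c • D (Fin.snoc s (f • t)) x = f x • c • D (Fin.snoc s t) x + _
        rw [hσ s f t x, smul_add, smul_comm c (f x), smul_assoc] }

/-- The differential `δ_m = [m, ·]`. -/
def cmDifferential (m : multiDer I F E 2) (k : ℕ) :
    (Cₛ^∞⟮I; F, E⟯ [⋀^Fin k]→ₗ[ℝ] Cₛ^∞⟮I; F, E⟯) →ₗ[ℝ]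
      Cₛ^∞⟮I; F, E⟯ [⋀^Fin (k + 1)]→ₗ[ℝ] Cₛ^∞⟮I; F, E⟯ where
  toFun D := cmBracket (by omega) m.1 D
  map_add' D D' := cmBracket_add_right _ m.1 D D'
  map_smul' c D := cmBracket_smul_right _ c m.1 D

/-- The multiderivations `D` with `k` arguments and `δ_m D = 0`. -/
def cmCocycles (m : multiDer I F E 2) (k : ℕ) :
    Submodule ℝ (Cₛ^∞⟮I; F, E⟯ [⋀^Fin k]→ₗ[ℝ] Cₛ^∞⟮I; F, E⟯) :=
  multiDer I F E k ⊓ LinearMap.ker (cmDifferential m k)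

/-- The coboundaries with `k` arguments: the maps `δ_m D` for multiderivations `D`. -/
def cmCoboundaries (m : multiDer I F E 2) :
    ∀ k : ℕ, Submodule ℝ (Cₛ^∞⟮I; F, E⟯ [⋀^Fin k]→ₗ[ℝ] Cₛ^∞⟮I; F, E⟯)
  | 0 => ⊥
  | k + 1 => (multiDer I F E k).map (cmDifferential m k)

/-- The cohomology `H^{k-1}_{m,CM}(E)` of the complex of multiderivations with differential
`[m, ·]` at the multiderivations with `k` arguments, cocycles modulo coboundaries. -/
abbrev CMCohomology (m : multiDer I F E 2) (k : ℕ) : Type _ :=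
  cmCocycles m k ⧸ (cmCoboundaries m k).submoduleOf (cmCocycles m k)

end Multiderivation
end LinearPoisson

end

/-!
The idea of the proof is to treat multivector fields as alternating multiderivations of the algebra
of smooth functions, and to restrict them to the fibrewise linear functions `ŝ`.

*Brackets as insertion products.* On any manifold, a smooth multivector field `P` of degree `p`
gives the alternating map `(f₁, …, fₚ) ↦ i_P (df₁ ∧ … ∧ dfₚ)` of `C^∞(N)` (`toAlt`), and it is
determined by this map (`multivectorField_ext`). Contraction with a product of exact forms is a sum
over shuffles (`contract_wedgeForm`), so that `i_P d i_Q` becomes the insertion product of the two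
alternating maps (`interior_extD_interior`), and the Schouten bracket becomes their graded commutator
(`isSchoutenBracket_iff_evalOn`). It exists because this commutator depends on the differentials of
its arguments only: the symbol `i_P (α ∧ ·) - (-1)ᵖ α ∧ i_P` of `L_P` is again a contraction and
hence supercommutes with contractions (`lieSymbol_contract`, `schouten_fun_smul`,
`bracketAlt_eq_zero`).

*Linear multivector fields.* The bracket with the Euler vector field `ξ` evaluates on the `ŝ` to
`ξ(P(ŝ₁, …, ŝₖ)) - k P(ŝ₁, …, ŝₖ)`. Therefore `P` is linear if and only if `P(ŝ₁, …, ŝₖ)` is an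
eigenfunction of `ξ` with eigenvalue `1` for all sections, that is a smooth function homogeneous of
degree one on the fibres, hence fibrewise linear (`isFiberLinear_of_evalOn_euler`,
`mem_linearMultivector_iff`). Here it is used that off the zero section the `dŝ` span the cotangent
spaces, so that by continuity the values on the `ŝ` determine `P` (`multivector_eq_zero_of_hat`;
this needs a fibre of positive dimension). Since fibrewise linear functions are the functions `ŝ`
(`exists_hat_eq`), `P` restricts to an alternating map of sections (`toSectionAlt`). Its symbol is
`P(ŝ₁, …, ŝₙ, π^* f)`, evaluated on the zero section (`toSectionAlt_snoc_smul`).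

*Surjectivity.* The covectors `dŝ + d(π^* f)` exhaust the cotangent space at every point of `E*`.
A multiderivation `D` with symbol `σ` extends to an alternating map of the pairs `(s, f)` with the
values `D(s₁, …)` on sections, `σ(s₁, …)(f)` on sections and one function, and zero if there are two
functions (`extendedAlt`). If `dŝ + d(π^* f)` vanishes at `v`, then `s` vanishes at the base point,
and the Leibniz rule for `D` shows that the extension vanishes on `(s, f)`
(`extendedAlt_cons_eq_zero`). The extension therefore descends to an alternating map of covectors,
which is the pairing with a multivector.

*Brackets and cohomology.* The map `s ↦ ŝ` intertwines the insertion products, so the Schouten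
bracket corresponds to the Crainic–Moerdijk bracket up to the sign `(-1)^((p-1)(q-1))`
(`exists_schouten_linear`). Cocycles and coboundaries correspond, the sign of the differential being
irrelevant for them (`cohomologyEquiv`). The exponents `p - 1` are written as `p + 1`, which has the
same parity.
-/


noncomputable section

set_option linter.unusedSectionVars false

namespace LinearPoisson

/-! ### Representatives of shuffles -/

section Shuffle

/-- The `(a, b)`-shuffles, encoded as permutations modulo permutations of the two blocks. -/
abbrev Shuffle (a b : ℕ) : Type := Equiv.Perm.ModSumCongr (Fin a) (Fin b)

instance (a b : ℕ) : Fintype (Shuffle a b) :=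
  inferInstanceAs (Fintype (_ ⧸ _))

/-- The first block of (a representative of) a shuffle. -/
def Shuffle.left {a b : ℕ} (q : Shuffle a b) (i : Fin a) : Fin (a + b) :=
  finSumFinEquiv (Quotient.out q (Sum.inl i))

/-- The second block of (a representative of) a shuffle. -/
def Shuffle.right {a b : ℕ} (q : Shuffle a b) (i : Fin b) : Fin (a + b) :=
  finSumFinEquiv (Quotient.out q (Sum.inr i))

/-- The sign of the chosen representative of a shuffle. -/
def Shuffle.sign {a b : ℕ} (q : Shuffle a b) : ℤˣ := Equiv.Perm.sign (Quotient.out q)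

/-- The exterior product of two alternating maps as a sum over shuffles, each evaluated at its chosen
representative. -/
theorem domCoprod_apply_shuffle {X N₁ N₂ N₃ : Type*} [AddCommGroup X] [Module ℝ X]
    [AddCommGroup N₁] [Module ℝ N₁] [AddCommGroup N₂] [Module ℝ N₂]
    [AddCommGroup N₃] [Module ℝ N₃] {a b : ℕ} (f : X [⋀^Fin a]→ₗ[ℝ] N₁)
    (g : X [⋀^Fin b]→ₗ[ℝ] N₂) (L : TensorProduct ℝ N₁ N₂ →ₗ[ℝ] N₃) (x : Fin (a + b) → X) :
    L (f.domCoprod g (x ∘ finSumFinEquiv)) =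
      ∑ q : Shuffle a b, q.sign • L (f (x ∘ q.left) ⊗ₜ[ℝ] g (x ∘ q.right)) := by
  rw [AlternatingMap.domCoprod_apply, sum_apply, map_sum]
  refine Fintype.sum_congr _ _ fun q => ?_
  conv_lhs => rw [← Quotient.out_eq' q, AlternatingMap.domCoprod.summand_mk'']
  simp only [smul_apply, MultilinearMap.domDomCongr_apply, MultilinearMap.domCoprod_apply]
  rw [LinearMap.map_smul_of_tower]
  rfl

theorem insertion_apply_shuffle {X : Type*} [AddCommGroup X] [Module ℝ X] {m b : ℕ}
    (h : b + m + 1 = (m + 1) + b) (f : X [⋀^Fin (m + 1)]→ₗ[ℝ] X) (g : X [⋀^Fin b]→ₗ[ℝ] X)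
    (x : Fin (b + m) → X) :
    insertion h f g x =
      ∑ q : Shuffle b m, q.sign • f (Matrix.vecCons (g (x ∘ q.left)) (x ∘ q.right)) :=
  domCoprod_apply_shuffle g (flipFirst f)
    (TensorProduct.lift (LinearMap.id (R := ℝ) (M := Module.End ℝ X)).flip) x

/-- Insertion is natural for linear maps intertwining the two pairs of maps. -/
theorem map_insertion {X Y : Type*} [AddCommGroup X] [Module ℝ X] [AddCommGroup Y] [Module ℝ Y]
    (T : X →ₗ[ℝ] Y) {a b r : ℕ} (h : r + 1 = a + b) {f : X [⋀^Fin a]→ₗ[ℝ] X}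
    {g : X [⋀^Fin b]→ₗ[ℝ] X} {f' : Y [⋀^Fin a]→ₗ[ℝ] Y} {g' : Y [⋀^Fin b]→ₗ[ℝ] Y}
    (hf : ∀ x, T (f x) = f' (T ∘ x)) (hg : ∀ x, T (g x) = g' (T ∘ x)) (x : Fin r → X) :
    T (insertion h f g x) = insertion h f' g' (T ∘ x) := by
  cases a with
  | zero => simp [insertion_zero_left]
  | succ m =>
    obtain rfl : r = b + m := by omega
    rw [insertion_apply_shuffle, insertion_apply_shuffle, map_sum]
    refine Fintype.sum_congr _ _ fun q => ?_
    rw [LinearMap.map_smul_of_tower, hf]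
    congr 2
    funext i
    refine Fin.cases ?_ (fun i => ?_) i
    · exact hg _
    · rfl

end Shuffle

/-! ### Pointwise algebra of multivectors -/

section Pointwise

variable {V : Type*} [AddCommGroup V] [Module ℝ V] [TopologicalSpace V]

/-- The form `α₁ ∧ … ∧ αᵣ` as an element of the graded space of forms. -/
def wedgeForm {r : ℕ} (α : Fin r → V →L[ℝ] ℝ) : ∀ n : ℕ, V [⋀^Fin n]→L[ℝ] ℝ := fun n =>
  if h : n = r then wedge (fun i : Fin n => α (Fin.cast h i)) else 0

theorem wedgeForm_self {r : ℕ} (α : Fin r → V →L[ℝ] ℝ) : wedgeForm α r = wedge α := by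
  simp [wedgeForm]

theorem wedgeForm_of_ne {r n : ℕ} (α : Fin r → V →L[ℝ] ℝ) (h : n ≠ r) : wedgeForm α n = 0 := by
  simp [wedgeForm, h]

/-- Contraction with `x₁ ∧ … ∧ xₚ` inserts the vectors in reversed order, since `i_{xₚ}` is the first
operator to be applied. -/
theorem contract_ιMulti_apply {p : ℕ} (x : Fin p → V) (η : ∀ n : ℕ, V [⋀^Fin n]→L[ℝ] ℝ) (n : ℕ)
    (v : Fin n → V) :
    contract (ExteriorAlgebra.ιMulti ℝ p x) η n v = η (p + n) (Fin.append (x ∘ Fin.rev) v) := by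
  have cast : ∀ {a b : ℕ} (h : a = b) (w : Fin b → V), η a (w ∘ Fin.cast h) = η b w := by
    rintro a _ rfl w; rfl
  induction p generalizing n with
  | zero =>
    have : contract (ExteriorAlgebra.ιMulti ℝ 0 x) η n v = η n v := by
      simp [ExteriorAlgebra.ιMulti_zero_apply]
    rw [this, ← cast (Nat.zero_add n).symm]
    congr 1
    funext i
    simp [Fin.append, Fin.addCases]
  | succ p ih =>
    rw [contract_ιMulti_succ]
    change contract (ExteriorAlgebra.ιMulti ℝ p (Matrix.vecTail x)) η (n + 1)
      (Matrix.vecCons (x 0) v) = _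
    rw [ih]
    have e : x ∘ Fin.rev = Fin.snoc (α := fun _ => V) (Matrix.vecTail x ∘ Fin.rev) (x 0) := by
      funext i
      refine Fin.lastCases ?_ (fun i => ?_) i
      · simp
      · simp [Matrix.vecTail, Fin.rev_castSucc]
    rw [e, Fin.append_left_snoc, ← cast (by omega : p + 1 + n = p + (n + 1))]
    rfl

/-- The pairing of a multivector with `p` covectors, `i_P (α₁ ∧ … ∧ αₚ)`. -/
def pair (P : ExteriorAlgebra ℝ V) {p : ℕ} (α : Fin p → V →L[ℝ] ℝ) : ℝ :=
  contract P (wedgeForm α) 0 ![]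

theorem pair_ιMulti {p : ℕ} (x : Fin p → V) (α : Fin p → V →L[ℝ] ℝ) :
    pair (ExteriorAlgebra.ιMulti ℝ p x) α =
      Matrix.det (Matrix.of fun i j => α j (x (Fin.rev i))) := by
  rw [pair, contract_ιMulti_apply]
  have : (Fin.append (x ∘ Fin.rev) ![] : Fin (p + 0) → V) = x ∘ Fin.rev := by
    funext i
    exact Fin.append_left (x ∘ Fin.rev) ![] i
  rw [this]
  change wedgeForm α p _ = _
  rw [wedgeForm_self, wedge_apply]
  rfl

/-- For fixed vectors `wᵢ`, the determinant `det (αⱼ(wᵢ))` as an alternating map of the covectors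
`αⱼ`. -/
def detCovector {ι : Type*} [Fintype ι] [DecidableEq ι] (w : ι → V) : (V →L[ℝ] ℝ) [⋀^ι]→ₗ[ℝ] ℝ :=
  (Matrix.detRowAlternating (R := ℝ) (n := ι)).compLinearMap
    (LinearMap.pi fun i => ContinuousLinearMap.coeLM ℝ |>.flip (w i))

theorem detCovector_apply {ι : Type*} [Fintype ι] [DecidableEq ι] (w : ι → V)
    (α : ι → V →L[ℝ] ℝ) : detCovector w α = Matrix.det (Matrix.of fun i j => α j (w i)) := by
  rw [← Matrix.det_transpose]
  rfl

theorem detCovector_eq_alternatization {ι : Type*} [Fintype ι] [DecidableEq ι] (w : ι → V) :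
    detCovector w = MultilinearMap.alternatization
      ((MultilinearMap.mkPiAlgebra ℝ ι ℝ).compLinearMap
        fun i => ContinuousLinearMap.coeLM ℝ |>.flip (w i)) := by
  ext α
  simp only [detCovector, AlternatingMap.compLinearMap_apply, Matrix.detRowAlternating,
    MultilinearMap.alternatization_apply]
  rfl

/-- Laplace expansion of a determinant along a block of rows. -/
theorem detCovector_sum {a b : ℕ} (w : Fin a ⊕ Fin b → V) (α : Fin (a + b) → V →L[ℝ] ℝ) :
    detCovector w (α ∘ finSumFinEquiv) = ∑ q : Shuffle a b, q.sign •
      (detCovector (w ∘ Sum.inl) (α ∘ q.left) * detCovector (w ∘ Sum.inr) (α ∘ q.right)) := by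
  have key : detCovector w = (LinearMap.mul' ℝ ℝ).compAlternatingMap
      ((detCovector (w ∘ Sum.inl)).domCoprod (detCovector (w ∘ Sum.inr))) := by
    rw [detCovector_eq_alternatization, detCovector_eq_alternatization,
      detCovector_eq_alternatization, ← MultilinearMap.domCoprod_alternization,
      ← LinearMap.compMultilinearMap_alternatization]
    congr 1
    ext α
    simp [Fintype.prod_sum_type]
  rw [key]
  exact domCoprod_apply_shuffle _ _ (LinearMap.mul' ℝ ℝ) α

/-- The Laplace expansion of `(α₁ ∧ … ∧ αₙ)(x, v)`. -/
theorem wedge_append {a b : ℕ} (x : Fin a → V) (v : Fin b → V) (α : Fin (a + b) → V →L[ℝ] ℝ) :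
    wedge α (Fin.append x v) = ∑ q : Shuffle a b, q.sign •
      (detCovector x (α ∘ q.left) * wedge (α ∘ q.right) v) := by
  have h := detCovector_sum (Sum.elim x v) α
  have h2 : detCovector (Sum.elim x v) (α ∘ finSumFinEquiv) = wedge α (Fin.append x v) := by
    rw [detCovector_apply, wedge_apply, ← Matrix.det_reindex_self finSumFinEquiv.symm]
    congr 1
    ext i j
    rcases i with i | i <;> simp [Matrix.reindex]
  rw [← h2, h]
  simp only [Sum.elim_comp_inl, Sum.elim_comp_inr]
  simp only [detCovector_apply v]
  rfl

/-- Contraction of a decomposable form, as a sum over shuffles. -/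
theorem contract_wedgeForm {p : ℕ} {P : ExteriorAlgebra ℝ V} (hP : P ∈ ⋀[ℝ]^p V) {n : ℕ}
    (α : Fin (p + n) → V →L[ℝ] ℝ) :
    contract P (wedgeForm α) n =
      ∑ q : Shuffle p n, (q.sign • pair P (α ∘ q.left)) • wedge (α ∘ q.right) := by
  rw [← ExteriorAlgebra.ιMulti_span_fixedDegree] at hP
  induction hP using Submodule.span_induction with
  | mem P hP =>
    obtain ⟨x, rfl⟩ := hP
    ext v
    rw [contract_ιMulti_apply, wedgeForm_self, wedge_append]
    simp only [ContinuousAlternatingMap.sum_apply, ContinuousAlternatingMap.smul_apply,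
      pair_ιMulti, detCovector_apply, smul_assoc, smul_eq_mul]
    rfl
  | zero => simp [pair]
  | add P Q _ _ hP hQ =>
    simp only [pair, map_add, LinearMap.add_apply, Pi.add_apply,
      ContinuousAlternatingMap.add_apply, smul_add, add_smul, Finset.sum_add_distrib] at *
    rw [hP, hQ]
  | smul c P _ hP =>
    simp only [pair, map_smul, LinearMap.smul_apply, Pi.smul_apply,
      ContinuousAlternatingMap.smul_apply] at *
    rw [hP, Finset.smul_sum]
    refine Finset.sum_congr rfl fun q _ => ?_
    rw [smul_smul, smul_comm, smul_eq_mul, mul_smul_comm, ← smul_eq_mul]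

theorem pair_add (P Q : ExteriorAlgebra ℝ V) {p : ℕ} (α : Fin p → V →L[ℝ] ℝ) :
    pair (P + Q) α = pair P α + pair Q α := by simp [pair]

theorem pair_smul (c : ℝ) (P : ExteriorAlgebra ℝ V) {p : ℕ} (α : Fin p → V →L[ℝ] ℝ) :
    pair (c • P) α = c * pair P α := by simp [pair]

theorem wedge_eq_detCovector {n : ℕ} (α : Fin n → V →L[ℝ] ℝ) (v : Fin n → V) :
    wedge α v = detCovector v α := (detCovector_apply v α).symm

/-- `wedgeForm`, as an alternating map of the covectors. -/
def wedgeFormAlt (r : ℕ) : (V →L[ℝ] ℝ) [⋀^Fin r]→ₗ[ℝ] (∀ n : ℕ, V [⋀^Fin n]→L[ℝ] ℝ) where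
  toFun := wedgeForm
  map_update_add' α i x y := by
    funext n
    by_cases h : n = r
    · subst h
      ext v
      simp only [Pi.add_apply, wedgeForm_self, ContinuousAlternatingMap.add_apply,
        wedge_eq_detCovector]
      convert! (detCovector v).map_update_add α i x y
    · simp [wedgeForm_of_ne _ h]
  map_update_smul' α i c x := by
    funext n
    by_cases h : n = r
    · subst h
      ext v
      simp only [Pi.smul_apply, wedgeForm_self, ContinuousAlternatingMap.smul_apply,
        wedge_eq_detCovector]
      convert! (detCovector v).map_update_smul α i c x
    · simp [wedgeForm_of_ne _ h]
  map_eq_zero_of_eq' α i j h hij := by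
    funext n
    by_cases hn : n = r
    · subst hn
      ext v
      rw [wedgeForm_self, wedge_eq_detCovector]
      exact (detCovector v).map_eq_zero_of_eq α h hij
    · simp [wedgeForm_of_ne _ hn]

/-- The pairing with a multivector, as an alternating map of the covectors. -/
def pairAlt (P : ExteriorAlgebra ℝ V) (p : ℕ) : (V →L[ℝ] ℝ) [⋀^Fin p]→ₗ[ℝ] ℝ :=
  ({ toFun := fun η => contract P η 0 ![]
     map_add' := fun η θ => by simp
     map_smul' := fun c η => by simp } :
    (∀ n : ℕ, V [⋀^Fin n]→L[ℝ] ℝ) →ₗ[ℝ] ℝ).compAlternatingMap (wedgeFormAlt p)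

theorem pairAlt_apply (P : ExteriorAlgebra ℝ V) {p : ℕ} (α : Fin p → V →L[ℝ] ℝ) :
    pairAlt P p α = pair P α := rfl

/-- The pairing is, up to the order of the covectors, the canonical one of exterior powers. -/
theorem pair_eq_pairingDual {p : ℕ} (P : ⋀[ℝ]^p V) (α : Fin p → V →L[ℝ] ℝ) :
    pair (P : ExteriorAlgebra ℝ V) α = exteriorPower.pairingDual ℝ V p
      (exteriorPower.ιMulti ℝ p fun i => (α (Fin.rev i)).toLinearMap) P := by
  let f : ⋀[ℝ]^p V →ₗ[ℝ] ℝ :=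
    { toFun := fun P => pair (P : ExteriorAlgebra ℝ V) α
      map_add' := fun P Q => pair_add _ _ α
      map_smul' := fun c P => pair_smul c _ α }
  suffices h : f = exteriorPower.pairingDual ℝ V p
      (exteriorPower.ιMulti ℝ p fun i => (α (Fin.rev i)).toLinearMap) from
    LinearMap.congr_fun h P
  apply exteriorPower.linearMap_ext
  ext x
  change pair (ExteriorAlgebra.ιMulti ℝ p x) α = _
  rw [pair_ιMulti, LinearMap.compAlternatingMap_apply, exteriorPower.pairingDual_ιMulti_ιMulti,
    ← Matrix.det_reindex_self Fin.revPerm]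
  congr 1
  ext i j
  simp [Matrix.reindex]

section Nondegenerate

variable [IsTopologicalAddGroup V] [ContinuousSMul ℝ V] [T2Space V] [FiniteDimensional ℝ V]

/-- The pairing is nondegenerate. -/
theorem eq_zero_of_pair_eq_zero {p : ℕ} (P : ⋀[ℝ]^p V)
    (h : ∀ α : Fin p → V →L[ℝ] ℝ, pair (P : ExteriorAlgebra ℝ V) α = 0) : P = 0 := by
  let b := Module.finBasis ℝ V
  apply (b.exteriorPower p).repr.injective
  rw [map_zero]
  ext s
  rw [exteriorPower.basis_repr_apply]
  have := h fun i => LinearMap.toContinuousLinearMap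
    (b.coord (Set.powersetCard.ofFinEmbEquiv.symm s (Fin.rev i)))
  rw [pair_eq_pairingDual] at this
  simp only [Fin.rev_rev] at this
  exact this

/-- Every alternating map of covectors is the pairing with a multivector. -/
theorem exists_pair_eq {p : ℕ} (B : (V →L[ℝ] ℝ) [⋀^Fin p]→ₗ[ℝ] ℝ) :
    ∃ P : ⋀[ℝ]^p V, ∀ α, pair (P : ExteriorAlgebra ℝ V) α = B α := by
  let b := Module.finBasis ℝ V
  let c : Module.Basis _ ℝ (V →L[ℝ] ℝ) := b.dualBasis.map LinearMap.toContinuousLinearMap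
  have hc : ∀ i, ((c i).toLinearMap : Module.Dual ℝ V) = b.coord i := fun i => by
    ext v; simp [c]
  let P : ⋀[ℝ]^p V := ∑ s, B (fun i => c (Set.powersetCard.ofFinEmbEquiv.symm s (Fin.rev i))) •
    b.exteriorPower p s
  refine ⟨P, fun α => ?_⟩
  rw [← pairAlt_apply]
  suffices h : (pairAlt (P : ExteriorAlgebra ℝ V) p).domDomCongr Fin.revPerm =
      B.domDomCongr Fin.revPerm by
    have := congrArg (fun k => k (α ∘ Fin.revPerm)) h
    simpa [AlternatingMap.domDomCongr_apply, Function.comp_def] using this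
  apply exteriorPower.alternatingMapLinearEquiv.injective
  apply LinearMap.ext_on (exteriorPower.ιMulti_family_span_of_span ℝ (n := p) c.span_eq)
  rintro _ ⟨s, rfl⟩
  rw [exteriorPower.ιMulti_family, exteriorPower.alternatingMapLinearEquiv_apply_ιMulti,
    exteriorPower.alternatingMapLinearEquiv_apply_ιMulti, AlternatingMap.domDomCongr_apply,
    AlternatingMap.domDomCongr_apply, pairAlt_apply, pair_eq_pairingDual]
  have h1 : (exteriorPower.ιMulti ℝ p fun i : Fin p =>
      ((c (Set.powersetCard.ofFinEmbEquiv.symm s (Fin.revPerm (Fin.rev i)))).toLinearMap :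
        Module.Dual ℝ V)) =
      exteriorPower.ιMulti_family ℝ p b.coord s := by
    rw [exteriorPower.ιMulti_family]
    congr 1
    funext i
    simp [hc]
  have h2 : exteriorPower.pairingDual ℝ V p (exteriorPower.ιMulti_family ℝ p b.coord s) P =
      (b.exteriorPower p).repr P s := by
    rw [exteriorPower.basis_repr_apply]; rfl
  refine (congrArg (fun k => exteriorPower.pairingDual ℝ V p k P) h1).trans (h2.trans ?_)
  simp only [P, Module.Basis.repr_sum_self]
  rfl

end Nondegenerate

/-! ### Exterior multiplication by a covector -/

/-- The form `α ∧ θ`. -/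
def wedgeLeft {n : ℕ} (α : V →L[ℝ] ℝ) (θ : V [⋀^Fin n]→L[ℝ] ℝ) : V [⋀^Fin (n + 1)]→L[ℝ] ℝ where
  __ := AlternatingMap.alternatizeUncurryFin (α.toLinearMap.smulRight θ.toAlternatingMap)
  cont := by
    change Continuous fun v => AlternatingMap.alternatizeUncurryFin
      (α.toLinearMap.smulRight θ.toAlternatingMap) v
    simp only [AlternatingMap.alternatizeUncurryFin_apply]
    refine continuous_finsetSum _ fun i _ => ?_
    have h : Continuous fun v : Fin (n + 1) → V => α (v i) * θ (i.removeNth v) :=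
      (α.cont.comp (continuous_apply i)).mul
        (θ.cont.comp (continuous_pi fun j => continuous_apply _))
    exact h.const_smul ((-1 : ℤ) ^ (i : ℕ))

theorem wedgeLeft_apply {n : ℕ} (α : V →L[ℝ] ℝ) (θ : V [⋀^Fin n]→L[ℝ] ℝ) (v : Fin (n + 1) → V) :
    wedgeLeft α θ v = ∑ i : Fin (n + 1), (-1 : ℝ) ^ (i : ℕ) * (α (v i) * θ (i.removeNth v)) := by
  change AlternatingMap.alternatizeUncurryFin (α.toLinearMap.smulRight θ.toAlternatingMap) v = _
  rw [AlternatingMap.alternatizeUncurryFin_apply]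
  refine Finset.sum_congr rfl fun i _ => ?_
  simp [zsmul_eq_mul]

/-- Exterior multiplication by a covector from the left, on forms of all degrees. -/
def extMul (α : V →L[ℝ] ℝ) : Module.End ℝ (∀ n : ℕ, V [⋀^Fin n]→L[ℝ] ℝ) where
  toFun η
    | 0 => 0
    | n + 1 => wedgeLeft α (η n)
  map_add' η ζ := by
    funext n
    cases n with
    | zero => simp
    | succ n =>
      ext v
      simp [wedgeLeft_apply, mul_add, Finset.sum_add_distrib]
  map_smul' c η := by
    funext n
    cases n with
    | zero => simp
    | succ n =>
      ext v
      simp only [Pi.smul_apply, ContinuousAlternatingMap.smul_apply, wedgeLeft_apply, smul_eq_mul,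
        RingHom.id_apply, Finset.mul_sum]
      exact Finset.sum_congr rfl fun i _ => by ring

theorem extMul_zero_deg (α : V →L[ℝ] ℝ) (η : ∀ n : ℕ, V [⋀^Fin n]→L[ℝ] ℝ) :
    extMul α η 0 = 0 := rfl

theorem extMul_succ (α : V →L[ℝ] ℝ) (η : ∀ n : ℕ, V [⋀^Fin n]→L[ℝ] ℝ) (n : ℕ) :
    extMul α η (n + 1) = wedgeLeft α (η n) := rfl

theorem wedge_cons {n : ℕ} (α : V →L[ℝ] ℝ) (β : Fin n → V →L[ℝ] ℝ) :
    wedge (Matrix.vecCons α β) = wedgeLeft α (wedge β) := by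
  ext v
  rw [wedge_apply, wedgeLeft_apply, Matrix.det_succ_column_zero]
  exact Finset.sum_congr rfl fun i _ => mul_assoc _ _ _

theorem wedgeForm_cons {r : ℕ} (α : V →L[ℝ] ℝ) (β : Fin r → V →L[ℝ] ℝ) :
    wedgeForm (Matrix.vecCons α β) = extMul α (wedgeForm β) := by
  funext n
  cases n with
  | zero => rw [wedgeForm_of_ne _ (by omega), extMul_zero_deg]
  | succ n =>
    rw [extMul_succ]
    by_cases h : n = r
    · subst h
      rw [wedgeForm_self, wedgeForm_self, wedge_cons]
    · rw [wedgeForm_of_ne _ (by omega), wedgeForm_of_ne _ h]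
      ext v
      simp [wedgeLeft_apply]

/-- The relation `α ∧ i_x + i_x (α ∧ ·) = α(x)`. -/
theorem extMul_contractVector (α : V →L[ℝ] ℝ) (x : V) (η : ∀ n : ℕ, V [⋀^Fin n]→L[ℝ] ℝ) :
    extMul α (contractVector x η) = α x • η - contractVector x (extMul α η) := by
  funext n
  ext v
  change extMul α (contractVector x η) n v = α x * η n v - extMul α η (n + 1) (Matrix.vecCons x v)
  rw [extMul_succ, wedgeLeft_apply, Fin.sum_univ_succ]
  cases n with
  | zero => simp [extMul_zero_deg, Fin.removeNth_zero]
  | succ n =>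
    rw [extMul_succ, wedgeLeft_apply]
    have : ∀ i : Fin (n + 1), (-1 : ℝ) ^ ((i.succ : Fin (n + 2)) : ℕ) *
        (α (Matrix.vecCons x v i.succ) * η (n + 1) (i.succ.removeNth (Matrix.vecCons x v))) =
        -((-1 : ℝ) ^ (i : ℕ) * (α (v i) * contractVector x η n (i.removeNth v))) := by
      intro i
      have h : i.succ.removeNth (Matrix.vecCons x v) = Matrix.vecCons x (i.removeNth v) := by
        funext j
        refine Fin.cases ?_ (fun j => ?_) j
        · rfl
        · simp [Fin.removeNth]
      rw [h, Fin.val_succ, pow_succ]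
      change _ = -(_ * (_ * η (n + 1) (Matrix.vecCons x (i.removeNth v))))
      simp
    rw [Finset.sum_congr rfl fun i _ => this i, Finset.sum_neg_distrib]
    simp [Fin.removeNth_zero]

theorem contract_ι (x : V) : contract (ExteriorAlgebra.ι ℝ x) = contractVector x :=
  ExteriorAlgebra.lift_ι_apply ℝ _ contractVector_mul_self x

/-- The commutation rule `α ∧ i_P = i_{P'} (α ∧ ·) + i_{α ⌋ P}`, where `P'` is the grade involution
of `P`. -/
theorem extMul_contract (α : V →L[ℝ] ℝ) (P : ExteriorAlgebra ℝ V)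
    (η : ∀ n : ℕ, V [⋀^Fin n]→L[ℝ] ℝ) :
    extMul α (contract P η) = contract (CliffordAlgebra.involute P) (extMul α η) +
      contract (CliffordAlgebra.contractLeft (Q := (0 : QuadraticForm ℝ V)) α.toLinearMap P) η := by
  induction P using CliffordAlgebra.left_induction generalizing η with
  | algebraMap r =>
    have h : ∀ ζ, contract (algebraMap ℝ (CliffordAlgebra (0 : QuadraticForm ℝ V)) r) ζ =
        r • ζ := fun ζ => by
      have : contract (algebraMap ℝ (CliffordAlgebra (0 : QuadraticForm ℝ V)) r) =
        algebraMap ℝ (Module.End ℝ (∀ n : ℕ, V [⋀^Fin n]→L[ℝ] ℝ)) r := contract.commutes r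
      rw [this, Module.algebraMap_end_apply]
    have hi : CliffordAlgebra.involute (algebraMap ℝ (CliffordAlgebra (0 : QuadraticForm ℝ V)) r) =
      algebraMap ℝ _ r := AlgHom.commutes _ r
    rw [CliffordAlgebra.contractLeft_algebraMap, hi, h, h, map_smul, map_zero]
    simp
  | add x y hx hy => simp only [map_add, LinearMap.add_apply, hx, hy]; abel
  | ι_mul P x hP =>
    have h1 : ∀ Q ζ, contract ((CliffordAlgebra.ι (0 : QuadraticForm ℝ V)) x * Q) ζ =
        contractVector x (contract Q ζ) := fun Q ζ => by
      rw [map_mul, ← contract_ι]; rfl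
    have h2 : ∀ (Q Q' : CliffordAlgebra (0 : QuadraticForm ℝ V)) ζ,
        contract (Q - Q') ζ = contract Q ζ - contract Q' ζ := fun Q Q' ζ => by
      rw [map_sub]; rfl
    have h3 : ∀ (Q : CliffordAlgebra (0 : QuadraticForm ℝ V)) ζ,
        contract (-Q) ζ = -contract Q ζ := fun Q ζ => by
      rw [map_neg]; rfl
    have hi : CliffordAlgebra.involute (CliffordAlgebra.ι (0 : QuadraticForm ℝ V) x * P) =
        -(CliffordAlgebra.ι (0 : QuadraticForm ℝ V) x * CliffordAlgebra.involute P) := by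
      rw [map_mul, CliffordAlgebra.involute_ι, neg_mul]
    rw [CliffordAlgebra.contractLeft_ι_mul, hi, h3, h2,
      h1, h1, h1, extMul_contractVector, hP, map_add, map_smul]
    change _ = _ + (α x • contract P η - _)
    abel

end Pointwise

section Supercommutative

variable {V : Type*} [AddCommGroup V] [Module ℝ V]

theorem ι_mul_of_mem {q : ℕ} (x : V) {Q : ExteriorAlgebra ℝ V} (hQ : Q ∈ ⋀[ℝ]^q V) :
    ExteriorAlgebra.ι ℝ x * Q = (-1 : ℝ) ^ q • (Q * ExteriorAlgebra.ι ℝ x) := by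
  rw [← ExteriorAlgebra.ιMulti_span_fixedDegree] at hQ
  induction hQ using Submodule.span_induction with
  | mem P hP =>
    obtain ⟨y, rfl⟩ := hP
    induction q with
    | zero => simp [ExteriorAlgebra.ιMulti_zero_apply]
    | succ q ih =>
      rw [ExteriorAlgebra.ιMulti_succ_apply, ← mul_assoc,
        eq_neg_of_add_eq_zero_left (ExteriorAlgebra.ι_add_mul_swap x (y 0)), neg_mul, mul_assoc,
        ih, pow_succ]
      simp [mul_assoc]
  | zero => simp
  | add P Q _ _ hP hQ => rw [mul_add, add_mul, hP, hQ, smul_add]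
  | smul c P _ hP => rw [mul_smul_comm, smul_mul_assoc, hP, smul_comm]

theorem mul_comm_of_mem {p q : ℕ} {P Q : ExteriorAlgebra ℝ V} (hP : P ∈ ⋀[ℝ]^p V)
    (hQ : Q ∈ ⋀[ℝ]^q V) : P * Q = (-1 : ℝ) ^ (p * q) • (Q * P) := by
  rw [← ExteriorAlgebra.ιMulti_span_fixedDegree] at hP
  induction hP using Submodule.span_induction with
  | mem P hP =>
    obtain ⟨y, rfl⟩ := hP
    induction p with
    | zero => simp [ExteriorAlgebra.ιMulti_zero_apply]
    | succ p ih =>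
      rw [ExteriorAlgebra.ιMulti_succ_apply, mul_assoc, ih, mul_smul_comm, ← mul_assoc,
        ι_mul_of_mem _ hQ, smul_mul_assoc, smul_smul, ← pow_add, mul_assoc]
      congr 2
      ring
  | zero => simp
  | add P Q _ _ hP hQ => rw [mul_add, add_mul, hP, hQ, smul_add]
  | smul c P _ hP => rw [mul_smul_comm, smul_mul_assoc, hP, smul_comm]

theorem involute_of_mem {p : ℕ} {P : ExteriorAlgebra ℝ V} (hP : P ∈ ⋀[ℝ]^p V) :
    CliffordAlgebra.involute (Q := (0 : QuadraticForm ℝ V)) P = (-1 : ℝ) ^ p • P := by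
  rw [← ExteriorAlgebra.ιMulti_span_fixedDegree] at hP
  induction hP using Submodule.span_induction with
  | mem P hP =>
    obtain ⟨y, rfl⟩ := hP
    induction p with
    | zero => simp [ExteriorAlgebra.ιMulti_zero_apply]
    | succ p ih =>
      rw [ExteriorAlgebra.ιMulti_succ_apply, map_mul, ih, pow_succ]
      have : CliffordAlgebra.involute (Q := (0 : QuadraticForm ℝ V)) (ExteriorAlgebra.ι ℝ (y 0)) =
          -ExteriorAlgebra.ι ℝ (y 0) := CliffordAlgebra.involute_ι _
      rw [this]
      simp
  | zero => simp
  | add P Q _ _ hP hQ => rw [map_add, hP, hQ, smul_add]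
  | smul c P _ hP => rw [map_smul, hP, smul_comm]

theorem contractLeft_mem {p : ℕ} {P : ExteriorAlgebra ℝ V} (hP : P ∈ ⋀[ℝ]^(p + 1) V)
    (α : Module.Dual ℝ V) :
    CliffordAlgebra.contractLeft (Q := (0 : QuadraticForm ℝ V)) α P ∈ ⋀[ℝ]^p V := by
  rw [← ExteriorAlgebra.ιMulti_span_fixedDegree] at hP
  induction hP using Submodule.span_induction with
  | mem P hP =>
    obtain ⟨y, rfl⟩ := hP
    have hcl : ∀ (x : V) (Q : ExteriorAlgebra ℝ V),
        CliffordAlgebra.contractLeft (Q := (0 : QuadraticForm ℝ V)) α (ExteriorAlgebra.ι ℝ x * Q) =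
          α x • Q - ExteriorAlgebra.ι ℝ x *
            CliffordAlgebra.contractLeft (Q := (0 : QuadraticForm ℝ V)) α Q :=
      fun x Q => CliffordAlgebra.contractLeft_ι_mul _ _ _
    induction p with
    | zero =>
      rw [ExteriorAlgebra.ιMulti_succ_apply, hcl, ExteriorAlgebra.ιMulti_zero_apply]
      have : CliffordAlgebra.contractLeft (Q := (0 : QuadraticForm ℝ V)) α
        (1 : ExteriorAlgebra ℝ V) = 0 := CliffordAlgebra.contractLeft_one (Q := 0) α
      rw [this, mul_zero, sub_zero]
      exact Submodule.smul_mem _ _ (Submodule.mem_one.2 ⟨1, map_one _⟩)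
    | succ p ih =>
      rw [ExteriorAlgebra.ιMulti_succ_apply, hcl]
      refine Submodule.sub_mem _ (Submodule.smul_mem _ _
        (ExteriorAlgebra.ιMulti_range ℝ (p + 1) ⟨_, rfl⟩)) ?_
      change _ ∈ (LinearMap.range (ExteriorAlgebra.ι ℝ)) ^ (p + 1)
      rw [pow_succ']
      exact Submodule.mul_mem_mul ⟨_, rfl⟩ (ih _)
  | zero => simp
  | add P Q _ _ hP hQ => rw [map_add]; exact Submodule.add_mem _ hP hQ
  | smul c P _ hP => rw [map_smul]; exact Submodule.smul_mem _ _ hP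

/-- The symbol `i_P (α ∧ ·) - (-1)ᵖ α ∧ i_P` of the Lie derivative `L_P`. -/
def lieSymbol [TopologicalSpace V] (α : V →L[ℝ] ℝ) (p : ℕ) (P : ExteriorAlgebra ℝ V)
    (η : ∀ n : ℕ, V [⋀^Fin n]→L[ℝ] ℝ) : ∀ n : ℕ, V [⋀^Fin n]→L[ℝ] ℝ :=
  contract P (extMul α η) - (-1 : ℝ) ^ p • extMul α (contract P η)

/-- The symbol of `L_P` supercommutes with contractions, since it is itself a contraction. -/
theorem lieSymbol_contract [TopologicalSpace V] (α : V →L[ℝ] ℝ) {p q : ℕ}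
    {P Q : ExteriorAlgebra ℝ V} (hP : P ∈ ⋀[ℝ]^p V) (hQ : Q ∈ ⋀[ℝ]^q V)
    (η : ∀ n : ℕ, V [⋀^Fin n]→L[ℝ] ℝ) :
    lieSymbol α p P (contract Q η) =
      (-1 : ℝ) ^ ((p + 1) * q) • contract Q (lieSymbol α p P η) := by
  set P' : ExteriorAlgebra ℝ V :=
    CliffordAlgebra.contractLeft (Q := (0 : QuadraticForm ℝ V)) α.toLinearMap P with hP'
  have h : ∀ ζ, lieSymbol α p P ζ = -((-1 : ℝ) ^ p • contract P' ζ) := fun ζ => by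
    rw [lieSymbol, extMul_contract, involute_of_mem hP, map_smul, smul_add, LinearMap.smul_apply,
      smul_smul, ← mul_pow]
    simp [hP']
  have hc : P' * Q = (-1 : ℝ) ^ ((p + 1) * q) • (Q * P') := by
    cases p with
    | zero =>
      have : P' = 0 := by
        obtain ⟨r, rfl⟩ := Submodule.mem_one.1 hP
        exact CliffordAlgebra.contractLeft_algebraMap (Q := (0 : QuadraticForm ℝ V)) _ r
      rw [this]
      simp
    | succ p =>
      rw [mul_comm_of_mem (contractLeft_mem hP α.toLinearMap) hQ]
      congr 1
      rw [show (p + 1 + 1) * q = p * q + 2 * q by ring, pow_add, pow_mul (-1 : ℝ) 2 q]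
      simp
  have hc' : contract P' (contract Q η) =
      (-1 : ℝ) ^ ((p + 1) * q) • contract Q (contract P' η) := by
    have := congrArg (fun Z => contract Z η) hc
    simp only [map_smul, map_mul] at this
    exact this
  rw [h, h, hc', map_neg, map_smul, smul_neg, smul_comm]

end Supercommutative

/-! ### Descent of alternating maps along surjections -/

section Descent

variable {A W X : Type*} [AddCommGroup A] [Module ℝ A] [AddCommGroup W] [Module ℝ W]
  [AddCommGroup X] [Module ℝ X]

/-- An alternating map which vanishes if one of its arguments lies in a submodule does not change if
its arguments are changed by elements of the submodule. -/
theorem alternating_congr {n : ℕ} (B : A [⋀^Fin n]→ₗ[ℝ] X) (U : Submodule ℝ A)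
    (hB : ∀ a : Fin n → A, (∃ i, a i ∈ U) → B a = 0) {a a' : Fin n → A}
    (h : ∀ i, a i - a' i ∈ U) : B a = B a' := by
  classical
  suffices H : ∀ s : Finset (Fin n), B (s.piecewise a a') = B a' by
    simpa using H Finset.univ
  intro s
  induction s using Finset.induction_on with
  | empty => simp
  | insert i s hi ih =>
    rw [← ih, Finset.piecewise_insert, ← sub_eq_zero]
    have : s.piecewise a a' = Function.update (s.piecewise a a') i (a' i) := by
      rw [← Finset.piecewise_eq_of_notMem s a a' hi, Function.update_eq_self]
    conv_lhs => rw [this, Function.update_idem]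
    rw [← AlternatingMap.map_update_sub]
    exact hB _ ⟨i, by simpa using h i⟩

theorem alternating_eq_zero_of_first {n : ℕ} (B : A [⋀^Fin (n + 1)]→ₗ[ℝ] X) (U : Submodule ℝ A)
    (hB : ∀ (u : A) (a : Fin n → A), u ∈ U → B (Matrix.vecCons u a) = 0)
    (a : Fin (n + 1) → A) (h : ∃ i, a i ∈ U) : B a = 0 := by
  obtain ⟨i, hi⟩ := h
  have h1 := B.map_perm a (Equiv.swap 0 i)
  have h2 : (a ∘ Equiv.swap 0 i) = Matrix.vecCons (a i)
      (fun j : Fin n => a (Equiv.swap 0 i j.succ)) := by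
    funext j
    refine Fin.cases ?_ (fun j => ?_) j
    · simp
    · simp
  rw [h2, hB _ _ hi] at h1
  rcases Int.units_eq_one_or (Equiv.Perm.sign (Equiv.swap 0 i)) with h | h
  · rw [h, one_smul] at h1; exact h1.symm
  · rw [h] at h1; simpa using h1.symm

/-- An alternating map on `A` descends along a surjection `A → W` if it vanishes whenever one of
its arguments is in the kernel. -/
theorem exists_descend {n : ℕ} (B : A [⋀^Fin n]→ₗ[ℝ] X) (T : A →ₗ[ℝ] W)
    (hT : Function.Surjective T) (hB : ∀ a : Fin n → A, (∃ i, T (a i) = 0) → B a = 0) :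
    ∃ B' : W [⋀^Fin n]→ₗ[ℝ] X, ∀ a : Fin n → A, B' (T ∘ a) = B a := by
  obtain ⟨S, hS⟩ := T.exists_rightInverse_of_surjective (LinearMap.range_eq_top.2 hT)
  refine ⟨B.compLinearMap S, fun a => ?_⟩
  rw [AlternatingMap.compLinearMap_apply]
  refine alternating_congr B (LinearMap.ker T) hB fun i => ?_
  rw [LinearMap.mem_ker, map_sub, sub_eq_zero]
  exact LinearMap.congr_fun hS _

end Descent

/-! ### Exterior derivatives on normed spaces -/

section Pullback

variable {V V' : Type*} [AddCommGroup V] [Module ℝ V] [TopologicalSpace V]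
  [AddCommGroup V'] [Module ℝ V'] [TopologicalSpace V']

theorem wedge_comp {n : ℕ} (α : Fin n → V →L[ℝ] ℝ) (A : V' →L[ℝ] V) :
    (wedge α).compContinuousLinearMap A = wedge fun i => (α i).comp A := rfl

theorem wedgeLeft_comp {n : ℕ} (α : V →L[ℝ] ℝ) (θ : V [⋀^Fin n]→L[ℝ] ℝ) (A : V' →L[ℝ] V) :
    (wedgeLeft α θ).compContinuousLinearMap A =
      wedgeLeft (α.comp A) (θ.compContinuousLinearMap A) := by
  ext v
  rw [wedgeLeft_apply]
  exact wedgeLeft_apply α θ (A ∘ v)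

end Pullback

section Normed

variable {G : Type*} [NormedAddCommGroup G] [NormedSpace ℝ G]

theorem wedgeLeft_eq_alternatizeUncurryFin {n : ℕ} (α : G →L[ℝ] ℝ) (θ : G [⋀^Fin n]→L[ℝ] ℝ) :
    wedgeLeft α θ = ContinuousAlternatingMap.alternatizeUncurryFin (α.smulRight θ) := by
  ext v
  rw [wedgeLeft_apply, ContinuousAlternatingMap.alternatizeUncurryFin_apply]
  refine Finset.sum_congr rfl fun i _ => ?_
  simp [zsmul_eq_mul]

theorem contDiffAt_wedgeLeft {X : Type*} [NormedAddCommGroup X] [NormedSpace ℝ X] {n : ℕ}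
    {α : X → G →L[ℝ] ℝ} {θ : X → G [⋀^Fin n]→L[ℝ] ℝ} {y : X} (hα : ContDiffAt ℝ ∞ α y)
    (hθ : ContDiffAt ℝ ∞ θ y) : ContDiffAt ℝ ∞ (fun y => wedgeLeft (α y) (θ y)) y := by
  simp only [wedgeLeft_eq_alternatizeUncurryFin]
  exact (ContinuousAlternatingMap.alternatizeUncurryFinCLM ℝ G ℝ).contDiff.contDiffAt.comp y
    (hα.smulRight hθ)

theorem contDiffAt_wedge {X : Type*} [NormedAddCommGroup X] [NormedSpace ℝ X] {n : ℕ}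
    {α : Fin n → X → G →L[ℝ] ℝ} {y : X} (hα : ∀ i, ContDiffAt ℝ ∞ (α i) y) :
    ContDiffAt ℝ ∞ (fun y => wedge fun i => α i y) y := by
  induction n with
  | zero =>
    have : (fun y => wedge fun i => α i y) = fun _ => wedge (V := G) Fin.elim0 := by
      funext z; congr 1; funext i; exact i.elim0
    rw [this]
    exact contDiffAt_const
  | succ n ih =>
    have : (fun y => wedge fun i => α i y) =
        fun y => wedgeLeft (α 0 y) (wedge fun i : Fin n => α i.succ y) := by
      funext z
      rw [← wedge_cons]
      congr 1
      funext i
      refine Fin.cases rfl (fun i => rfl) i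
    rw [this]
    exact contDiffAt_wedgeLeft (hα 0) (ih fun i => hα i.succ)

theorem extDeriv_fun_smul' {n : ℕ} {h : G → ℝ} {θ : G → G [⋀^Fin n]→L[ℝ] ℝ} {y : G}
    (hh : DifferentiableAt ℝ h y) (hθ : DifferentiableAt ℝ θ y) :
    extDeriv (fun y => h y • θ y) y = wedgeLeft (fderiv ℝ h y) (θ y) + h y • extDeriv θ y := by
  rw [extDeriv, fderiv_fun_smul hh hθ, wedgeLeft_eq_alternatizeUncurryFin, extDeriv]
  simp only [← ContinuousAlternatingMap.alternatizeUncurryFinCLM_apply, map_add, map_smul]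
  exact add_comm _ _

theorem two_le_infty : (2 : WithTop ℕ∞) ≤ ∞ := WithTop.coe_le_coe.2 le_top

/-- A product of exact forms is closed. -/
theorem extDeriv_wedge_fderiv {r : ℕ} {U : Set G} (hU : IsOpen U) {F : Fin r → G → ℝ}
    (hF : ∀ i, ContDiffOn ℝ ∞ (F i) U) {y : G} (hy : y ∈ U) :
    extDeriv (fun y => wedge fun i => fderiv ℝ (F i) y) y = 0 := by
  induction r generalizing y with
  | zero =>
    have : (fun y => wedge fun i => fderiv ℝ (F i) y) = fun _ => wedge (V := G) Fin.elim0 := by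
      funext z; congr 1; funext i; exact i.elim0
    rw [this, extDeriv]
    simp [← ContinuousAlternatingMap.alternatizeUncurryFinCLM_apply]
  | succ r ih =>
    have hFa : ∀ i, ∀ z ∈ U, ContDiffAt ℝ ∞ (F i) z := fun i z hz =>
      (hF i).contDiffAt (hU.mem_nhds hz)
    have hdF : ∀ i, ∀ z ∈ U, ContDiffAt ℝ ∞ (fderiv ℝ (F i)) z := fun i z hz =>
      (hFa i z hz).fderiv_right (by simp)
    have hw : ∀ z ∈ U, ContDiffAt ℝ ∞ (fun z => wedge fun i : Fin r => fderiv ℝ (F i.succ) z) z :=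
      fun z hz => contDiffAt_wedge fun i => hdF i.succ z hz
    -- the product is exact: it is the derivative of `F₀ dF₁ ∧ … ∧ dFᵣ`
    have e : ∀ z ∈ U, wedge (fun i => fderiv ℝ (F i) z) =
        extDeriv (fun z => F 0 z • wedge fun i : Fin r => fderiv ℝ (F i.succ) z) z := by
      intro z hz
      rw [extDeriv_fun_smul' ((hFa 0 z hz).differentiableAt (by simp))
        ((hw z hz).differentiableAt (by simp)), ih (fun i => hF i.succ) hz, smul_zero, add_zero,
        ← wedge_cons]
      congr 1
      funext i
      refine Fin.cases rfl (fun i => rfl) i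
    have e' : (fun z => wedge (fun i => fderiv ℝ (F i) z)) =ᶠ[nhds y]
        extDeriv (fun z => F 0 z • wedge fun i : Fin r => fderiv ℝ (F i.succ) z) :=
      Filter.eventually_of_mem (hU.mem_nhds hy) e
    rw [e'.extDeriv_eq]
    exact extDeriv_extDeriv_apply ((hFa 0 y hy).smul (hw y hy)) (by simpa using two_le_infty)

end Normed

/-! ### The exterior derivative on a manifold -/

section Manifold

variable {EN : Type*} [NormedAddCommGroup EN] [NormedSpace ℝ EN]
  {HN : Type*} [TopologicalSpace HN] {J : ModelWithCorners ℝ EN HN} [J.Boundaryless]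
  {N : Type*} [TopologicalSpace N] [ChartedSpace HN N] [IsManifold J ∞ N]

theorem exactForm_eq_wedgeForm {r : ℕ} (f : Fin r → C^∞⟮J, N; 𝓘(ℝ, ℝ), ℝ⟯) (n : ℕ) (x : N) :
    exactForm f n x = wedgeForm (fun i => mvfderiv J (f i) x) n := rfl

theorem interior_apply {p : ℕ} (P : MultivectorField J N p) (η : GradedForm J N) (n : ℕ) (x : N) :
    interior P η n x = contract (P x : ExteriorAlgebra ℝ (TangentSpace J x)) (fun k => η k x) n :=
  rfl

theorem contDiffAt_comp_extChartAt_symm {X : Type*} [NormedAddCommGroup X] [NormedSpace ℝ X]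
    {f : N → X} {x : N} (hf : ContMDiffAt J 𝓘(ℝ, X) ∞ f x) :
    ContDiffAt ℝ ∞ (f ∘ (extChartAt J x).symm) (extChartAt J x x) := by
  have := contMDiffAt_iff_source.1 hf
  rw [J.range_eq_univ, contMDiffWithinAt_univ] at this
  exact this.contDiffAt

theorem contMDiffAt_of_contDiffAt {X : Type*} [NormedAddCommGroup X] [NormedSpace ℝ X]
    {f : N → X} {x : N} (hf : ContDiffAt ℝ ∞ (f ∘ (extChartAt J x).symm) (extChartAt J x x)) :
    ContMDiffAt J 𝓘(ℝ, X) ∞ f x := by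
  rw [contMDiffAt_iff_source, J.range_eq_univ, contMDiffWithinAt_univ]
  exact hf.contMDiffAt

theorem contDiffOn_comp_extChartAt_symm (f : C^∞⟮J, N; 𝓘(ℝ, ℝ), ℝ⟯) (x : N) :
    ContDiffOn ℝ ∞ (f ∘ (extChartAt J x).symm) (extChartAt J x).target := by
  have := f.contMDiff.contMDiffOn (s := Set.univ) |>.comp (contMDiffOn_extChartAt_symm (n := ∞) x)
    (fun _ _ => Set.mem_univ _)
  exact this.contDiffOn

theorem mdifferentiableAt_extChartAt_symm {x : N} {y : EN} (hy : y ∈ (extChartAt J x).target) :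
    MDifferentiableAt 𝓘(ℝ, EN) J (extChartAt J x).symm y :=
  (((contMDiffOn_extChartAt_symm (n := ∞) x).contMDiffAt
    (extChartAt_target_mem_nhds' hy)).mdifferentiableAt (by simp))

/-- The derivative of the inverse chart at `y`, as a map from the model space. -/
def chartSymmDeriv (J : ModelWithCorners ℝ EN HN) (x : N) (y : EN) :
    EN →L[ℝ] TangentSpace J ((extChartAt J x).symm y) :=
  mfderiv 𝓘(ℝ, EN) J (extChartAt J x).symm y ∘L
      (NormedSpace.fromTangentSpace y).symm.toContinuousLinearMap

theorem inChart_eq {n : ℕ} (η : ∀ x : N, TangentSpace J x [⋀^Fin n]→L[ℝ] ℝ) (x : N) (y : EN) :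
    inChart η x y =
      (η ((extChartAt J x).symm y)).compContinuousLinearMap (chartSymmDeriv J x y) := rfl

theorem mvfderiv_comp_chartSymmDeriv (f : C^∞⟮J, N; 𝓘(ℝ, ℝ), ℝ⟯) (x : N) {y : EN}
    (hy : y ∈ (extChartAt J x).target) :
    (mvfderiv J f ((extChartAt J x).symm y)).comp (chartSymmDeriv J x y) =
      fderiv ℝ (f ∘ (extChartAt J x).symm) y := by
  rw [← mfderiv_eq_fderiv, mfderiv_comp y (f.contMDiff.mdifferentiableAt (by simp))
    (mdifferentiableAt_extChartAt_symm hy)]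
  rfl

theorem inChart_exactForm {r : ℕ} (f : Fin r → C^∞⟮J, N; 𝓘(ℝ, ℝ), ℝ⟯) (x : N) {y : EN}
    (hy : y ∈ (extChartAt J x).target) :
    inChart (exactForm f r) x y = wedge fun i => fderiv ℝ (f i ∘ (extChartAt J x).symm) y := by
  rw [inChart_eq, exactForm_eq_wedgeForm, wedgeForm_self, wedge_comp]
  congr 1
  funext i
  exact mvfderiv_comp_chartSymmDeriv (f i) x hy

theorem isSmoothForm_zero {n : ℕ} :
    IsSmoothForm (0 : ∀ x : N, TangentSpace J x [⋀^Fin n]→L[ℝ] ℝ) := fun _ =>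
  contDiffAt_const (c := (0 : EN [⋀^Fin n]→L[ℝ] ℝ))

theorem isSmoothForm_exactForm {r : ℕ} (f : Fin r → C^∞⟮J, N; 𝓘(ℝ, ℝ), ℝ⟯) (n : ℕ) :
    IsSmoothForm (exactForm f n) := by
  by_cases h : n = r
  · subst h
    intro x
    have hx := mem_extChartAt_target (I := J) x
    have e : inChart (exactForm f n) x =ᶠ[nhds (extChartAt J x x)]
        fun y => wedge fun i => fderiv ℝ (f i ∘ (extChartAt J x).symm) y :=
      Filter.eventually_of_mem (extChartAt_target_mem_nhds x) fun y hy => inChart_exactForm f x hy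
    refine ContDiffAt.congr_of_eventuallyEq (contDiffAt_wedge fun i => ?_) e
    exact ((contDiffOn_comp_extChartAt_symm (f i) x).contDiffAt
      (extChartAt_target_mem_nhds x)).fderiv_right (by simp)
  · rw [exactForm_of_ne f h]
    exact isSmoothForm_zero

theorem IsSmoothForm.fun_smul {n : ℕ} {η : ∀ x : N, TangentSpace J x [⋀^Fin n]→L[ℝ] ℝ}
    (hη : IsSmoothForm η) {h : N → ℝ} (hh : ContMDiff J 𝓘(ℝ, ℝ) ∞ h) :
    IsSmoothForm (fun x => h x • η x) := fun x =>
  (contDiffAt_comp_extChartAt_symm (hh x)).smul (hη x)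

theorem isSmoothForm_sum {n : ℕ} {ι : Type*} (s : Finset ι)
    {η : ι → ∀ x : N, TangentSpace J x [⋀^Fin n]→L[ℝ] ℝ} (hη : ∀ i ∈ s, IsSmoothForm (η i)) :
    IsSmoothForm (∑ i ∈ s, η i) := by
  classical
  induction s using Finset.induction_on with
  | empty => exact isSmoothForm_zero
  | insert i s hi ih =>
    rw [Finset.sum_insert hi]
    exact (hη i (Finset.mem_insert_self i s)).add
      (ih fun j hj => hη j (Finset.mem_insert_of_mem hj))

/-- A form of degree zero is smooth if and only if it is a smooth function. -/
theorem isSmoothForm_zero_iff {η : ∀ x : N, TangentSpace J x [⋀^Fin 0]→L[ℝ] ℝ} :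
    IsSmoothForm η ↔ ContMDiff J 𝓘(ℝ, ℝ) ∞ fun x => η x ![] := by
  have e : ∀ x, inChart η x = (ContinuousAlternatingMap.constOfIsEmptyLIE ℝ EN ℝ (Fin 0)) ∘
      ((fun x => η x ![]) ∘ (extChartAt J x).symm) := by
    intro x
    funext y
    ext v
    rw [inChart_eq]
    simp only [Function.comp_apply, ContinuousAlternatingMap.constOfIsEmptyLIE_apply,
      ContinuousAlternatingMap.constOfIsEmpty_apply]
    change η _ _ = η _ _
    congr 1
    exact Subsingleton.elim _ _
  constructor
  · intro h x
    apply contMDiffAt_of_contDiffAt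
    have := (ContinuousAlternatingMap.constOfIsEmptyLIE ℝ EN ℝ (Fin 0)).symm.contDiff.contDiffAt.comp
      (extChartAt J x x) (h x)
    rw [e x] at this
    refine this.congr_of_eventuallyEq (Filter.Eventually.of_forall fun y => ?_)
    simp
  · intro h x
    rw [e x]
    exact (ContinuousAlternatingMap.constOfIsEmptyLIE ℝ EN ℝ (Fin 0)).contDiff.contDiffAt.comp
      (extChartAt J x x) (contDiffAt_comp_extChartAt_symm (h x))

theorem extD_succ (η : GradedForm J N) (n : ℕ) (x : N) :
    extD η (n + 1) x = (extDeriv (inChart (η n) x) (extChartAt J x x)).compContinuousLinearMap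
      (mvfderiv J (extChartAt J x) x) := rfl

theorem extD_exactForm {r : ℕ} (f : Fin r → C^∞⟮J, N; 𝓘(ℝ, ℝ), ℝ⟯) : extD (exactForm f) = 0 := by
  funext n x
  cases n with
  | zero => rfl
  | succ n =>
    rw [extD_succ]
    by_cases h : n = r
    · subst h
      have e : inChart (exactForm f n) x =ᶠ[nhds (extChartAt J x x)]
          fun y => wedge fun i => fderiv ℝ (f i ∘ (extChartAt J x).symm) y :=
        Filter.eventually_of_mem (extChartAt_target_mem_nhds x) fun y hy => inChart_exactForm f x hy
      rw [e.extDeriv_eq, extDeriv_wedge_fderiv (isOpen_extChartAt_target x)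
        (fun i => contDiffOn_comp_extChartAt_symm (f i) x) (mem_extChartAt_target x)]
      rfl
    · have : inChart (exactForm f n) x = fun _ => 0 := by
        rw [exactForm_of_ne f h]; rfl
      rw [this, extDeriv]
      ext v
      simp [← ContinuousAlternatingMap.alternatizeUncurryFinCLM_apply]

/-- Pulling the local expression back along the chart gives the form. -/
theorem inChart_comp_mvfderiv {n : ℕ} (η : ∀ x : N, TangentSpace J x [⋀^Fin n]→L[ℝ] ℝ) (x : N) :
    (inChart η x (extChartAt J x x)).compContinuousLinearMap (mvfderiv J (extChartAt J x) x) =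
      η x := by
  have : IsManifold J 1 N := .of_le (n := ∞) (by simp)
  have h0 := mfderivWithin_extChartAt_symm_comp_mfderiv_extChartAt' (I := J) (x := x)
    (mem_extChartAt_source (I := J) x)
  rw [J.range_eq_univ, mfderivWithin_univ] at h0
  have key : ∀ z : N, z = x → ∀ w : Fin n → EN,
      η z (fun i => (w i : TangentSpace J z)) = η x (fun i => (w i : TangentSpace J x)) := by
    rintro _ rfl w; rfl
  ext w
  refine (key _ (extChartAt_to_inv (I := J) x) _).trans ?_
  congr 1
  funext i
  exact DFunLike.congr_fun h0 (w i)

theorem fderiv_comp_mvfderiv (h : C^∞⟮J, N; 𝓘(ℝ, ℝ), ℝ⟯) (x : N) :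
    (fderiv ℝ (h ∘ (extChartAt J x).symm) (extChartAt J x x)).comp
      (mvfderiv J (extChartAt J x) x) = mvfderiv J h x := by
  have : IsManifold J 1 N := .of_le (n := ∞) (by simp)
  have h0 := mfderivWithin_extChartAt_symm_comp_mfderiv_extChartAt' (I := J) (x := x)
    (mem_extChartAt_source (I := J) x)
  rw [J.range_eq_univ, mfderivWithin_univ] at h0
  rw [← mvfderiv_comp_chartSymmDeriv h x (mem_extChartAt_target x)]
  have key : ∀ z : N, z = x → ∀ w : EN,
      mvfderiv J h z (w : TangentSpace J z) = mvfderiv J h x (w : TangentSpace J x) := by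
    rintro _ rfl w; rfl
  ext w
  refine (key _ (extChartAt_to_inv (I := J) x) _).trans ?_
  congr 1
  exact DFunLike.congr_fun h0 w

/-- The Leibniz rule `d(hη) = dh ∧ η + h dη`. -/
theorem extD_fun_smul (h : C^∞⟮J, N; 𝓘(ℝ, ℝ), ℝ⟯) {η : GradedForm J N}
    (hη : ∀ n, IsSmoothForm (η n)) (x : N) :
    (fun n => extD (fun n x => h x • η n x) n x) =
      extMul (mvfderiv J h x) (fun n => η n x) + h x • fun n => extD η n x := by
  funext n
  cases n with
  | zero => simp [extD, extMul_zero_deg]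
  | succ n =>
    rw [Pi.add_apply, extMul_succ, Pi.smul_apply, extD_succ, extD_succ]
    have e : inChart (fun x => h x • η n x) x =
      fun y => (h ∘ (extChartAt J x).symm) y • inChart (η n) x y := rfl
    rw [e, extDeriv_fun_smul'
      ((contDiffAt_comp_extChartAt_symm (h.contMDiff x)).differentiableAt (by simp))
      ((hη n x).differentiableAt (by simp))]
    have := wedgeLeft_comp (fderiv ℝ (h ∘ (extChartAt J x).symm) (extChartAt J x x))
      (inChart (η n) x (extChartAt J x x)) (mvfderiv J (extChartAt J x) x)
    rw [fderiv_comp_mvfderiv, inChart_comp_mvfderiv] at this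
    rw [← this]
    have hx : (h ∘ (extChartAt J x).symm) (extChartAt J x x) = h x := by simp
    rw [hx]
    rfl

theorem extD_congr {η ζ : GradedForm J N} {x : N} (h : ∀ᶠ y in nhds x, ∀ n, η n y = ζ n y)
    (n : ℕ) : extD η n x = extD ζ n x := by
  cases n with
  | zero => rfl
  | succ n =>
    rw [extD_succ, extD_succ]
    congr 1
    apply Filter.EventuallyEq.extDeriv_eq
    have hc : Filter.Tendsto (extChartAt J x).symm (nhds (extChartAt J x x)) (nhds x) := by
      have := (continuousAt_extChartAt_symm (I := J) x).tendsto
      rwa [extChartAt_to_inv] at this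
    filter_upwards [hc.eventually h] with y hy
    rw [inChart_eq, inChart_eq, hy n]

theorem extD_sum {ι : Type*} (s : Finset ι) {η : ι → GradedForm J N}
    (hη : ∀ i ∈ s, ∀ n, IsSmoothForm (η i n)) : extD (∑ i ∈ s, η i) = ∑ i ∈ s, extD (η i) := by
  classical
  induction s using Finset.induction_on with
  | empty => simp [extD_zero]
  | insert i s hi ih =>
    rw [Finset.sum_insert hi, Finset.sum_insert hi, extD_add (hη i (Finset.mem_insert_self i s)),
      ih fun j hj => hη j (Finset.mem_insert_of_mem hj)]
    intro n
    have : (∑ j ∈ s, η j) n = ∑ j ∈ s, η j n := by simp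
    rw [this]
    exact isSmoothForm_sum s fun j hj => hη j (Finset.mem_insert_of_mem hj) n

theorem exactForm_cons {r : ℕ} (h : C^∞⟮J, N; 𝓘(ℝ, ℝ), ℝ⟯)
    (f : Fin r → C^∞⟮J, N; 𝓘(ℝ, ℝ), ℝ⟯) (x : N) :
    (fun n => exactForm (Matrix.vecCons h f) n x) =
      extMul (mvfderiv J h x) (fun n => exactForm f n x) := by
  have : (fun n => exactForm (Matrix.vecCons h f) n x) =
      wedgeForm (Matrix.vecCons (mvfderiv J h x) fun i => mvfderiv J (f i) x) := by
    funext n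
    rw [exactForm_eq_wedgeForm]
    congr 1
    funext i
    refine Fin.cases rfl (fun i => rfl) i
  rw [this, wedgeForm_cons]
  rfl

theorem extD_smul_exactForm {r : ℕ} (h : C^∞⟮J, N; 𝓘(ℝ, ℝ), ℝ⟯)
    (f : Fin r → C^∞⟮J, N; 𝓘(ℝ, ℝ), ℝ⟯) :
    extD (fun n x => h x • exactForm f n x) = exactForm (Matrix.vecCons h f) := by
  funext n x
  have h1 := extD_fun_smul h (isSmoothForm_exactForm f) x
  rw [extD_exactForm, ← exactForm_cons] at h1
  have h2 := congrFun h1 n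
  refine h2.trans ?_
  simp

end Manifold

/-! ### Multivector fields as multiderivations of the algebra of functions -/

section Manifold

variable {EN : Type*} [NormedAddCommGroup EN] [NormedSpace ℝ EN]
  {HN : Type*} [TopologicalSpace HN] {J : ModelWithCorners ℝ EN HN} [J.Boundaryless]
  {N : Type*} [TopologicalSpace N] [ChartedSpace HN N] [IsManifold J ∞ N]

/-- The differential at a point, `f ↦ df(x)`. -/
def differentialAt (x : N) : C^∞⟮J, N; 𝓘(ℝ, ℝ), ℝ⟯ →ₗ[ℝ] (TangentSpace J x →L[ℝ] ℝ) where
  toFun f := mvfderiv J f x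
  map_add' f g := mvfderiv_add (f.contMDiff.mdifferentiableAt (by simp))
    (g.contMDiff.mdifferentiableAt (by simp))
  map_smul' c f := by
    have h := mvfderiv_smul (I := J) (a := fun _ : N => c) (x := x) mdifferentiableAt_const
      (f.contMDiff.mdifferentiableAt (x := x) (by simp))
    rw [mvfderiv_const] at h
    refine Eq.trans h ?_
    ext v
    simp

theorem differentialAt_apply (x : N) (f : C^∞⟮J, N; 𝓘(ℝ, ℝ), ℝ⟯) :
    differentialAt x f = mvfderiv J f x := rfl

theorem differentialAt_mul (x : N) (f g : C^∞⟮J, N; 𝓘(ℝ, ℝ), ℝ⟯) :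
    differentialAt x (f * g) = f x • differentialAt x g + g x • differentialAt x f :=
  mvfderiv_mul (f.contMDiff.mdifferentiableAt (by simp)) (g.contMDiff.mdifferentiableAt (by simp))

/-- The function `i_P (df₁ ∧ … ∧ dfₚ)`. -/
def evalOn {p : ℕ} (P : MultivectorField J N p) (f : Fin p → C^∞⟮J, N; 𝓘(ℝ, ℝ), ℝ⟯) (x : N) : ℝ :=
  interior P (exactForm f) 0 x ![]

theorem evalOn_eq_pair {p : ℕ} (P : MultivectorField J N p)
    (f : Fin p → C^∞⟮J, N; 𝓘(ℝ, ℝ), ℝ⟯) (x : N) :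
    evalOn P f x = pairAlt (P x : ExteriorAlgebra ℝ (TangentSpace J x)) p
      (fun i => differentialAt x (f i)) := rfl

theorem interior_exactForm_of_ne {p r n : ℕ} (P : MultivectorField J N p)
    (f : Fin r → C^∞⟮J, N; 𝓘(ℝ, ℝ), ℝ⟯) (h : n + p ≠ r) : interior P (exactForm f) n = 0 :=
  interior_eq_zero P (exactForm_of_ne f h)

/-- The contraction of an exact form with a multivector field, as a sum over shuffles. -/
theorem interior_exactForm {p m : ℕ} (P : MultivectorField J N p)
    (f : Fin (p + m) → C^∞⟮J, N; 𝓘(ℝ, ℝ), ℝ⟯) :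
    interior P (exactForm f) = ∑ q : Shuffle p m, q.sign •
      (fun n x => evalOn P (f ∘ q.left) x • exactForm (f ∘ q.right) n x : GradedForm J N) := by
  funext n x
  rw [Finset.sum_apply, Finset.sum_apply]
  by_cases h : n = m
  · subst h
    rw [interior_apply]
    refine (contract_wedgeForm (P x).2 (fun i => mvfderiv J (f i) x)).trans ?_
    refine Finset.sum_congr rfl fun q _ => ?_
    rw [smul_assoc]
    simp only [Pi.smul_apply, exactForm_eq_wedgeForm, wedgeForm_self]
    rfl
  · rw [interior_exactForm_of_ne P f (by omega)]
    refine (Finset.sum_eq_zero fun q _ => ?_).symm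
    simp [exactForm_of_ne _ h]

theorem IsSmoothMultivector.contMDiff_evalOn {p : ℕ} {P : MultivectorField J N p}
    (hP : IsSmoothMultivector P) (f : Fin p → C^∞⟮J, N; 𝓘(ℝ, ℝ), ℝ⟯) :
    ContMDiff J 𝓘(ℝ, ℝ) ∞ (evalOn P f) :=
  isSmoothForm_zero_iff.1 (hP p f 0)

theorem IsSmoothForm.units_smul {n : ℕ} {η : ∀ x : N, TangentSpace J x [⋀^Fin n]→L[ℝ] ℝ}
    (hη : IsSmoothForm η) (c : ℤˣ) : IsSmoothForm (c • η) := by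
  rcases Int.units_eq_one_or c with rfl | rfl
  · rwa [one_smul]
  · have : (-1 : ℤˣ) • η = (-1 : ℝ) • η := by
      funext x
      ext v
      simp
    rw [this]
    exact hη.smul _

/-- The contractions with all exact forms are smooth as soon as the complete ones are. -/
theorem isSmoothMultivector_of_evalOn {p : ℕ} {P : MultivectorField J N p}
    (hP : ∀ f : Fin p → C^∞⟮J, N; 𝓘(ℝ, ℝ), ℝ⟯, ContMDiff J 𝓘(ℝ, ℝ) ∞ (evalOn P f)) :
    IsSmoothMultivector P := by
  intro r f n
  by_cases h : n + p = r
  · obtain rfl : r = p + n := by omega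
    rw [interior_exactForm, Finset.sum_apply]
    exact isSmoothForm_sum _ fun q _ =>
      ((isSmoothForm_exactForm (f ∘ q.right) n).fun_smul (hP (f ∘ q.left))).units_smul _
  · rw [interior_exactForm_of_ne P f h]
    exact isSmoothForm_zero

/-- A smooth multivector field as an alternating map of the algebra of smooth functions. -/
def toAlt {p : ℕ} {P : MultivectorField J N p} (hP : IsSmoothMultivector P) :
    C^∞⟮J, N; 𝓘(ℝ, ℝ), ℝ⟯ [⋀^Fin p]→ₗ[ℝ] C^∞⟮J, N; 𝓘(ℝ, ℝ), ℝ⟯ where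
  toFun f := ⟨evalOn P f, hP.contMDiff_evalOn f⟩
  map_update_add' f i g h := by
    ext x
    exact ((pairAlt (P x : ExteriorAlgebra ℝ (TangentSpace J x)) p).compLinearMap
      (differentialAt x)).map_update_add f i g h
  map_update_smul' f i c g := by
    ext x
    exact ((pairAlt (P x : ExteriorAlgebra ℝ (TangentSpace J x)) p).compLinearMap
      (differentialAt x)).map_update_smul f i c g
  map_eq_zero_of_eq' f i j h hij := by
    ext x
    exact ((pairAlt (P x : ExteriorAlgebra ℝ (TangentSpace J x)) p).compLinearMap
      (differentialAt x)).map_eq_zero_of_eq f h hij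

theorem toAlt_apply {p : ℕ} {P : MultivectorField J N p} (hP : IsSmoothMultivector P)
    (f : Fin p → C^∞⟮J, N; 𝓘(ℝ, ℝ), ℝ⟯) (x : N) : toAlt hP f x = evalOn P f x := rfl

theorem smul_evalOn_exactForm_smooth {p m : ℕ} {P : MultivectorField J N p}
    (hP : IsSmoothMultivector P) (f : Fin p → C^∞⟮J, N; 𝓘(ℝ, ℝ), ℝ⟯)
    (g : Fin m → C^∞⟮J, N; 𝓘(ℝ, ℝ), ℝ⟯) (n : ℕ) :
    IsSmoothForm (fun x => evalOn P f x • exactForm g n x) :=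
  (isSmoothForm_exactForm g n).fun_smul (hP.contMDiff_evalOn f)

theorem units_smul_gradedForm (c : ℤˣ) (η : GradedForm J N) : c • η = ((c : ℤ) : ℝ) • η := by
  funext n x
  ext v
  rcases Int.units_eq_one_or c with rfl | rfl <;> simp

theorem extD_interior_exactForm {p m : ℕ} {P : MultivectorField J N p}
    (hP : IsSmoothMultivector P) (f : Fin (p + m) → C^∞⟮J, N; 𝓘(ℝ, ℝ), ℝ⟯) :
    extD (interior P (exactForm f)) = ∑ q : Shuffle p m, q.sign •
      exactForm (Matrix.vecCons (toAlt hP (f ∘ q.left)) (f ∘ q.right)) := by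
  rw [interior_exactForm, extD_sum]
  · refine Finset.sum_congr rfl fun q _ => ?_
    rw [units_smul_gradedForm, units_smul_gradedForm, extD_smul]
    congr 1
    exact extD_smul_exactForm (toAlt hP (f ∘ q.left)) (f ∘ q.right)
  · intro q _ n
    exact (smul_evalOn_exactForm_smooth hP _ _ n).units_smul _

theorem interior_sum {ι : Type*} (s : Finset ι) {p : ℕ} (P : MultivectorField J N p)
    (η : ι → GradedForm J N) : interior P (∑ i ∈ s, η i) = ∑ i ∈ s, interior P (η i) := by
  classical
  induction s using Finset.induction_on with
  | empty => simpa using interior_smul_right P (0 : ℝ) (0 : GradedForm J N)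
  | insert i s hi ih => rw [Finset.sum_insert hi, Finset.sum_insert hi, interior_add_right, ih]

/-- The operator `i_P d i_Q` is the insertion product of the multiderivations. -/
theorem interior_extD_interior {p q r : ℕ} (h : r + 1 = p + q) {P : MultivectorField J N p}
    {Q : MultivectorField J N q} (hP : IsSmoothMultivector P) (hQ : IsSmoothMultivector Q)
    (f : Fin r → C^∞⟮J, N; 𝓘(ℝ, ℝ), ℝ⟯) (x : N) :
    interior P (extD (interior Q (exactForm f))) 0 x ![] =
      insertion h (toAlt hP) (toAlt hQ) f x := by
  cases p with
  | zero =>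
    rw [insertion_zero_left]
    have : interior Q (exactForm f) = 0 := by
      funext n
      exact interior_exactForm_of_ne Q f (by omega)
    rw [this, extD_zero, interior_eq_zero P (by rfl)]
    rfl
  | succ m =>
    obtain rfl : r = q + m := by omega
    rw [extD_interior_exactForm hQ, insertion_apply_shuffle, interior_sum]
    have e : ∀ (s : Finset (Shuffle q m)) (F : Shuffle q m → C^∞⟮J, N; 𝓘(ℝ, ℝ), ℝ⟯),
        (∑ i ∈ s, F i : C^∞⟮J, N; 𝓘(ℝ, ℝ), ℝ⟯) x = ∑ i ∈ s, F i x := fun s F =>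
      map_sum (ContMDiffMap.evalRingHom x) F s
    rw [e, Finset.sum_apply, Finset.sum_apply, ContinuousAlternatingMap.sum_apply]
    refine Finset.sum_congr rfl fun i _ => ?_
    rw [units_smul_gradedForm, interior_smul_right]
    rcases Int.units_eq_one_or i.sign with hs | hs
    · rw [hs]; simp; rfl
    · rw [hs]
      have e1 : ∀ g : C^∞⟮J, N; 𝓘(ℝ, ℝ), ℝ⟯, ((-1 : ℤˣ) • g) x = -(g x) := fun g => by
        rw [Units.neg_smul, one_smul]; rfl
      rw [e1]
      simp
      rfl

theorem extD_succ_eq_zero {η : GradedForm J N} {n : ℕ} (h : η n = 0) : extD η (n + 1) = 0 := by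
  funext x
  have : inChart (η n) x = fun _ => 0 := by rw [h]; rfl
  rw [extD_succ, this, extDeriv]
  ext v
  simp [← ContinuousAlternatingMap.alternatizeUncurryFinCLM_apply]

theorem interior_extD_interior_of_ne {p q r n : ℕ} (h : r + 1 = p + q)
    (P : MultivectorField J N p) (Q : MultivectorField J N q)
    (f : Fin r → C^∞⟮J, N; 𝓘(ℝ, ℝ), ℝ⟯) (hn : n ≠ 0) :
    interior P (extD (interior Q (exactForm f))) n = 0 := by
  apply interior_eq_zero
  obtain ⟨k, hk⟩ : ∃ k, n + p = k + 1 := ⟨n + p - 1, by omega⟩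
  rw [hk]
  exact extD_succ_eq_zero (interior_exactForm_of_ne Q f (by omega))

/-- On products of exact forms of degree `p + q - 1`, two of the four terms of `[L_P, i_Q]` vanish: one for
reasons of degree, and one since the forms are closed. -/
theorem schouten_rhs {p q r : ℕ} (h : r + 1 = p + q) (P : MultivectorField J N p)
    (Q : MultivectorField J N q) (f : Fin r → C^∞⟮J, N; 𝓘(ℝ, ℝ), ℝ⟯) :
    lieDeriv P (interior Q (exactForm f)) -
        (-1 : ℝ) ^ ((p + 1) * q) • interior Q (lieDeriv P (exactForm f)) =
      interior P (extD (interior Q (exactForm f))) -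
        (-1 : ℝ) ^ ((p + 1) * (q + 1)) • interior Q (extD (interior P (exactForm f))) := by
  have h0 : ∀ {k : ℕ} (P : MultivectorField J N k), interior P (0 : GradedForm J N) = 0 :=
    fun P => by simpa using interior_smul_right P (0 : ℝ) (0 : GradedForm J N)
  rw [lieDeriv, lieDeriv, interior_interior_exactForm h, extD_zero, smul_zero, sub_zero,
    extD_exactForm, h0, zero_sub]
  have e : -((-1 : ℝ) ^ p • extD (interior P (exactForm f))) =
      (-(-1 : ℝ) ^ p) • extD (interior P (exactForm f)) := by
    funext n x
    ext v
    simp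
  rw [e, interior_smul_right, smul_smul]
  congr 2
  rw [show (p + 1) * (q + 1) = (p + 1) * q + p + 1 by ring, pow_succ, pow_add]
  ring

/-- The Schouten bracket is the graded commutator for the insertion product. -/
theorem isSchoutenBracket_iff {p q r : ℕ} (h : r + 1 = p + q) {P : MultivectorField J N p}
    {Q : MultivectorField J N q} (hP : IsSmoothMultivector P) (hQ : IsSmoothMultivector Q)
    (R : MultivectorField J N r) :
    IsSchoutenBracket P Q R ↔ ∀ (f : Fin r → C^∞⟮J, N; 𝓘(ℝ, ℝ), ℝ⟯) (x : N), evalOn R f x =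
      insertion h (toAlt hP) (toAlt hQ) f x - (-1 : ℝ) ^ ((p + 1) * (q + 1)) *
        insertion (by omega) (toAlt hQ) (toAlt hP) f x := by
  refine forall_congr' fun f => ?_
  rw [schouten_rhs h]
  constructor
  · intro H x
    rw [evalOn, H, ← interior_extD_interior h hP hQ,
      ← interior_extD_interior (by omega : r + 1 = q + p) hQ hP]
    rfl
  · intro H
    funext n x
    by_cases hn : n = 0
    · subst hn
      ext v
      rw [Subsingleton.elim v ![]]
      refine (H x).trans ?_
      rw [← interior_extD_interior h hP hQ,
        ← interior_extD_interior (by omega : r + 1 = q + p) hQ hP]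
      rfl
    · rw [interior_exactForm_of_ne R f (by omega)]
      simp [interior_extD_interior_of_ne h P Q f hn,
        interior_extD_interior_of_ne (by omega : r + 1 = q + p) Q P f hn]

end Manifold

/-! ### Functions with prescribed differentials and local coframes -/

section Instances

variable {EN : Type*} [NormedAddCommGroup EN] [NormedSpace ℝ EN]
  {HN : Type*} [TopologicalSpace HN] {J : ModelWithCorners ℝ EN HN}
  {N : Type*} [TopologicalSpace N] [ChartedSpace HN N]

instance (x : N) : T2Space (TangentSpace J x) := inferInstanceAs (T2Space EN)

instance [FiniteDimensional ℝ EN] (x : N) : FiniteDimensional ℝ (TangentSpace J x) :=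
  inferInstanceAs (FiniteDimensional ℝ EN)

end Instances

section Manifold

variable {EN : Type*} [NormedAddCommGroup EN] [NormedSpace ℝ EN] [FiniteDimensional ℝ EN]
  {HN : Type*} [TopologicalSpace HN] {J : ModelWithCorners ℝ EN HN} [J.Boundaryless]
  {N : Type*} [TopologicalSpace N] [ChartedSpace HN N] [IsManifold J ∞ N] [T2Space N]

/-- A function which is smooth near a point agrees near the point with a global smooth function. -/
theorem exists_eventuallyEq {g : N → ℝ} {x : N}
    (hg : ∀ᶠ y in nhds x, ContMDiffAt J 𝓘(ℝ, ℝ) ∞ g y) :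
    ∃ f : C^∞⟮J, N; 𝓘(ℝ, ℝ), ℝ⟯, ∀ᶠ y in nhds x, f y = g y := by
  obtain ⟨χ, -, hχ⟩ := (SmoothBumpFunction.nhds_basis_tsupport (I := J) x).mem_iff.1 hg
  refine ⟨⟨fun y => χ y • g y, contMDiff_of_tsupport fun y hy => ?_⟩, ?_⟩
  · exact χ.contMDiffAt.smul (hχ (tsupport_smul_subset_left _ _ hy))
  · filter_upwards [χ.eventuallyEq_one] with y hy
    change χ y • g y = g y
    rw [hy]
    simp

/-- The differential of a function at any point of a chart domain, through the chart. -/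
theorem differentialAt_eq_fderiv_comp (f : C^∞⟮J, N; 𝓘(ℝ, ℝ), ℝ⟯) {x y : N}
    (hy : y ∈ (extChartAt J x).source) :
    differentialAt y f = (fderiv ℝ (f ∘ (extChartAt J x).symm) (extChartAt J x y)).comp
      (mvfderiv J (extChartAt J x) y) := by
  have e : (f : N → ℝ) =ᶠ[nhds y] (f ∘ (extChartAt J x).symm) ∘ extChartAt J x := by
    filter_upwards [extChartAt_source_mem_nhds' (I := J) hy] with z hz
    simp only [Function.comp_apply, (extChartAt J x).left_inv hz]
  have h1 : MDifferentiableAt 𝓘(ℝ, EN) 𝓘(ℝ, ℝ) (f ∘ (extChartAt J x).symm) (extChartAt J x y) :=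
    (((contDiffOn_comp_extChartAt_symm f x).contDiffAt
      (extChartAt_target_mem_nhds' ((extChartAt J x).map_source hy))).differentiableAt
        (by simp)).mdifferentiableAt
  have h2 : MDifferentiableAt J 𝓘(ℝ, EN) (extChartAt J x) y :=
    (contMDiffAt_extChartAt' (n := ∞) (by simpa using hy)).mdifferentiableAt (by simp)
  have h3 : mvfderiv J f y = mvfderiv J ((f ∘ (extChartAt J x).symm) ∘ extChartAt J x) y := by
    ext v
    have := e.mfderiv_eq (I := J) (I' := 𝓘(ℝ, ℝ))
    exact DFunLike.congr_fun this v
  rw [differentialAt_apply, h3]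
  have h4 := mvfderiv_comp (I := 𝓘(ℝ, EN)) y h1 h2
  rw [h4]
  have h5 := mfderiv_eq_fderiv (𝕜 := ℝ) (f := f ∘ (extChartAt J x).symm) (x := extChartAt J x y)
  rw [← h5]
  rfl

theorem mvfderiv_extChartAt_bijective (x : N) :
    Function.Bijective (mvfderiv J (extChartAt J x) x) := by
  have : IsManifold J 1 N := .of_le (n := ∞) (by simp)
  obtain ⟨e, he⟩ := isInvertible_mfderiv_extChartAt (I := J) (mem_extChartAt_source (I := J) x)
  have : ⇑(mvfderiv J (extChartAt J x) x) = e := by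
    ext v
    exact DFunLike.congr_fun he.symm v
  rw [this]
  exact e.bijective

/-- Every covector is the differential of a global function. -/
theorem differentialAt_surjective (x : N) :
    Function.Surjective (differentialAt (J := J) x) := by
  intro α
  let A := LinearEquiv.ofBijective (mvfderiv J (extChartAt J x) x).toLinearMap
    (mvfderiv_extChartAt_bijective x)
  let β : EN →L[ℝ] ℝ := LinearMap.toContinuousLinearMap (α.toLinearMap ∘ₗ A.symm.toLinearMap)
  have hsm : ∀ y ∈ (extChartAt J x).source, ContMDiffAt J 𝓘(ℝ, ℝ) ∞ (β ∘ extChartAt J x) y :=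
    fun y hy => β.contDiff.contDiffAt.comp_contMDiffAt
      (contMDiffAt_extChartAt' (n := ∞) (by simpa using hy))
  obtain ⟨f, hf⟩ := exists_eventuallyEq (g := β ∘ extChartAt J x) (x := x)
    (Filter.eventually_of_mem (extChartAt_source_mem_nhds (I := J) x) hsm)
  refine ⟨f, ?_⟩
  rw [differentialAt_eq_fderiv_comp f (mem_extChartAt_source (I := J) x)]
  have hc : Filter.Tendsto (extChartAt J x).symm (nhds (extChartAt J x x)) (nhds x) := by
    have := (continuousAt_extChartAt_symm (I := J) x).tendsto
    rwa [extChartAt_to_inv] at this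
  have e : f ∘ (extChartAt J x).symm =ᶠ[nhds (extChartAt J x x)] β := by
    filter_upwards [hc.eventually hf, extChartAt_target_mem_nhds (I := J) x] with y hy hy'
    simp only [Function.comp_apply] at hy ⊢
    rw [hy, (extChartAt J x).right_inv hy']
  rw [e.fderiv_eq, ContinuousLinearMap.fderiv]
  ext v
  change α (A.symm (A v)) = α v
  rw [A.symm_apply_apply]

/-- A local coframe of exact forms: if the differentials of `G μ` are a basis at `x₀`, then near
`x₀` the differential of any function is a smooth linear combination of them. -/
theorem exists_coframe_expansion {ι : Type*} [Fintype ι] {x₀ : N}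
    (G : ι → C^∞⟮J, N; 𝓘(ℝ, ℝ), ℝ⟯) (hli : LinearIndependent ℝ fun μ => differentialAt x₀ (G μ))
    (hsp : Submodule.span ℝ (Set.range fun μ => differentialAt x₀ (G μ)) = ⊤)
    (F : C^∞⟮J, N; 𝓘(ℝ, ℝ), ℝ⟯) :
    ∃ c : ι → C^∞⟮J, N; 𝓘(ℝ, ℝ), ℝ⟯, ∀ᶠ x in nhds x₀,
      differentialAt x F = ∑ μ, c μ x • differentialAt x (G μ) := by
  classical
  let D : C^∞⟮J, N; 𝓘(ℝ, ℝ), ℝ⟯ → EN → EN →L[ℝ] ℝ := fun f y =>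
    fderiv ℝ (f ∘ (extChartAt J x₀).symm) y
  have hD : ∀ f, ∀ y ∈ (extChartAt J x₀).target, ContDiffAt ℝ ∞ (D f) y := fun f y hy =>
    ((contDiffOn_comp_extChartAt_symm f x₀).contDiffAt
      (extChartAt_target_mem_nhds' hy)).fderiv_right (by simp)
  -- `Λ` assembles the differentials of the `G μ` in the chart. It is invertible at `x₀`, hence near
  -- `x₀`, and the coefficients are the components of `Λ⁻¹ (dF)`
  let Λ : EN → (ι → ℝ) →L[ℝ] (EN →L[ℝ] ℝ) := fun y =>
    ∑ μ, (ContinuousLinearMap.proj μ : (ι → ℝ) →L[ℝ] ℝ).smulRight (D (G μ) y)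
  have hΛ_apply : ∀ y c, Λ y c = ∑ μ, c μ • D (G μ) y := fun y c => by
    simp [Λ]
  have hΛ : ∀ y ∈ (extChartAt J x₀).target, ContDiffAt ℝ ∞ Λ y := fun y hy =>
    ContDiffAt.sum fun μ _ => contDiffAt_const.smulRight (hD (G μ) y hy)
  have hx₀ := mem_extChartAt_source (I := J) x₀
  set A := mvfderiv J (extChartAt J x₀) x₀
  have hA := mvfderiv_extChartAt_bijective (J := J) x₀
  have hΛA : ∀ c, (Λ (extChartAt J x₀ x₀) c).comp A = ∑ μ, c μ • differentialAt x₀ (G μ) := by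
    intro c
    rw [hΛ_apply]
    simp only [differentialAt_eq_fderiv_comp _ hx₀]
    ext v
    simp [D, A]
  have hbij : Function.Bijective (Λ (extChartAt J x₀ x₀)) := by
    constructor
    · rw [injective_iff_map_eq_zero]
      intro c hc
      have := hΛA c
      rw [hc, ContinuousLinearMap.zero_comp] at this
      funext μ
      exact Fintype.linearIndependent_iff.1 hli c this.symm μ
    · intro β
      have hm : β.comp A ∈ Submodule.span ℝ (Set.range fun μ => differentialAt x₀ (G μ)) := by
        rw [hsp]; trivial
      obtain ⟨c, hc⟩ := (Submodule.mem_span_range_iff_exists_fun ℝ).1 hm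
      refine ⟨c, ?_⟩
      ext v
      obtain ⟨w, rfl⟩ := hA.2 v
      have h1 := hΛA c
      rw [hc] at h1
      exact DFunLike.congr_fun h1 w
  let e₀ : (ι → ℝ) ≃L[ℝ] (EN →L[ℝ] ℝ) :=
    (LinearEquiv.ofBijective (Λ (extChartAt J x₀ x₀)).toLinearMap hbij).toContinuousLinearEquiv
  have he₀ : (e₀ : (ι → ℝ) →L[ℝ] (EN →L[ℝ] ℝ)) = Λ (extChartAt J x₀ x₀) := by ext v; rfl
  have hinv : ∀ᶠ x in nhds x₀, Λ (extChartAt J x₀ x) ∈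
      Set.range (ContinuousLinearEquiv.toContinuousLinearMap
        : ((ι → ℝ) ≃L[ℝ] (EN →L[ℝ] ℝ)) → _) := by
    have hcont : ContinuousAt (fun x => Λ (extChartAt J x₀ x)) x₀ :=
      ContinuousAt.comp (g := Λ) (f := extChartAt J x₀)
        (hΛ _ (mem_extChartAt_target x₀)).continuousAt (continuousAt_extChartAt x₀)
    exact hcont.eventually (ContinuousLinearEquiv.isOpen.mem_nhds ⟨e₀, he₀⟩)
  let c : N → ι → ℝ := fun x => (Λ (extChartAt J x₀ x)).inverse (D F (extChartAt J x₀ x))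
  have hcs : ∀ᶠ x in nhds x₀, ContMDiffAt J 𝓘(ℝ, ι → ℝ) ∞ c x := by
    filter_upwards [hinv, extChartAt_source_mem_nhds (I := J) x₀] with x hx hxs
    obtain ⟨e, he⟩ := hx
    have ht := (extChartAt J x₀).map_source hxs
    have h1 : ContDiffAt ℝ ∞ (fun y => (Λ y).inverse (D F y)) (extChartAt J x₀ x) := by
      refine ContDiffAt.clm_apply ?_ (hD F _ ht)
      have h2 := contDiffAt_map_inverse (n := ∞) e
      rw [he] at h2
      exact h2.comp _ (hΛ _ ht)
    exact h1.comp_contMDiffAt (contMDiffAt_extChartAt' (n := ∞) (by simpa using hxs))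
  have hex : ∀ μ, ∃ f : C^∞⟮J, N; 𝓘(ℝ, ℝ), ℝ⟯, ∀ᶠ y in nhds x₀, f y = c y μ := fun μ =>
    exists_eventuallyEq (hcs.mono fun x hx => contMDiffAt_pi_space.1 hx μ)
  choose f hf using hex
  refine ⟨f, ?_⟩
  filter_upwards [hinv, extChartAt_source_mem_nhds (I := J) x₀, Filter.eventually_all.2 hf]
    with x hx hxs hfx
  obtain ⟨e, he⟩ := hx
  have h1 : Λ (extChartAt J x₀ x) (c x) = D F (extChartAt J x₀ x) := by
    change Λ (extChartAt J x₀ x) ((Λ (extChartAt J x₀ x)).inverse _) = _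
    rw [← he, ContinuousLinearMap.inverse_equiv]
    exact e.apply_symm_apply _
  rw [hΛ_apply] at h1
  simp only [differentialAt_eq_fderiv_comp _ hxs, hfx]
  change (D F (extChartAt J x₀ x)).comp _ = _
  rw [← h1]
  ext v
  simp [D]

/-- At every point, a basis of the cotangent space can be selected from the differentials of a
set of functions whose differentials span. -/
theorem exists_coframe (𝒢 : Set C^∞⟮J, N; 𝓘(ℝ, ℝ), ℝ⟯) (x : N)
    (h𝒢 : Submodule.span ℝ (differentialAt (J := J) x '' 𝒢) = ⊤) :
    ∃ (k : ℕ) (G : Fin k → C^∞⟮J, N; 𝓘(ℝ, ℝ), ℝ⟯), (∀ μ, G μ ∈ 𝒢) ∧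
      LinearIndependent ℝ (fun μ => differentialAt x (G μ)) ∧
      Submodule.span ℝ (Set.range fun μ => differentialAt x (G μ)) = ⊤ := by
  obtain ⟨b, hb, hsp, hli⟩ := exists_linearIndependent ℝ (differentialAt (J := J) x '' 𝒢)
  have hfd : Module.Finite ℝ (TangentSpace J x →L[ℝ] ℝ) :=
    Module.Finite.equiv (LinearMap.toContinuousLinearMap
      (E := TangentSpace J x) (F' := ℝ) (𝕜 := ℝ))
  have hfin : b.Finite := hli.setFinite
  have := hfin.fintype
  let e := (Fintype.equivFin b).symm
  choose g hg hg' using fun i : b => hb i.2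
  have hr : (fun μ => differentialAt x (g (e μ))) = fun μ => ((e μ : b) : TangentSpace J x →L[ℝ] ℝ) :=
    funext fun μ => hg' (e μ)
  refine ⟨_, fun μ => g (e μ), fun μ => hg _, ?_, ?_⟩
  · rw [hr]
    exact hli.comp e e.injective
  · rw [hr, ← h𝒢, ← hsp]
    congr 1
    ext v
    constructor
    · rintro ⟨μ, rfl⟩; exact (e μ).2
    · intro hv; exact ⟨e.symm ⟨v, hv⟩, by simp⟩

/-- Smoothness of a multivector field can be tested on functions whose differentials span the
cotangent space at every point. -/
theorem isSmoothMultivector_of_span {p : ℕ} {P : MultivectorField J N p}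
    (𝒢 : Set C^∞⟮J, N; 𝓘(ℝ, ℝ), ℝ⟯)
    (h𝒢 : ∀ x, Submodule.span ℝ (differentialAt (J := J) x '' 𝒢) = ⊤)
    (hP : ∀ G : Fin p → C^∞⟮J, N; 𝓘(ℝ, ℝ), ℝ⟯, (∀ i, G i ∈ 𝒢) →
      ContMDiff J 𝓘(ℝ, ℝ) ∞ (evalOn P G)) : IsSmoothMultivector P := by
  classical
  refine isSmoothMultivector_of_evalOn fun f x₀ => ?_
  obtain ⟨k, G, hG, hli, hsp⟩ := exists_coframe 𝒢 x₀ (h𝒢 x₀)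
  choose c hc using fun j => exists_coframe_expansion G hli hsp (f j)
  have e : evalOn P f =ᶠ[nhds x₀] fun x => ∑ r : Fin p → Fin k,
      (∏ j, c j (r j) x) • evalOn P (fun j => G (r j)) x := by
    filter_upwards [Filter.eventually_all.2 hc] with x hx
    rw [evalOn_eq_pair]
    simp only [hx]
    rw [← AlternatingMap.coe_multilinearMap, MultilinearMap.map_sum]
    refine Finset.sum_congr rfl fun r _ => ?_
    rw [MultilinearMap.map_smul_univ]
    rfl
  refine ContMDiffAt.congr_of_eventuallyEq ?_ e
  refine contMDiffAt_finsetSum fun r _ => ?_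
  have h1 : ContMDiffAt J 𝓘(ℝ, ℝ) ∞ (fun x => ∏ j, c j (r j) x) x₀ :=
    contMDiffAt_finsetProd fun j _ => (c j (r j)).contMDiff.contMDiffAt
  exact h1.smul (hP _ fun j => hG _).contMDiffAt

/-- A multivector field is determined by its values on functions. -/
theorem multivectorField_ext {p : ℕ} {P Q : MultivectorField J N p}
    (h : ∀ f x, evalOn P f x = evalOn Q f x) : P = Q := by
  funext x
  rw [← sub_eq_zero]
  apply eq_zero_of_pair_eq_zero
  intro α
  choose f hf using fun i => differentialAt_surjective (J := J) x (α i)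
  have h1 := h f x
  rw [evalOn_eq_pair, evalOn_eq_pair] at h1
  simp only [hf] at h1
  have h2 : ((P x - Q x : ⋀[ℝ]^p (TangentSpace J x)) : ExteriorAlgebra ℝ (TangentSpace J x)) =
    (P x : ExteriorAlgebra ℝ (TangentSpace J x)) + (-1 : ℝ) • (Q x).1 := by
    simp [sub_eq_add_neg]
  rw [h2, pair_add, pair_smul]
  rw [pairAlt_apply, pairAlt_apply] at h1
  rw [h1]
  ring

end Manifold

/-! ### Existence and uniqueness of the Schouten bracket -/

section Manifold

variable {EN : Type*} [NormedAddCommGroup EN] [NormedSpace ℝ EN] [FiniteDimensional ℝ EN]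
  {HN : Type*} [TopologicalSpace HN] {J : ModelWithCorners ℝ EN HN} [J.Boundaryless]
  {N : Type*} [TopologicalSpace N] [ChartedSpace HN N] [IsManifold J ∞ N] [T2Space N]

theorem interior_fun_smul {p : ℕ} (P : MultivectorField J N p) (h : N → ℝ) (η : GradedForm J N) :
    interior P (fun n x => h x • η n x) = fun n x => h x • interior P η n x := by
  funext n x
  exact congrFun ((contract (P x : ExteriorAlgebra ℝ (TangentSpace J x))).map_smul (h x)
    (fun k => η k x)) n

theorem lieDeriv_congr {p : ℕ} (P : MultivectorField J N p) {η ζ : GradedForm J N} {x : N}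
    (h : ∀ᶠ y in nhds x, ∀ n, η n y = ζ n y) (n : ℕ) :
    lieDeriv P η n x = lieDeriv P ζ n x := by
  have h1 : (fun k => extD η k x) = fun k => extD ζ k x := funext (extD_congr h)
  have h2 : ∀ᶠ y in nhds x, ∀ k, interior P η k y = interior P ζ k y := by
    filter_upwards [h] with y hy k
    have : (fun k => η k y) = fun k => ζ k y := funext hy
    rw [interior_apply, interior_apply, this]
  change contract _ (fun k => extD η k x) n - (-1 : ℝ) ^ p • extD (interior P η) n x =
    contract _ (fun k => extD ζ k x) n - (-1 : ℝ) ^ p • extD (interior P ζ) n x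
  rw [h1, extD_congr h2 n]

theorem lieDeriv_sum {ι : Type*} (s : Finset ι) {p : ℕ} (P : MultivectorField J N p)
    {η : ι → GradedForm J N} (hη : ∀ i ∈ s, ∀ n, IsSmoothForm (η i n))
    (hP : ∀ i ∈ s, ∀ n, IsSmoothForm (interior P (η i) n)) :
    lieDeriv P (∑ i ∈ s, η i) = ∑ i ∈ s, lieDeriv P (η i) := by
  simp only [lieDeriv]
  rw [extD_sum s hη, interior_sum, interior_sum, extD_sum s hP, Finset.smul_sum,
    Finset.sum_sub_distrib]

theorem extMul_sum_smul {V : Type*} [AddCommGroup V] [Module ℝ V] [TopologicalSpace V]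
    {ι : Type*} (s : Finset ι) (c : ι → ℝ) (α : ι → V →L[ℝ] ℝ)
    (η : ∀ n : ℕ, V [⋀^Fin n]→L[ℝ] ℝ) :
    extMul (∑ i ∈ s, c i • α i) η = ∑ i ∈ s, c i • extMul (α i) η := by
  funext n
  rw [Finset.sum_apply]
  cases n with
  | zero => simp [extMul_zero_deg]
  | succ n =>
    ext v
    rw [ContinuousAlternatingMap.sum_apply]
    simp only [extMul_succ, Pi.smul_apply, sum_apply, smul_apply, wedgeLeft_apply, smul_eq_mul]
    simp only [Finset.mul_sum, Finset.sum_mul]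
    rw [Finset.sum_comm]
    refine Finset.sum_congr rfl fun i _ => ?_
    rw [ContinuousAlternatingMap.smul_apply, wedgeLeft_apply, smul_eq_mul, Finset.mul_sum]
    exact Finset.sum_congr rfl fun j _ => by ring

/-- The Leibniz rule `L_P (h η) = h L_P η + (i_P (dh ∧ η) - (-1)ᵖ dh ∧ i_P η)`. -/
theorem lieDeriv_fun_smul {p : ℕ} (P : MultivectorField J N p) (h : C^∞⟮J, N; 𝓘(ℝ, ℝ), ℝ⟯)
    {η : GradedForm J N} (hη : ∀ n, IsSmoothForm (η n))
    (hP : ∀ n, IsSmoothForm (interior P η n)) (x : N) :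
    (fun n => lieDeriv P (fun n x => h x • η n x) n x) =
      lieSymbol (mvfderiv J h x) p (P x) (fun n => η n x) +
        h x • fun n => lieDeriv P η n x := by
  have h1 := extD_fun_smul h hη x
  have h2 := extD_fun_smul h hP x
  rw [← interior_fun_smul] at h2
  have h3 : (fun n => lieDeriv P (fun n x => h x • η n x) n x) =
      contract (P x : ExteriorAlgebra ℝ (TangentSpace J x))
        (fun n => extD (fun n x => h x • η n x) n x) -
      (-1 : ℝ) ^ p • fun n => extD (interior P fun n x => h x • η n x) n x := rfl
  have h4 : (fun n => lieDeriv P η n x) =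
      contract (P x : ExteriorAlgebra ℝ (TangentSpace J x)) (fun n => extD η n x) -
      (-1 : ℝ) ^ p • fun n => extD (interior P η) n x := rfl
  rw [h3, h4, h1, h2, map_add, map_smul, lieSymbol, smul_add, smul_sub, smul_comm (h x)]
  have h5 : (fun n => interior P η n x) =
    contract (P x : ExteriorAlgebra ℝ (TangentSpace J x)) (fun n => η n x) := rfl
  rw [h5]
  abel

/-- The operator `L_P i_Q - (-1)^{(p-1)q} i_Q L_P` is linear over the smooth functions, on forms of
degree `p + q - 1`. -/
theorem schouten_fun_smul {p q r : ℕ} (h : r + 1 = p + q) {P : MultivectorField J N p}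
    {Q : MultivectorField J N q} (hP : IsSmoothMultivector P) (hQ : IsSmoothMultivector Q)
    (c : C^∞⟮J, N; 𝓘(ℝ, ℝ), ℝ⟯) (f : Fin r → C^∞⟮J, N; 𝓘(ℝ, ℝ), ℝ⟯) (n : ℕ) (x : N) :
    lieDeriv P (interior Q fun n x => c x • exactForm f n x) n x -
        (-1 : ℝ) ^ ((p + 1) * q) •
          interior Q (lieDeriv P fun n x => c x • exactForm f n x) n x =
      c x • (lieDeriv P (interior Q (exactForm f)) n x -
        (-1 : ℝ) ^ ((p + 1) * q) • interior Q (lieDeriv P (exactForm f)) n x) := by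
  have h0 : ∀ n, IsSmoothForm (interior P (interior Q (exactForm f)) n) := fun n => by
    rw [interior_interior_exactForm h]
    exact isSmoothForm_zero
  have h1 := lieDeriv_fun_smul P c (fun n => hQ r f n) h0 x
  have h2 := lieDeriv_fun_smul P c (fun n => isSmoothForm_exactForm f n) (fun n => hP r f n) x
  have h3 : (fun n => interior Q (exactForm f) n x) =
    contract (Q x : ExteriorAlgebra ℝ (TangentSpace J x)) (fun n => exactForm f n x) := rfl
  rw [h3, lieSymbol_contract _ (P x).2 (Q x).2] at h1
  rw [interior_fun_smul, interior_apply, h2]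
  have h4 := congrFun h1 n
  rw [h4, map_add, map_smul]
  have h5 : ∀ n, interior Q (lieDeriv P (exactForm f)) n x =
    contract (Q x : ExteriorAlgebra ℝ (TangentSpace J x))
      (fun n => lieDeriv P (exactForm f) n x) n := fun n => rfl
  rw [h5]
  ext v
  simp
  ring

/-- The value of the bracket of two multiderivations, as alternating map of the algebra of
functions. -/
def bracketAlt {p q r : ℕ} (h : r + 1 = p + q) {P : MultivectorField J N p}
    {Q : MultivectorField J N q} (hP : IsSmoothMultivector P) (hQ : IsSmoothMultivector Q) :
    C^∞⟮J, N; 𝓘(ℝ, ℝ), ℝ⟯ [⋀^Fin r]→ₗ[ℝ] C^∞⟮J, N; 𝓘(ℝ, ℝ), ℝ⟯ :=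
  insertion h (toAlt hP) (toAlt hQ) -
    (-1 : ℝ) ^ ((p + 1) * (q + 1)) • insertion (by omega) (toAlt hQ) (toAlt hP)

theorem bracketAlt_apply {p q r : ℕ} (h : r + 1 = p + q) {P : MultivectorField J N p}
    {Q : MultivectorField J N q} (hP : IsSmoothMultivector P) (hQ : IsSmoothMultivector Q)
    (f : Fin r → C^∞⟮J, N; 𝓘(ℝ, ℝ), ℝ⟯) (x : N) :
    bracketAlt h hP hQ f x = insertion h (toAlt hP) (toAlt hQ) f x -
      (-1 : ℝ) ^ ((p + 1) * (q + 1)) * insertion (by omega) (toAlt hQ) (toAlt hP) f x := rfl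

theorem bracketAlt_eq {p q r : ℕ} (h : r + 1 = p + q) {P : MultivectorField J N p}
    {Q : MultivectorField J N q} (hP : IsSmoothMultivector P) (hQ : IsSmoothMultivector Q)
    (f : Fin r → C^∞⟮J, N; 𝓘(ℝ, ℝ), ℝ⟯) (x : N) :
    bracketAlt h hP hQ f x = (lieDeriv P (interior Q (exactForm f)) 0 x -
      (-1 : ℝ) ^ ((p + 1) * q) • interior Q (lieDeriv P (exactForm f)) 0 x) ![] := by
  have e := congrFun (congrFun (schouten_rhs h P Q f) 0) x
  refine Eq.trans ?_ (congrArg (fun η => η ![]) e.symm)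
  rw [bracketAlt_apply, ← interior_extD_interior h hP hQ,
    ← interior_extD_interior (by omega : r + 1 = q + p) hQ hP]
  rfl

/-- The bracket of two multiderivations depends, at a point, only on the differentials of its
arguments at the point. -/
theorem bracketAlt_eq_zero {p q r : ℕ} (h : r + 1 = p + q) {P : MultivectorField J N p}
    {Q : MultivectorField J N q} (hP : IsSmoothMultivector P) (hQ : IsSmoothMultivector Q)
    (f : Fin r → C^∞⟮J, N; 𝓘(ℝ, ℝ), ℝ⟯) (x : N) (hf : ∃ i, differentialAt x (f i) = 0) :
    bracketAlt h hP hQ f x = 0 := by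
  cases r with
  | zero => exact hf.choose.elim0
  | succ r =>
    let ev : C^∞⟮J, N; 𝓘(ℝ, ℝ), ℝ⟯ →ₗ[ℝ] ℝ :=
      { toFun := fun g => g x, map_add' := fun _ _ => rfl, map_smul' := fun _ _ => rfl }
    refine alternating_eq_zero_of_first (ev.compAlternatingMap (bracketAlt h hP hQ))
      (LinearMap.ker (differentialAt x)) (fun u a hu => ?_) f hf
    change bracketAlt h hP hQ _ x = 0
    have hspan : Submodule.span ℝ (differentialAt (J := J) x '' Set.univ) = ⊤ := by
      rw [Set.image_univ, (differentialAt_surjective x).range_eq, Submodule.span_univ]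
    obtain ⟨k, G, -, hli, hsp⟩ := exists_coframe Set.univ x hspan
    obtain ⟨c, hc⟩ := exists_coframe_expansion G hli hsp u
    have hcx : ∀ μ, c μ x = 0 := by
      have := hc.self_of_nhds
      rw [LinearMap.mem_ker.1 hu] at this
      exact Fintype.linearIndependent_iff.1 hli _ this.symm
    -- near `x`, `du ∧ …` is a sum of multiples of `dG_μ ∧ …` by functions vanishing at `x`, and the
    -- expression for the bracket in terms of Lie derivatives and contractions is linear over the
    -- functions
    let θ : Fin k → GradedForm J N := fun μ n y => c μ y • exactForm (Matrix.vecCons (G μ) a) n y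
    have hθ : ∀ μ ∈ Finset.univ, ∀ n, IsSmoothForm (θ μ n) := fun μ _ n =>
      (isSmoothForm_exactForm _ n).fun_smul (c μ).contMDiff
    have hPθ : ∀ μ ∈ Finset.univ, ∀ n, IsSmoothForm (interior P (θ μ) n) := fun μ _ n => by
      rw [interior_fun_smul]
      exact (hP _ _ n).fun_smul (c μ).contMDiff
    have hQθ : ∀ μ ∈ Finset.univ, ∀ n, IsSmoothForm (interior Q (θ μ) n) := fun μ _ n => by
      rw [interior_fun_smul]
      exact (hQ _ _ n).fun_smul (c μ).contMDiff
    have hPQθ : ∀ μ ∈ Finset.univ, ∀ n, IsSmoothForm (interior P (interior Q (θ μ)) n) :=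
      fun μ _ n => by
        rw [interior_fun_smul, interior_fun_smul, interior_interior_exactForm h]
        have : (fun n x => c μ x • (0 : GradedForm J N) n x) = (0 : GradedForm J N) := by
          funext n x
          exact smul_zero _
        rw [this]
        exact isSmoothForm_zero
    have hloc : ∀ᶠ y in nhds x, ∀ n,
        exactForm (Matrix.vecCons u a) n y = (∑ μ, θ μ) n y := by
      filter_upwards [hc] with y hy n
      have e1 := congrFun (exactForm_cons u a y) n
      rw [← differentialAt_apply, hy, extMul_sum_smul] at e1
      rw [Finset.sum_apply, Finset.sum_apply]
      refine e1.trans ?_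
      rw [Finset.sum_apply]
      refine Finset.sum_congr rfl fun μ _ => ?_
      have e2 := congrFun (exactForm_cons (G μ) a y) n
      exact congrArg (fun ζ : TangentSpace J y [⋀^Fin n]→L[ℝ] ℝ => c μ y • ζ) e2.symm
    have hlocQ : ∀ᶠ y in nhds x, ∀ n, interior Q (exactForm (Matrix.vecCons u a)) n y =
        interior Q (∑ μ, θ μ) n y := by
      filter_upwards [hloc] with y hy n
      rw [interior_apply, interior_apply, funext hy]
    rw [bracketAlt_eq, lieDeriv_congr P hlocQ, interior_apply, funext (lieDeriv_congr P hloc),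
      ← interior_apply, interior_sum, lieDeriv_sum _ P hQθ hPQθ, lieDeriv_sum _ P hθ hPθ,
      interior_sum]
    have e3 : ∀ η ζ : Fin k → GradedForm J N, (∑ μ, η μ) 0 x -
        (-1 : ℝ) ^ ((p + 1) * q) • (∑ μ, ζ μ) 0 x =
        ∑ μ, (η μ 0 x - (-1 : ℝ) ^ ((p + 1) * q) • ζ μ 0 x) := fun η ζ => by
      rw [Finset.sum_apply, Finset.sum_apply, Finset.sum_apply, Finset.sum_apply,
        Finset.sum_sub_distrib, Finset.smul_sum]
    rw [e3, Finset.sum_eq_zero]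
    · rfl
    · intro μ _
      refine (schouten_fun_smul h hP hQ (c μ) _ 0 x).trans ?_
      rw [hcx, zero_smul]

/-- The Schouten bracket of smooth multivector fields exists and is smooth. -/
theorem exists_isSchoutenBracket {p q r : ℕ} (h : r + 1 = p + q) {P : MultivectorField J N p}
    {Q : MultivectorField J N q} (hP : IsSmoothMultivector P) (hQ : IsSmoothMultivector Q) :
    ∃ R : MultivectorField J N r, IsSmoothMultivector R ∧ IsSchoutenBracket P Q R ∧
      ∀ f, evalOn R f = bracketAlt h hP hQ f := by
  have hex : ∀ x, ∃ R : ⋀[ℝ]^r (TangentSpace J x), ∀ f : Fin r → C^∞⟮J, N; 𝓘(ℝ, ℝ), ℝ⟯,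
      pairAlt (R : ExteriorAlgebra ℝ (TangentSpace J x)) r (fun i => differentialAt x (f i)) =
        bracketAlt h hP hQ f x := fun x => by
    let ev : C^∞⟮J, N; 𝓘(ℝ, ℝ), ℝ⟯ →ₗ[ℝ] ℝ :=
      { toFun := fun g => g x, map_add' := fun _ _ => rfl, map_smul' := fun _ _ => rfl }
    obtain ⟨B, hB⟩ := exists_descend (ev.compAlternatingMap (bracketAlt h hP hQ))
      (differentialAt x) (differentialAt_surjective x)
      fun f hf => bracketAlt_eq_zero h hP hQ f x hf
    obtain ⟨R, hR⟩ := exists_pair_eq B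
    exact ⟨R, fun f => by rw [pairAlt_apply, hR]; exact hB f⟩
  choose R hR using hex
  have hR' : ∀ f : Fin r → C^∞⟮J, N; 𝓘(ℝ, ℝ), ℝ⟯,
      evalOn (R : MultivectorField J N r) f = bracketAlt h hP hQ f :=
    fun f => funext fun x => hR x f
  refine ⟨R, isSmoothMultivector_of_evalOn fun f => ?_,
    (isSchoutenBracket_iff h hP hQ R).2 fun f x => congrFun (hR' f) x, hR'⟩
  rw [hR']
  exact (bracketAlt h hP hQ f).contMDiff

theorem isSchoutenBracket_iff_evalOn {p q r : ℕ} (h : r + 1 = p + q) {P : MultivectorField J N p}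
    {Q : MultivectorField J N q} (hP : IsSmoothMultivector P) (hQ : IsSmoothMultivector Q)
    (R : MultivectorField J N r) :
    IsSchoutenBracket P Q R ↔ ∀ f x, evalOn R f x = bracketAlt h hP hQ f x :=
  isSchoutenBracket_iff h hP hQ R

/-- The Schouten bracket is unique. -/
theorem IsSchoutenBracket.unique {p q r : ℕ} (h : r + 1 = p + q) {P : MultivectorField J N p}
    {Q : MultivectorField J N q} (hP : IsSmoothMultivector P) (hQ : IsSmoothMultivector Q)
    {R R' : MultivectorField J N r} (hR : IsSchoutenBracket P Q R)
    (hR' : IsSchoutenBracket P Q R') : R = R' :=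
  multivectorField_ext fun f x => by
    rw [(isSchoutenBracket_iff_evalOn h hP hQ R).1 hR f x,
      (isSchoutenBracket_iff_evalOn h hP hQ R').1 hR' f x]

end Manifold

/-! ### Sections of vector bundles -/

section Sections

variable {EM : Type*} [NormedAddCommGroup EM] [NormedSpace ℝ EM] [FiniteDimensional ℝ EM]
  {HM : Type*} [TopologicalSpace HM] {I : ModelWithCorners ℝ EM HM} [I.Boundaryless]
  {M : Type*} [TopologicalSpace M] [ChartedSpace HM M] [IsManifold I ∞ M] [T2Space M]
  {F : Type*} [NormedAddCommGroup F] [NormedSpace ℝ F]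
  {E : M → Type*} [∀ x, AddCommGroup (E x)] [∀ x, Module ℝ (E x)]
  [TopologicalSpace (Bundle.TotalSpace F E)] [∀ x, TopologicalSpace (E x)]
  [FiberBundle F E] [VectorBundle ℝ F E] [ContMDiffVectorBundle ∞ F E I]

variable (F) in
/-- The identification of a fibre with the model fibre given by the preferred trivialization. -/
def fiberEquiv (x : M) : E x ≃L[ℝ] F :=
  (trivializationAt F E x).continuousLinearEquivAt ℝ x (FiberBundle.mem_baseSet_trivializationAt' x)

/-- A section which is smooth near a point agrees near the point with a global smooth section. -/
theorem exists_section_eventuallyEq {s : ∀ x, E x} {x : M}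
    (hs : ∀ᶠ y in nhds x, ContMDiffAt I (I.prod 𝓘(ℝ, F)) ∞
      (fun z => Bundle.TotalSpace.mk' F z (s z)) y) :
    ∃ S : Cₛ^∞⟮I; F, E⟯, ∀ᶠ y in nhds x, S y = s y := by
  obtain ⟨U, hU, hUo, hxU⟩ := eventually_nhds_iff.1 hs
  obtain ⟨χ, -, hχ⟩ := (SmoothBumpFunction.nhds_basis_tsupport (I := I) x).mem_iff.1
    (hUo.mem_nhds hxU)
  refine ⟨⟨(χ : M → ℝ) • s, ContMDiffOn.smul_section_of_tsupport χ.contMDiff.contMDiffOn hUo hχ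
    fun y hy => (hU y hy).contMDiffWithinAt⟩, ?_⟩
  filter_upwards [χ.eventuallyEq_one] with y hy
  change χ y • s y = s y
  rw [hy]
  exact one_smul ℝ _

/-- There is a smooth section through every point of a vector bundle. -/
theorem exists_section_eq (x : M) (w : E x) : ∃ s : Cₛ^∞⟮I; F, E⟯, s x = w := by
  have h : ∀ᶠ y in nhds x, ContMDiffAt I (I.prod 𝓘(ℝ, F)) ∞ (fun z => Bundle.TotalSpace.mk' F z
      ((trivializationAt F E x).symm z (fiberEquiv F x w))) y := by
    filter_upwards [(trivializationAt F E x).open_baseSet.mem_nhds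
      (FiberBundle.mem_baseSet_trivializationAt' x)] with y hy
    rw [(trivializationAt F E x).contMDiffAt_section_iff hy]
    refine (contMDiffAt_const (c := fiberEquiv F x w)).congr_of_eventuallyEq ?_
    filter_upwards [(trivializationAt F E x).open_baseSet.mem_nhds hy] with z hz
    rw [(trivializationAt F E x).apply_mk_symm hz]
  obtain ⟨s, hs⟩ := exists_section_eventuallyEq h
  refine ⟨s, ?_⟩
  rw [hs.self_of_nhds]
  exact (fiberEquiv F x).symm_apply_apply w

theorem sum_section_apply {ι : Type*} (S : Finset ι) (s : ι → Cₛ^∞⟮I; F, E⟯) (x : M) :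
    (∑ i ∈ S, s i) x = ∑ i ∈ S, s i x := by
  classical
  induction S using Finset.induction_on with
  | empty => rfl
  | insert i S hi ih =>
    rw [Finset.sum_insert hi, Finset.sum_insert hi, ← ih]
    rfl

/-- A section vanishing at a point is a combination of sections with coefficients that vanish at
the point. -/
theorem mem_span_of_apply_eq_zero [FiniteDimensional ℝ F] (x : M) (s : Cₛ^∞⟮I; F, E⟯)
    (hs : s x = 0) : s ∈ Submodule.span ℝ {u : Cₛ^∞⟮I; F, E⟯ |
      ∃ (h : C^∞⟮I, M; 𝓘(ℝ, ℝ), ℝ⟯) (t : Cₛ^∞⟮I; F, E⟯), h x = 0 ∧ u = h • t} := by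
  have : ContMDiffVectorBundle 1 F E I := .of_le (n := ∞) (by simp)
  let e := trivializationAt F E x
  have hx : x ∈ e.baseSet := FiberBundle.mem_baseSet_trivializationAt' x
  have hnhds := e.open_baseSet.mem_nhds hx
  let b := Module.finBasis ℝ F
  have ht : ∀ i, ∃ t : Cₛ^∞⟮I; F, E⟯, ∀ᶠ y in nhds x, t y = e.localFrame b i y := fun i =>
    exists_section_eventuallyEq (by
      filter_upwards [hnhds] with y hy
      exact contMDiffAt_localFrame_of_mem ∞ e b i hy)
  choose t ht using ht
  have hc : ∀ i, ∃ c : C^∞⟮I, M; 𝓘(ℝ, ℝ), ℝ⟯, ∀ᶠ y in nhds x,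
      c y = e.localFrameCoeff I b i y (s y) := fun i =>
    exists_eventuallyEq (by
      filter_upwards [hnhds] with y hy
      exact contMDiffAt_localFrameCoeff b hy (s.contMDiff y) i)
  choose c hc using hc
  have hloc : ∀ᶠ y in nhds x, (s - ∑ i, c i • t i) y = 0 := by
    filter_upwards [hnhds, Filter.eventually_all.2 ht, Filter.eventually_all.2 hc]
      with y hy hty hcy
    change s y - (∑ i, c i • t i) y = 0
    rw [sum_section_apply, sub_eq_zero]
    simp only [smul_section_apply, hty, hcy]
    exact Bundle.Trivialization.eq_sum_localFrameCoeff_smul hy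
  obtain ⟨χ, -, hχ⟩ := (SmoothBumpFunction.nhds_basis_tsupport (I := I) x).mem_iff.1 hloc
  let θ : C^∞⟮I, M; 𝓘(ℝ, ℝ), ℝ⟯ := ⟨χ, χ.contMDiff⟩
  -- a bump function `θ` which is one at `x` and supported where the local expansion holds
  have hdec : s = ∑ i, c i • t i + (1 - θ) • (s - ∑ i, c i • t i) := by
    have h0 : θ • (s - ∑ i, c i • t i) = 0 := by
      ext y
      rw [smul_section_apply]
      by_cases hy : y ∈ tsupport χ
      · rw [show (s - ∑ i, c i • t i) y = 0 from hχ hy, smul_zero]; rfl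
      · rw [show θ y = 0 from image_eq_zero_of_notMem_tsupport hy, zero_smul]; rfl
    rw [sub_smul, one_smul, h0]
    abel
  rw [hdec]
  refine add_mem (sum_mem fun i _ => Submodule.subset_span ⟨c i, t i, ?_, rfl⟩)
    (Submodule.subset_span ⟨1 - θ, _, ?_, rfl⟩)
  · rw [(hc i).self_of_nhds, hs, map_zero]
  · change 1 - χ x = 0
    rw [χ.eq_one]
    ring

end Sections

section Functions

variable {EM : Type*} [NormedAddCommGroup EM] [NormedSpace ℝ EM] [FiniteDimensional ℝ EM]
  {HM : Type*} [TopologicalSpace HM] {I : ModelWithCorners ℝ EM HM} [I.Boundaryless]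
  {M : Type*} [TopologicalSpace M] [ChartedSpace HM M] [IsManifold I ∞ M] [T2Space M]

theorem contMDiffAt_of_dual {V : Type*} [NormedAddCommGroup V] [NormedSpace ℝ V]
    [FiniteDimensional ℝ V] {G : M → V} {x : M}
    (h : ∀ ψ : V →L[ℝ] ℝ, ContMDiffAt I 𝓘(ℝ, ℝ) ∞ (fun y => ψ (G y)) x) :
    ContMDiffAt I 𝓘(ℝ, V) ∞ G x := by
  let b := Module.finBasis ℝ V
  have e : G = fun y => ∑ i, LinearMap.toContinuousLinearMap (b.coord i) (G y) • b i :=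
    funext fun y => (b.sum_repr (G y)).symm
  rw [e]
  exact contMDiffAt_finsetSum fun i _ => (h _).smul contMDiffAt_const

theorem tangent_eq_zero {x : M} {X : TangentSpace I x}
    (h : ∀ α : TangentSpace I x →L[ℝ] ℝ, α X = 0) : X = 0 := by
  have key : ∀ X : EM, (∀ α : EM →L[ℝ] ℝ, α X = 0) → X = 0 := fun X hX => by
    by_contra hne
    obtain ⟨α, hα⟩ := SeparatingDual.exists_ne_zero (R := ℝ) hne
    exact hα (hX α)
  exact key X h

/-- A vector is determined by the derivatives of functions in its direction. -/
theorem tangent_ext {x : M} {X Y : TangentSpace I x}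
    (h : ∀ f : C^∞⟮I, M; 𝓘(ℝ, ℝ), ℝ⟯, differentialAt x f X = differentialAt x f Y) : X = Y := by
  rw [← sub_eq_zero]
  refine tangent_eq_zero fun α => ?_
  obtain ⟨f, rfl⟩ := differentialAt_surjective (J := I) x α
  rw [map_sub, h f, sub_self]

/-- A vector field is smooth if it maps smooth functions to smooth functions. -/
theorem contMDiff_of_differentialAt {X : ∀ x : M, TangentSpace I x}
    (h : ∀ f : C^∞⟮I, M; 𝓘(ℝ, ℝ), ℝ⟯, ContMDiff I 𝓘(ℝ, ℝ) ∞ fun x => differentialAt x f (X x)) :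
    ContMDiff I (I.prod 𝓘(ℝ, EM)) ∞
      (fun x => Bundle.TotalSpace.mk' EM (E := (TangentSpace I : M → Type _)) x (X x)) := by
  have : IsManifold I 1 M := .of_le (n := ∞) (by simp)
  intro x₀
  rw [Bundle.contMDiffAt_section]
  -- the coordinates of the vector field are the derivatives of the coordinate functions
  refine contMDiffAt_of_dual fun ψ => ?_
  obtain ⟨f, hf⟩ := exists_eventuallyEq (g := ψ ∘ extChartAt I x₀) (x := x₀)
    (Filter.eventually_of_mem (extChartAt_source_mem_nhds (I := I) x₀) fun y hy =>
      ψ.contDiff.contDiffAt.comp_contMDiffAt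
        (contMDiffAt_extChartAt' (n := ∞) (by simpa using hy)))
  refine ((h f).contMDiffAt).congr_of_eventuallyEq ?_
  filter_upwards [extChartAt_source_mem_nhds (I := I) x₀, hf.eventually_nhds] with x hx hfx
  rw [extChartAt_source] at hx
  have hφ : MDifferentiableAt I 𝓘(ℝ, EM) (extChartAt I x₀) x :=
    (contMDiffAt_extChartAt' (n := ∞) hx).mdifferentiableAt (by simp)
  have h1 : mfderiv I 𝓘(ℝ, ℝ) f x = mfderiv I 𝓘(ℝ, ℝ) (ψ ∘ extChartAt I x₀) x :=
    Filter.EventuallyEq.mfderiv_eq hfx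
  have h2 : differentialAt x f (X x) = ψ (mfderiv I 𝓘(ℝ, EM) (extChartAt I x₀) x (X x)) := by
    change mfderiv I 𝓘(ℝ, ℝ) f x (X x) = _
    rw [h1, mfderiv_comp (I' := 𝓘(ℝ, EM)) x ψ.mdifferentiableAt hφ]
    have := ψ.mfderiv_eq (x := extChartAt I x₀ x)
    rw [this]
    rfl
  have h3 : (trivializationAt EM (TangentSpace I) x₀).continuousLinearMapAt ℝ x (X x) =
      ((trivializationAt EM (TangentSpace I) x₀) ⟨x, X x⟩).2 := by
    rw [Bundle.Trivialization.continuousLinearMapAt_apply,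
      Bundle.Trivialization.linearMapAt_apply, if_pos (by simpa using hx)]
  rw [h2]
  exact congrArg ψ (h3.symm.trans
    (DFunLike.congr_fun (TangentBundle.continuousLinearMapAt_trivializationAt hx) (X x)))

/-- The derivative of a smooth function along a smooth vector field is smooth. -/
theorem contMDiff_differentialAt_apply (X : Cₛ^∞⟮I; EM, (TangentSpace I : M → Type _)⟯)
    (f : C^∞⟮I, M; 𝓘(ℝ, ℝ), ℝ⟯) : ContMDiff I 𝓘(ℝ, ℝ) ∞ fun x => differentialAt x f (X x) := by
  have : IsManifold I 1 M := .of_le (n := ∞) (by simp)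
  have h1 := (f.contMDiff.contMDiff_tangentMap (m := ∞) (by simp)).comp X.contMDiff
  exact (contMDiff_snd_tangentBundle_modelSpace ℝ 𝓘(ℝ, ℝ)).comp h1

end Functions

/-! ### Functions and cotangent vectors on the dual bundle -/

section TotalSpace

variable {M : Type*} [TopologicalSpace M] [T2Space M]
  {F : Type*} [TopologicalSpace F] [T2Space F] {E : M → Type*} [∀ x, TopologicalSpace (E x)]
  [TopologicalSpace (Bundle.TotalSpace F E)] [FiberBundle F E]

theorem t2Space_totalSpace : T2Space (Bundle.TotalSpace F E) := by
  refine ⟨fun v w hvw => ?_⟩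
  by_cases hb : v.1 = w.1
  · let e := trivializationAt F E v.1
    have hv : v ∈ e.source := FiberBundle.mem_trivializationAt_proj_source
    have hw : w ∈ e.source := by
      rw [e.mem_source, ← hb]
      exact FiberBundle.mem_baseSet_trivializationAt' v.1
    have hne : e v ≠ e w := fun h => hvw (e.injOn hv hw h)
    obtain ⟨U, V, hU, hV, hvU, hwV, hUV⟩ := t2_separation hne
    exact ⟨_, _, e.continuousOn.isOpen_inter_preimage e.open_source hU,
      e.continuousOn.isOpen_inter_preimage e.open_source hV, ⟨hv, hvU⟩, ⟨hw, hwV⟩,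
      (hUV.preimage e).mono Set.inter_subset_right Set.inter_subset_right⟩
  · obtain ⟨U, V, hU, hV, hvU, hwV, hUV⟩ := t2_separation hb
    exact ⟨_, _, hU.preimage (FiberBundle.continuous_proj F E),
      hV.preimage (FiberBundle.continuous_proj F E), hvU, hwV, hUV.preimage _⟩

end TotalSpace

section Dual

variable {EM : Type*} [NormedAddCommGroup EM] [NormedSpace ℝ EM] [FiniteDimensional ℝ EM]
  {HM : Type*} [TopologicalSpace HM] {I : ModelWithCorners ℝ EM HM} [I.Boundaryless]
  {M : Type*} [TopologicalSpace M] [ChartedSpace HM M] [IsManifold I ∞ M] [T2Space M]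
  {F : Type*} [NormedAddCommGroup F] [NormedSpace ℝ F] [FiniteDimensional ℝ F]
  {E : M → Type*} [∀ x, AddCommGroup (E x)] [∀ x, Module ℝ (E x)]
  [TopologicalSpace (Bundle.TotalSpace F E)] [∀ x, TopologicalSpace (E x)]
  [FiberBundle F E] [VectorBundle ℝ F E] [ContMDiffVectorBundle ∞ F E I]

instance : T2Space (DualTotal F E) := t2Space_totalSpace

theorem hat_apply (s : Cₛ^∞⟮I; F, E⟯) (v : DualTotal F E) : hat s v = v.2 (s v.1) := rfl

/-- The pullback to `E*` of a function on the base. -/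
def basic (f : C^∞⟮I, M; 𝓘(ℝ, ℝ), ℝ⟯) :
    C^∞⟮dualModel I F, DualTotal F E; 𝓘(ℝ, ℝ), ℝ⟯ :=
  ⟨fun v => f v.1, f.contMDiff.comp (Bundle.contMDiff_proj (DualFiber E))⟩

theorem basic_apply (f : C^∞⟮I, M; 𝓘(ℝ, ℝ), ℝ⟯) (v : DualTotal F E) :
    basic (E := E) f v = f v.1 := rfl

/-- The map `s ↦ ŝ`. -/
def hatLM : Cₛ^∞⟮I; F, E⟯ →ₗ[ℝ] C^∞⟮dualModel I F, DualTotal F E; 𝓘(ℝ, ℝ), ℝ⟯ where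
  toFun := hat
  map_add' s t := by ext v; exact map_add v.2 (s v.1) (t v.1)
  map_smul' c s := by ext v; exact map_smul v.2 c (s v.1)

/-- The map `f ↦ π^* f`. -/
def basicLM : C^∞⟮I, M; 𝓘(ℝ, ℝ), ℝ⟯ →ₗ[ℝ] C^∞⟮dualModel I F, DualTotal F E; 𝓘(ℝ, ℝ), ℝ⟯ where
  toFun := basic
  map_add' _ _ := rfl
  map_smul' _ _ := rfl

theorem hat_smul (f : C^∞⟮I, M; 𝓘(ℝ, ℝ), ℝ⟯) (s : Cₛ^∞⟮I; F, E⟯) :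
    hat (f • s) = basic f * hat s := by
  ext v
  exact map_smul v.2 (f v.1) (s v.1)

theorem differentialAt_hat_smul (f : C^∞⟮I, M; 𝓘(ℝ, ℝ), ℝ⟯) (s : Cₛ^∞⟮I; F, E⟯)
    (v : DualTotal F E) : differentialAt v (hat (f • s)) =
      f v.1 • differentialAt v (hat s) + v.2 (s v.1) • differentialAt v (basic f) := by
  rw [hat_smul, differentialAt_mul]
  rfl

/-- The preferred trivialization of the dual bundle, in terms of the one of the bundle. -/
theorem dual_trivialization_apply (x : M) (v : DualTotal F E)
    (hv : v.1 ∈ (trivializationAt F E x).baseSet) (b : F) :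
    (trivializationAt (F →L[ℝ] ℝ) (DualFiber E) x v).2 b =
      v.2 ((trivializationAt F E x).symm v.1 b) := by
  have h := hom_trivializationAt_apply (RingHom.id ℝ) (F₁ := F) (E₁ := E) (F₂ := ℝ)
    (E₂ := Bundle.Trivial M ℝ) x v
  rw [h]
  change ContinuousLinearMap.inCoordinates F E ℝ (Bundle.Trivial M ℝ) x v.1 x v.1 v.2 b = _
  rw [ContinuousLinearMap.inCoordinates_eq hv (by simp)]
  rfl

/-- A covector on the fibre over `x`, in coordinates of the model fibre. -/
def fiberIncl (x : M) (ψ : F →L[ℝ] ℝ) : DualTotal F E :=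
  ⟨x, (fiberEquiv (F →L[ℝ] ℝ) (E := DualFiber E) x).symm ψ⟩

theorem contMDiff_fiberIncl (x : M) : ContMDiff 𝓘(ℝ, F →L[ℝ] ℝ) (dualModel I F) ∞
    (fiberIncl (E := E) x : (F →L[ℝ] ℝ) → DualTotal F E) := by
  intro ψ
  rw [Bundle.contMDiffAt_totalSpace]
  refine ⟨contMDiffAt_const, contMDiffAt_id.congr_of_eventuallyEq (Filter.Eventually.of_forall
    fun φ => ?_)⟩
  exact (fiberEquiv (F →L[ℝ] ℝ) (E := DualFiber E) x).apply_symm_apply φ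

theorem exists_fiberIncl (v : DualTotal F E) : ∃ ψ, fiberIncl (E := E) v.1 ψ = v :=
  ⟨fiberEquiv (F →L[ℝ] ℝ) (E := DualFiber E) v.1 v.2, by
    cases v
    simp [fiberIncl]⟩

theorem fiberIncl_eq {x : M} {ψ : F →L[ℝ] ℝ} {w : DualFiber E x}
    (h : fiberEquiv (F →L[ℝ] ℝ) (E := DualFiber E) x w = ψ) :
    fiberIncl (E := E) x ψ = ⟨x, w⟩ := by
  rw [← h, fiberIncl, ContinuousLinearEquiv.symm_apply_apply]

/-- The derivative of a function along a curve in a fibre. -/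
theorem hasDerivAt_comp_fiberIncl (G : C^∞⟮dualModel I F, DualTotal F E; 𝓘(ℝ, ℝ), ℝ⟯) (x : M)
    {γ : ℝ → F →L[ℝ] ℝ} {γ' : F →L[ℝ] ℝ} {t : ℝ} (hγ : HasDerivAt γ γ' t) :
    HasDerivAt (fun u => G (fiberIncl x (γ u)))
      (differentialAt (fiberIncl x (γ t)) G
        (mfderiv 𝓘(ℝ, F →L[ℝ] ℝ) (dualModel I F) (fiberIncl (E := E) x) (γ t) γ')) t := by
  have hg := G.contMDiff.mdifferentiableAt (x := fiberIncl x (γ t)) (by simp)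
  have hi := (contMDiff_fiberIncl (I := I) (E := E) x).mdifferentiableAt (x := γ t) (by simp)
  have h1 := mfderiv_comp (γ t) hg hi
  rw [mfderiv_eq_fderiv] at h1
  have hd : DifferentiableAt ℝ (G ∘ fiberIncl x) (γ t) :=
    (G.contMDiff.comp (contMDiff_fiberIncl x)).contDiff.differentiable (by simp) _
  have h2 := hd.hasFDerivAt.comp_hasDerivAt t hγ
  rw [h1] at h2
  exact h2

/-- A covector on a fibre, given by a covector on the model fibre. -/
def dualOf (x : M) (ψ : F →L[ℝ] ℝ) : DualFiber E x := ψ.comp (fiberEquiv F (E := E) x).toContinuousLinearMap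

theorem exists_dualOf_ne_zero {x : M} {w : E x} (hw : w ≠ 0) :
    ∃ ψ : F →L[ℝ] ℝ, dualOf (E := E) x ψ w ≠ 0 :=
  SeparatingDual.exists_ne_zero (R := ℝ) (x := fiberEquiv F x w)
    fun h => hw ((fiberEquiv F x).map_eq_zero_iff.1 h)

theorem section_ext_of_hat {s t : Cₛ^∞⟮I; F, E⟯}
    (h : hat s = hat t) : s = t := by
  ext x
  rw [← sub_eq_zero]
  by_contra hne
  obtain ⟨φ, hv⟩ := exists_dualOf_ne_zero (F := F) (E := E) hne
  let v : DualFiber E x := dualOf x φ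
  refine hv ((map_sub v _ _).trans (sub_eq_zero.2 ?_))
  exact DFunLike.congr_fun h (⟨x, v⟩ : DualTotal F E)

/-- A covector `dŝ + d(π^* f)` determines the value of `s`, by differentiation in the direction of
the fibre. -/
theorem apply_eq_zero_of_differentialAt (v : DualTotal F E) (s : Cₛ^∞⟮I; F, E⟯)
    (f : C^∞⟮I, M; 𝓘(ℝ, ℝ), ℝ⟯) (h : differentialAt v (hat s) + differentialAt v (basic f) = 0) :
    s v.1 = 0 := by
  obtain ⟨ψ, hψ⟩ := exists_fiberIncl v
  by_contra hne
  obtain ⟨φ₀, hw⟩ := exists_dualOf_ne_zero (F := F) (E := E) hne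
  set w : DualFiber E v.1 := dualOf v.1 φ₀
  let φ := fiberEquiv (F →L[ℝ] ℝ) (E := DualFiber E) v.1 w
  have hline : HasDerivAt (fun t : ℝ => ψ + t • φ) φ 0 := by
    simpa using ((hasDerivAt_id (0 : ℝ)).smul_const φ).const_add ψ
  have h3 : ∀ t : ℝ, fiberIncl (E := E) v.1 (ψ + t • φ) = ⟨v.1, v.2 + t • w⟩ := fun t => by
    refine fiberIncl_eq ?_
    rw [map_add, map_smul]
    congr 1
    have : v = ⟨v.1, (fiberEquiv (F →L[ℝ] ℝ) (E := DualFiber E) v.1).symm ψ⟩ := hψ.symm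
    rw [Bundle.TotalSpace.ext_iff] at this
    rw [eq_of_heq this.2, ContinuousLinearEquiv.apply_symm_apply]
  have h4 := (hasDerivAt_comp_fiberIncl (hat s) v.1 hline).add
    (hasDerivAt_comp_fiberIncl (basic (E := E) (F := F) f) v.1 hline)
  have h0 : fiberIncl (E := E) v.1 (ψ + (0 : ℝ) • φ) = v := by rw [zero_smul, add_zero, hψ]
  rw [← add_apply, h0, h, zero_apply] at h4
  have h5 : HasDerivAt (fun t : ℝ => (hat s v + f v.1) + t * w (s v.1)) (w (s v.1)) 0 := by
    simpa using ((hasDerivAt_id (0 : ℝ)).mul_const (w (s v.1))).const_add (hat s v + f v.1)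
  refine hw (h5.unique ?_)
  refine h4.congr_of_eventuallyEq (Filter.Eventually.of_forall fun t => ?_)
  change _ = hat s (fiberIncl (E := E) v.1 (ψ + t • φ)) + basic f (fiberIncl (E := E) v.1 (ψ + t • φ))
  rw [h3, hat_apply, hat_apply, basic_apply]
  change _ = (v.2 (s v.1) + t * w (s v.1)) + f v.1
  ring

end Dual

theorem eq_zero_of_mvfderiv_extChartAt {EN : Type*} [NormedAddCommGroup EN] [NormedSpace ℝ EN]
    [FiniteDimensional ℝ EN] {HN : Type*} [TopologicalSpace HN] {J : ModelWithCorners ℝ EN HN}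
    [J.Boundaryless] {N : Type*} [TopologicalSpace N] [ChartedSpace HN N] [IsManifold J ∞ N]
    [T2Space N] {x : N} {Y : TangentSpace J x} (h : mvfderiv J (extChartAt J x) x Y = 0) : Y = 0 :=
  (mvfderiv_extChartAt_bijective x).1 (h.trans (map_zero _).symm)

section Dual

variable {EM : Type*} [NormedAddCommGroup EM] [NormedSpace ℝ EM] [FiniteDimensional ℝ EM]
  {HM : Type*} [TopologicalSpace HM] {I : ModelWithCorners ℝ EM HM} [I.Boundaryless]
  {M : Type*} [TopologicalSpace M] [ChartedSpace HM M] [IsManifold I ∞ M] [T2Space M]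
  {F : Type*} [NormedAddCommGroup F] [NormedSpace ℝ F] [FiniteDimensional ℝ F]
  {E : M → Type*} [∀ x, AddCommGroup (E x)] [∀ x, Module ℝ (E x)]
  [TopologicalSpace (Bundle.TotalSpace F E)] [∀ x, TopologicalSpace (E x)]
  [FiberBundle F E] [VectorBundle ℝ F E] [ContMDiffVectorBundle ∞ F E I]

/-- Tangent vectors of the base can be lifted to any point of `E*`. -/
theorem exists_lift (v : DualTotal F E) :
    ∃ A : TangentSpace I v.1 →L[ℝ] TangentSpace (dualModel I F) v,
      ∀ (f : C^∞⟮I, M; 𝓘(ℝ, ℝ), ℝ⟯) (X : TangentSpace I v.1),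
        differentialAt v (basic f) (A X) = differentialAt v.1 f X := by
  -- the lift is the derivative of a section through `v`
  obtain ⟨τ, hτ⟩ := exists_section_eq (I := I) (F := F →L[ℝ] ℝ) (E := DualFiber E) v.1 v.2
  let T : M → DualTotal F E := fun x => ⟨x, τ x⟩
  have hT : T v.1 = v := by
    change Bundle.TotalSpace.mk v.1 (τ v.1) = v
    rw [hτ]
  have hTs : MDifferentiableAt I (dualModel I F) T v.1 :=
    (τ.contMDiff.mdifferentiableAt (by simp))
  have key : ∃ A : TangentSpace I v.1 →L[ℝ] TangentSpace (dualModel I F) (T v.1),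
      ∀ (f : C^∞⟮I, M; 𝓘(ℝ, ℝ), ℝ⟯) (X : TangentSpace I v.1),
        differentialAt (T v.1) (basic f) (A X) = differentialAt v.1 f X := by
    refine ⟨mfderiv I (dualModel I F) T v.1, fun f X => ?_⟩
    have h := mfderiv_comp v.1
      ((basic (E := E) (F := F) f).contMDiff.mdifferentiableAt (x := T v.1) (by simp)) hTs
    exact (DFunLike.congr_fun h X).symm
  rwa [hT] at key

/-- A tangent vector of `E*` is determined by the derivatives of the functions `ŝ` and `π^* f`. -/
theorem dual_tangent_eq_zero {v : DualTotal F E} {Y : TangentSpace (dualModel I F) v}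
    (hs : ∀ s : Cₛ^∞⟮I; F, E⟯, differentialAt v (hat s) Y = 0)
    (hf : ∀ f : C^∞⟮I, M; 𝓘(ℝ, ℝ), ℝ⟯, differentialAt v (basic f) Y = 0) : Y = 0 := by
  let φ : DualTotal F E → EM × (F →L[ℝ] ℝ) := extChartAt (dualModel I F) v
  have hφ : MDifferentiableAt (dualModel I F) 𝓘(ℝ, EM × (F →L[ℝ] ℝ)) φ v :=
    (contMDiffAt_extChartAt (n := ∞)).mdifferentiableAt (by simp)
  -- the components of the chart around `v` are pulled back functions and linear functions
  have hφ_apply : ∀ w : DualTotal F E, φ w = (extChartAt I v.1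
      (trivializationAt (F →L[ℝ] ℝ) (DualFiber E) v.1 w).1,
      (trivializationAt (F →L[ℝ] ℝ) (DualFiber E) v.1 w).2) := fun w => by
    change extChartAt (I.prod 𝓘(ℝ, F →L[ℝ] ℝ)) v w = _
    rw [FiberBundle.extChartAt]
    rfl
  have hbase : ∀ᶠ w : DualTotal F E in nhds v,
      w.1 ∈ (trivializationAt F E v.1).baseSet :=
    (FiberBundle.continuous_proj (F →L[ℝ] ℝ) (DualFiber E)).continuousAt.eventually
      ((trivializationAt F E v.1).open_baseSet.mem_nhds
        (FiberBundle.mem_baseSet_trivializationAt' v.1))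
  have hbase' : ∀ᶠ w : DualTotal F E in nhds v,
      w ∈ (trivializationAt (F →L[ℝ] ℝ) (DualFiber E) v.1).source :=
    (trivializationAt (F →L[ℝ] ℝ) (DualFiber E) v.1).open_source.mem_nhds
      FiberBundle.mem_trivializationAt_proj_source
  have key : ∀ β : EM × (F →L[ℝ] ℝ) →L[ℝ] ℝ, ∀ G : C^∞⟮dualModel I F, DualTotal F E; 𝓘(ℝ, ℝ), ℝ⟯,
      (∀ᶠ w in nhds v, G w = β (φ w)) → differentialAt v G Y = 0 →
        β (mvfderiv (dualModel I F) φ v Y) = 0 := fun β G hG h0 => by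
    have h1 : mfderiv (dualModel I F) 𝓘(ℝ, ℝ) G v =
        mfderiv (dualModel I F) 𝓘(ℝ, ℝ) (β ∘ φ) v := Filter.EventuallyEq.mfderiv_eq hG
    have h2 := mfderiv_comp (I' := 𝓘(ℝ, EM × (F →L[ℝ] ℝ))) v (β.mdifferentiableAt (x := φ v)) hφ
    have h3 := β.mfderiv_eq (x := φ v)
    rw [h3] at h2
    exact (DFunLike.congr_fun (h1.trans h2) Y).symm.trans h0
  apply eq_zero_of_mvfderiv_extChartAt
  change mvfderiv (dualModel I F) φ v Y = 0
  refine Prod.ext ?_ ?_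
  · by_contra hne
    obtain ⟨ψ, hψ⟩ := SeparatingDual.exists_ne_zero (R := ℝ) hne
    apply hψ
    obtain ⟨f, hfψ⟩ := exists_eventuallyEq (g := ψ ∘ extChartAt I v.1) (x := v.1)
      (Filter.eventually_of_mem (extChartAt_source_mem_nhds (I := I) v.1) fun y hy =>
        ψ.contDiff.contDiffAt.comp_contMDiffAt
          (contMDiffAt_extChartAt' (n := ∞) (by simpa using hy)))
    refine key (ψ.comp (ContinuousLinearMap.fst ℝ EM (F →L[ℝ] ℝ))) (basic f) ?_ (hf f)
    filter_upwards [hbase', (FiberBundle.continuous_proj (F →L[ℝ] ℝ)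
      (DualFiber E)).continuousAt.eventually hfψ] with w hw hfw
    rw [basic_apply, hfw, hφ_apply]
    change ψ _ = ψ _
    rw [Bundle.Trivialization.coe_fst _ hw]
    rfl
  · ext b
    let s₀ : ∀ x, E x := fun x => (trivializationAt F E v.1).symm x b
    obtain ⟨s, hs₀⟩ := exists_section_eventuallyEq (I := I) (F := F) (s := s₀) (x := v.1) (by
      filter_upwards [(trivializationAt F E v.1).open_baseSet.mem_nhds
        (FiberBundle.mem_baseSet_trivializationAt' v.1)] with y hy
      rw [(trivializationAt F E v.1).contMDiffAt_section_iff hy]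
      refine (contMDiffAt_const (c := b)).congr_of_eventuallyEq ?_
      filter_upwards [(trivializationAt F E v.1).open_baseSet.mem_nhds hy] with z hz
      rw [(trivializationAt F E v.1).apply_mk_symm hz])
    refine key ((ContinuousLinearMap.apply ℝ ℝ b).comp
      (ContinuousLinearMap.snd ℝ EM (F →L[ℝ] ℝ))) (hat s) ?_ (hs s)
    filter_upwards [hbase, (FiberBundle.continuous_proj (F →L[ℝ] ℝ)
      (DualFiber E)).continuousAt.eventually hs₀] with w hw hsw
    rw [hφ_apply, hat_apply, hsw]
    change _ = (trivializationAt (F →L[ℝ] ℝ) (DualFiber E) v.1 w).2 b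
    rw [dual_trivialization_apply _ _ hw]

end Dual

section Reflexivity

variable {V : Type*} [AddCommGroup V] [Module ℝ V] [TopologicalSpace V] [IsTopologicalAddGroup V]
  [ContinuousSMul ℝ V] [T2Space V] [FiniteDimensional ℝ V]

/-- Finite dimensional spaces are reflexive. -/
theorem exists_eval_eq (φ : (V →L[ℝ] ℝ) →ₗ[ℝ] ℝ) : ∃ Y : V, ∀ α : V →L[ℝ] ℝ, α Y = φ α := by
  let φ' : Module.Dual ℝ (Module.Dual ℝ V) :=
    φ ∘ₗ (LinearMap.toContinuousLinearMap : (V →ₗ[ℝ] ℝ) ≃ₗ[ℝ] (V →L[ℝ] ℝ)).toLinearMap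
  refine ⟨(Module.evalEquiv ℝ V).symm φ', fun α => ?_⟩
  have h := Module.apply_evalEquiv_symm_apply ℝ V α.toLinearMap φ'
  refine h.trans ?_
  change φ (LinearMap.toContinuousLinearMap α.toLinearMap) = φ α
  congr 1

/-- A subspace of the dual space which separates points is the whole dual space. -/
theorem span_eq_top_of_separating (S : Submodule ℝ (V →L[ℝ] ℝ))
    (h : ∀ Y : V, (∀ α ∈ S, α Y = 0) → Y = 0) : S = ⊤ := by
  by_contra hne
  obtain ⟨φ, hφ, hS⟩ := S.exists_le_ker_of_lt_top (lt_top_iff_ne_top.2 hne)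
  obtain ⟨Y, hY⟩ := exists_eval_eq φ
  have h0 := h Y fun α hα => (hY α).trans (hS hα)
  apply hφ
  ext α
  rw [← hY, h0, map_zero]
  rfl

end Reflexivity

/-- An alternating map vanishes if it vanishes on a spanning set. -/
theorem alternating_eq_zero_of_span {W X : Type*} [AddCommGroup W] [Module ℝ W] [AddCommGroup X]
    [Module ℝ X] {n : ℕ} (B : W [⋀^Fin n]→ₗ[ℝ] X) (S : Set W) (hS : Submodule.span ℝ S = ⊤)
    (h : ∀ a : Fin n → W, (∀ i, a i ∈ S) → B a = 0) (a : Fin n → W) : B a = 0 := by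
  classical
  suffices H : ∀ (s : Finset (Fin n)) (a : Fin n → W), (∀ i ∉ s, a i ∈ S) → B a = 0 from
    H Finset.univ a fun i hi => absurd (Finset.mem_univ i) hi
  intro s
  induction s using Finset.induction_on with
  | empty => exact fun a ha => h a fun i => ha i (Finset.notMem_empty i)
  | insert j s hj ih =>
    intro a ha
    have key : ∀ x ∈ Submodule.span ℝ S, B (Function.update a j x) = 0 := by
      intro x hx
      induction hx using Submodule.span_induction with
      | mem x hx =>
        refine ih _ fun i hi => ?_
        by_cases hij : i = j
        · subst hij; simpa using hx
        · rw [Function.update_of_ne hij]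
          exact ha i (by simp [hij, hi])
      | zero => exact B.map_update_zero a j
      | add x y _ _ hx hy => rw [B.map_update_add, hx, hy, add_zero]
      | smul c x _ hx => rw [B.map_update_smul, hx, smul_zero]
    rw [← Function.update_eq_self j a]
    exact key (a j) (hS ▸ Submodule.mem_top)

section Generic

variable {EN : Type*} [NormedAddCommGroup EN] [NormedSpace ℝ EN]
  {HN : Type*} [TopologicalSpace HN] {J : ModelWithCorners ℝ EN HN}
  {N : Type*} [TopologicalSpace N] [ChartedSpace HN N]

theorem evalOn_smul {p : ℕ} (c : ℝ) (P : MultivectorField J N p)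
    (f : Fin p → C^∞⟮J, N; 𝓘(ℝ, ℝ), ℝ⟯) (x : N) : evalOn (c • P) f x = c * evalOn P f x := by
  rw [evalOn, interior_smul_left]
  rfl

theorem evalOn_add {p : ℕ} (P Q : MultivectorField J N p)
    (f : Fin p → C^∞⟮J, N; 𝓘(ℝ, ℝ), ℝ⟯) (x : N) :
    evalOn (P + Q) f x = evalOn P f x + evalOn Q f x := by
  rw [evalOn, interior_add_left]
  rfl

theorem evalOn_zero {p : ℕ} (f : Fin p → C^∞⟮J, N; 𝓘(ℝ, ℝ), ℝ⟯) (x : N) :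
    evalOn (0 : MultivectorField J N p) f x = 0 := by
  simpa using evalOn_smul (0 : ℝ) (0 : MultivectorField J N p) f x

end Generic

section Dual

variable {EM : Type*} [NormedAddCommGroup EM] [NormedSpace ℝ EM] [FiniteDimensional ℝ EM]
  {HM : Type*} [TopologicalSpace HM] {I : ModelWithCorners ℝ EM HM} [I.Boundaryless]
  {M : Type*} [TopologicalSpace M] [ChartedSpace HM M] [IsManifold I ∞ M] [T2Space M]
  {F : Type*} [NormedAddCommGroup F] [NormedSpace ℝ F] [FiniteDimensional ℝ F]
  {E : M → Type*} [∀ x, AddCommGroup (E x)] [∀ x, Module ℝ (E x)]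
  [TopologicalSpace (Bundle.TotalSpace F E)] [∀ x, TopologicalSpace (E x)]
  [FiberBundle F E] [VectorBundle ℝ F E] [ContMDiffVectorBundle ∞ F E I]

variable (I F E) in
/-- The functions `ŝ + π^* f` on `E*`, affine linear on the fibres. -/
def affineFunctions : Set C^∞⟮dualModel I F, DualTotal F E; 𝓘(ℝ, ℝ), ℝ⟯ :=
  Set.range fun a : Cₛ^∞⟮I; F, E⟯ × C^∞⟮I, M; 𝓘(ℝ, ℝ), ℝ⟯ => hat a.1 + basic a.2

/-- The differentials of the functions `ŝ + π^* f` span the cotangent spaces. -/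
theorem span_affineFunctions (v : DualTotal F E) :
    Submodule.span ℝ (differentialAt (J := dualModel I F) v '' affineFunctions I F E) = ⊤ := by
  have h0 : hat (0 : Cₛ^∞⟮I; F, E⟯) = 0 := hatLM.map_zero
  refine span_eq_top_of_separating _ fun Y hY => dual_tangent_eq_zero
    (fun s => hY _ (Submodule.subset_span ⟨_, ⟨(s, 0), rfl⟩, ?_⟩))
    (fun f => hY _ (Submodule.subset_span ⟨_, ⟨(0, f), rfl⟩, ?_⟩))
  · change differentialAt v (hat s + basicLM 0) = _
    rw [map_zero, add_zero]
  · change differentialAt v (hat 0 + basic f) = _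
    rw [h0, zero_add]

/-- Off the zero section, the differentials of the functions `ŝ` span the cotangent space. -/
theorem span_hat {v : DualTotal F E} (hv : v.2 ≠ 0) :
    Submodule.span ℝ (differentialAt v '' Set.range (hat : Cₛ^∞⟮I; F, E⟯ → _)) = ⊤ := by
  have hmem : ∀ s : Cₛ^∞⟮I; F, E⟯, differentialAt v (hat s) ∈
      Submodule.span ℝ (differentialAt v '' Set.range (hat : Cₛ^∞⟮I; F, E⟯ → _)) :=
    fun s => Submodule.subset_span ⟨_, ⟨s, rfl⟩, rfl⟩
  refine span_eq_top_of_separating _ fun Y hY => dual_tangent_eq_zero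
    (fun s => hY _ (hmem s)) fun f => ?_
  obtain ⟨w, hw⟩ : ∃ w, v.2 w ≠ 0 := by
    by_contra! h
    exact hv (ContinuousLinearMap.ext h)
  obtain ⟨s, hs⟩ := exists_section_eq (I := I) (F := F) v.1 w
  have h1 := hY _ (hmem (f • s))
  rw [differentialAt_hat_smul, add_apply, smul_apply, hY _ (hmem s), smul_zero, zero_add,
    smul_apply, hs] at h1
  exact (smul_eq_zero.1 h1).resolve_left hw

/-- A smooth multivector field on `E*` is determined by its values on the functions `ŝ`. -/
theorem multivector_eq_zero_of_hat [Nontrivial F] {p : ℕ}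
    {P : MultivectorField (dualModel I F) (DualTotal F E) p} (hP : IsSmoothMultivector P)
    (h : ∀ (s : Fin p → Cₛ^∞⟮I; F, E⟯) v, evalOn P (fun i => hat (s i)) v = 0) : P = 0 := by
  have hzero : ∀ (f : Fin p → C^∞⟮dualModel I F, DualTotal F E; 𝓘(ℝ, ℝ), ℝ⟯)
      (v : DualTotal F E), v.2 ≠ 0 → evalOn P f v = 0 := fun f v hv => by
    rw [evalOn_eq_pair]
    refine alternating_eq_zero_of_span _ _ (span_hat hv) (fun a ha => ?_) _
    choose g hg hga using ha
    choose s hs using hg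
    have e : a = fun i => differentialAt v (hat (s i)) := funext fun i => by rw [hs, hga]
    rw [e]
    exact h s v
  refine multivectorField_ext fun f v => ?_
  rw [evalOn_zero]
  by_cases hv : v.2 = 0
  -- the points off the zero section are dense, as the fibres have positive dimension
  · obtain ⟨ψ, hψ⟩ : ∃ ψ : F →L[ℝ] ℝ, ψ ≠ 0 := exists_ne 0
    have hv0 : fiberIncl (E := E) v.1 0 = v := by
      rw [fiberIncl_eq (w := 0) (map_zero _), ← hv]
    have hc : Continuous fun t : ℝ => evalOn P f (fiberIncl v.1 (t • ψ)) :=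
      (hP.contMDiff_evalOn f).continuous.comp
        ((contMDiff_fiberIncl (I := I) v.1).continuous.comp (by fun_prop))
    have hz : ∀ t : ℝ, t ≠ 0 → evalOn P f (fiberIncl v.1 (t • ψ)) = 0 := fun t ht => by
      apply hzero
      intro h1
      have h2 : (fiberEquiv (F →L[ℝ] ℝ) (E := DualFiber E) v.1).symm (t • ψ) = 0 := h1
      rw [ContinuousLinearEquiv.map_eq_zero_iff] at h2
      exact (smul_ne_zero ht hψ) h2
    have h1 : (fun t : ℝ => evalOn P f (fiberIncl v.1 (t • ψ))) = fun _ => 0 :=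
      hc.ext_on (dense_compl_singleton (0 : ℝ)) continuous_const hz
    have h2 := congrFun h1 0
    simp only [zero_smul] at h2
    rwa [hv0] at h2
  · exact hzero f v hv

end Dual

/-! ### The Euler vector field and linear multivector fields -/

section Euler

variable {EM : Type*} [NormedAddCommGroup EM] [NormedSpace ℝ EM] [FiniteDimensional ℝ EM]
  {HM : Type*} [TopologicalSpace HM] {I : ModelWithCorners ℝ EM HM} [I.Boundaryless]
  {M : Type*} [TopologicalSpace M] [ChartedSpace HM M] [IsManifold I ∞ M] [T2Space M]
  {F : Type*} [NormedAddCommGroup F] [NormedSpace ℝ F] [FiniteDimensional ℝ F]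
  {E : M → Type*} [∀ x, AddCommGroup (E x)] [∀ x, Module ℝ (E x)]
  [TopologicalSpace (Bundle.TotalSpace F E)] [∀ x, TopologicalSpace (E x)]
  [FiberBundle F E] [VectorBundle ℝ F E] [ContMDiffVectorBundle ∞ F E I]

/-- The dilation of `E*` by `c`. -/
def dilate (c : ℝ) (v : DualTotal F E) : DualTotal F E := ⟨v.1, c • v.2⟩

theorem dilate_fiberIncl (c : ℝ) (x : M) (ψ : F →L[ℝ] ℝ) :
    dilate c (fiberIncl (E := E) x ψ) = fiberIncl x (c • ψ) :=
  (fiberIncl_eq (map_smul _ _ _ |>.trans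
    (congrArg (c • ·) (ContinuousLinearEquiv.apply_symm_apply _ _)))).symm

theorem dilate_one (v : DualTotal F E) : dilate 1 v = v := by
  rw [dilate, one_smul]

theorem contMDiff_dilate_exp (v : DualTotal F E) :
    ContMDiff 𝓘(ℝ, ℝ) (dualModel I F) ∞ fun t : ℝ => dilate (Real.exp t) v := by
  obtain ⟨ψ, hψ⟩ := exists_fiberIncl v
  have : (fun t : ℝ => dilate (Real.exp t) v) =
      fiberIncl (E := E) v.1 ∘ fun t => Real.exp t • ψ := funext fun t => by
    conv_lhs => rw [← hψ]
    exact dilate_fiberIncl _ _ _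
  rw [this]
  exact (contMDiff_fiberIncl v.1).comp (Real.contDiff_exp.smul contDiff_const).contMDiff

theorem evalOn_euler_eq (f : Fin 1 → C^∞⟮dualModel I F, DualTotal F E; 𝓘(ℝ, ℝ), ℝ⟯)
    (v : DualTotal F E) : evalOn euler f v = mfderiv (dualModel I F) 𝓘(ℝ, ℝ) (f 0) v
      (mfderiv 𝓘(ℝ, ℝ) (dualModel I F) (fun t : ℝ => dilate (Real.exp t) v) 0
        ((NormedSpace.fromTangentSpace (0 : ℝ)).symm 1) :) := by
  rw [evalOn_eq_pair, pairAlt_apply]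
  refine (pair_ιMulti _ _).trans ?_
  rw [Matrix.det_fin_one]
  rfl

/-- The Euler vector field generates the flow `v ↦ eᵗ v`. -/
theorem hasDerivAt_euler (f : Fin 1 → C^∞⟮dualModel I F, DualTotal F E; 𝓘(ℝ, ℝ), ℝ⟯)
    (v : DualTotal F E) (t : ℝ) : HasDerivAt (fun u => f 0 (dilate (Real.exp u) v))
      (evalOn euler f (dilate (Real.exp t) v)) t := by
  -- by the group property of the flow, it is enough to differentiate at time zero
  suffices H : ∀ w : DualTotal F E,
      HasDerivAt (fun u => f 0 (dilate (Real.exp u) w)) (evalOn euler f w) 0 by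
    have h1 := H (dilate (Real.exp t) v)
    have h3 : HasDerivAt (fun u : ℝ => u - t) 1 t := (hasDerivAt_id t).sub_const t
    rw [← sub_self t] at h1
    have h2 := HasDerivAt.comp (h := fun u : ℝ => u - t) t h1 h3
    rw [mul_one] at h2
    refine h2.congr_of_eventuallyEq (Filter.Eventually.of_forall fun u => ?_)
    change f 0 (dilate (Real.exp u) v) =
      f 0 ⟨v.1, Real.exp (u - t) • Real.exp t • v.2⟩
    rw [smul_smul, ← Real.exp_add, sub_add_cancel]
    rfl
  intro w
  have hw : dilate (Real.exp 0) w = w := by rw [Real.exp_zero, dilate_one]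
  have hγ := contMDiff_dilate_exp (I := I) w
  have hd : DifferentiableAt ℝ (fun u => f 0 (dilate (Real.exp u) w)) 0 :=
    ((f 0).contMDiff.comp hγ).contDiff.differentiable (by simp) _
  have h1 := mfderiv_comp (0 : ℝ)
    ((f 0).contMDiff.mdifferentiableAt (x := dilate (Real.exp 0) w) (by simp))
    (hγ.mdifferentiableAt (by simp))
  have h2 : evalOn euler f w = fderiv ℝ (fun u => f 0 (dilate (Real.exp u) w)) 0 1 := by
    rw [evalOn_euler_eq, ← mfderiv_eq_fderiv]
    have h3 : mfderiv (dualModel I F) 𝓘(ℝ, ℝ) (f 0) (dilate (Real.exp 0) w) =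
      mfderiv (dualModel I F) 𝓘(ℝ, ℝ) (f 0) w := by rw [hw]
    rw [h3] at h1
    exact (DFunLike.congr_fun h1 _).symm
  rw [h2]
  exact hd.hasDerivAt

theorem evalOn_euler_hat (f : Fin 1 → C^∞⟮dualModel I F, DualTotal F E; 𝓘(ℝ, ℝ), ℝ⟯)
    (s : Cₛ^∞⟮I; F, E⟯) (h : f 0 = hat s) (v : DualTotal F E) : evalOn euler f v = hat s v := by
  have h1 := hasDerivAt_euler f v 0
  rw [Real.exp_zero, dilate_one, h] at h1
  have h2 : HasDerivAt (fun u : ℝ => Real.exp u * hat s v) (hat s v) 0 := by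
    simpa using (Real.hasDerivAt_exp 0).mul_const (hat s v)
  exact h1.unique h2

theorem evalOn_euler_basic (f : Fin 1 → C^∞⟮dualModel I F, DualTotal F E; 𝓘(ℝ, ℝ), ℝ⟯)
    (g : C^∞⟮I, M; 𝓘(ℝ, ℝ), ℝ⟯) (h : f 0 = basic g) (v : DualTotal F E) :
    evalOn euler f v = 0 := by
  have h1 := hasDerivAt_euler f v 0
  rw [Real.exp_zero, dilate_one, h] at h1
  exact h1.unique (hasDerivAt_const (0 : ℝ) (g v.1))

/-- The Euler vector field maps `ŝ + π^* f` to `ŝ`, hence it is smooth. -/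
theorem isSmoothMultivector_euler :
    IsSmoothMultivector (euler : MultivectorField (dualModel I F) (DualTotal F E) 1) := by
  refine isSmoothMultivector_of_span (affineFunctions I F E) span_affineFunctions fun G hG => ?_
  obtain ⟨⟨s, g⟩, hsg⟩ := hG 0
  refine (hat s).contMDiff.congr fun v => ?_
  have h1 := evalOn_euler_hat (fun _ => hat s) s rfl v
  have h2 := evalOn_euler_basic (fun _ => basic (E := E) (F := F) g) g rfl v
  rw [evalOn_euler_eq] at h1 h2 ⊢
  have h3 : mfderiv (dualModel I F) 𝓘(ℝ, ℝ) (G 0) v =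
      differentialAt v (hat s) + differentialAt v (basic g) := by
    rw [← map_add, ← hsg]
    rfl
  rw [h3]
  refine (congrArg₂ (· + ·) h1 h2).trans (add_zero _)

end Euler

/-! ### Insertion products with maps of one argument -/

section Insertion

/-- The number of `(a, b)`-shuffles is a binomial coefficient. -/
theorem card_shuffle (a b : ℕ) :
    Fintype.card (Shuffle a b) * (a.factorial * b.factorial) = (a + b).factorial := by
  classical
  have h := Subgroup.card_eq_card_quotient_mul_card_subgroup
    (Equiv.Perm.sumCongrHom (Fin a) (Fin b)).range
  have h1 : Nat.card (Equiv.Perm.sumCongrHom (Fin a) (Fin b)).range =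
      a.factorial * b.factorial := by
    rw [← Nat.card_congr (MonoidHom.ofInjective
      (Equiv.Perm.sumCongrHom_injective (α := Fin a) (β := Fin b))).toEquiv]
    simp [Nat.card_eq_fintype_card, Fintype.card_perm]
  rw [h1] at h
  have h2 : Nat.card (Equiv.Perm (Fin a ⊕ Fin b)) = (a + b).factorial := by
    simp [Nat.card_eq_fintype_card, Fintype.card_perm]
  rw [← h2, h, ← Nat.card_eq_fintype_card]

/-- The permutation of all arguments given by (a representative of) a shuffle. -/
def Shuffle.perm {a b : ℕ} (q : Shuffle a b) : Equiv.Perm (Fin (a + b)) :=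
  finSumFinEquiv.permCongr (Quotient.out q)

theorem Shuffle.sign_perm {a b : ℕ} (q : Shuffle a b) : Equiv.Perm.sign q.perm = q.sign :=
  Equiv.Perm.sign_permCongr _ _

theorem Shuffle.perm_castAdd {a b : ℕ} (q : Shuffle a b) (i : Fin a) :
    q.perm (Fin.castAdd b i) = q.left i := by
  simp [Shuffle.perm, Shuffle.left, Equiv.permCongr_apply]

theorem Shuffle.perm_natAdd {a b : ℕ} (q : Shuffle a b) (i : Fin b) :
    q.perm (Fin.natAdd a i) = q.right i := by
  simp [Shuffle.perm, Shuffle.right, Equiv.permCongr_apply]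

variable {X : Type*} [AddCommGroup X] [Module ℝ X]

/-- There is only one `(b, 0)`-shuffle. -/
theorem insertion_one_left {b : ℕ} (h : b + 1 = 1 + b) (f : X [⋀^Fin 1]→ₗ[ℝ] X)
    (g : X [⋀^Fin b]→ₗ[ℝ] X) (x : Fin b → X) : insertion h f g x = f fun _ => g x := by
  have hcard : Fintype.card (Shuffle b 0) = 1 := by
    have h := card_shuffle b 0
    simp only [Nat.factorial_zero, mul_one, add_zero] at h
    exact Nat.eq_of_mul_eq_mul_right b.factorial_pos (h.trans (one_mul _).symm)
  refine (insertion_apply_shuffle (m := 0) h f g x).trans ?_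
  have hterm : ∀ q : Shuffle b 0, q.sign • f (Matrix.vecCons (g (x ∘ q.left)) (x ∘ q.right)) =
      f fun _ => g x := fun q => by
    have h1 : x ∘ q.left = x ∘ q.perm := funext fun i => congrArg x (q.perm_castAdd i).symm
    have h2 : Matrix.vecCons (g (x ∘ q.left)) (x ∘ q.right) =
        (fun _ => q.sign • g x : Fin 1 → X) := by
      funext i
      rw [Subsingleton.elim i 0]
      exact (congrArg g h1).trans ((g.map_perm x q.perm).trans (by rw [q.sign_perm]))
    have h3 : ∀ (c : ℤˣ) (y : X), c • f (fun _ => c • y) = f fun _ => y := fun c y => by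
      have h4 := f.map_update_smul (fun _ => y) 0 (-1) y
      have h5 : ∀ z : X, Function.update (fun _ : Fin 1 => y) 0 z = fun _ => z := fun z => by
        funext i
        rw [Subsingleton.elim i 0]
        simp
      rw [h5, h5] at h4
      rcases Int.units_eq_one_or c with rfl | rfl
      · simp
      · simp only [neg_smul, one_smul] at h4
        simp [Units.neg_smul, h4]
    rw [h2]
    exact h3 _ _
  rw [Finset.sum_congr rfl fun q _ => hterm q, Finset.sum_const, Finset.card_univ, hcard, one_smul]

/-- Inserting a map which acts as the identity multiplies by the number of arguments. -/
theorem insertion_one_right {m r : ℕ} (h : r + 1 = (m + 1) + 1) (hr : 1 + m = r)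
    (f : X [⋀^Fin (m + 1)]→ₗ[ℝ] X) (g : X [⋀^Fin 1]→ₗ[ℝ] X) (x : Fin r → X)
    (hx : ∀ i, g (fun _ => x i) = x i) :
    insertion h f g x = ((m + 1 : ℕ) : ℝ) • f (x ∘ Fin.cast (by omega)) := by
  subst hr
  have hcard : Fintype.card (Shuffle 1 m) = m + 1 := by
    have h := card_shuffle 1 m
    rw [Nat.factorial_one, one_mul, add_comm 1 m, Nat.factorial_succ] at h
    exact Nat.eq_of_mul_eq_mul_right m.factorial_pos h
  rw [insertion_apply_shuffle]
  have hterm : ∀ q : Shuffle 1 m, q.sign • f (Matrix.vecCons (g (x ∘ q.left)) (x ∘ q.right)) =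
      f (x ∘ Fin.cast (by omega)) := fun q => by
    let c : Fin (m + 1) ≃ Fin (1 + m) := finCongr (by omega)
    have h1 : Matrix.vecCons (g (x ∘ q.left)) (x ∘ q.right) =
        (x ∘ c) ∘ (c.symm.permCongr q.perm) := by
      funext i
      refine Fin.cases ?_ (fun i => ?_) i
      · have h2 : x ∘ q.left = fun _ => x (q.left 0) :=
          funext fun j => by rw [Subsingleton.elim j 0]; rfl
        rw [h2]
        refine (hx _).trans ?_
        rw [← q.perm_castAdd]
        simp [Equiv.permCongr_apply, c]
        rfl
      · refine congrArg x ?_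
        rw [← q.perm_natAdd]
        simp only [Equiv.permCongr_apply, c, finCongr_symm, finCongr_apply, Fin.cast_cast,
          Fin.cast_eq_self]
        congr 1
        ext
        simp [add_comm]
    rw [h1, f.map_perm, Equiv.Perm.sign_permCongr, q.sign_perm, smul_smul, Int.units_mul_self,
      one_smul]
    rfl
  rw [Finset.sum_congr rfl fun q _ => hterm q, Finset.sum_const, Finset.card_univ, hcard]
  exact (Nat.cast_smul_eq_nsmul ℝ _ _).symm

end Insertion

/-! ### Linear multivector fields and fibrewise linear functions -/

section FiberLinear

variable {EM : Type*} [NormedAddCommGroup EM] [NormedSpace ℝ EM] [FiniteDimensional ℝ EM]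
  {HM : Type*} [TopologicalSpace HM] {I : ModelWithCorners ℝ EM HM} [I.Boundaryless]
  {M : Type*} [TopologicalSpace M] [ChartedSpace HM M] [IsManifold I ∞ M] [T2Space M]
  {F : Type*} [NormedAddCommGroup F] [NormedSpace ℝ F] [FiniteDimensional ℝ F]
  {E : M → Type*} [∀ x, AddCommGroup (E x)] [∀ x, Module ℝ (E x)]
  [TopologicalSpace (Bundle.TotalSpace F E)] [∀ x, TopologicalSpace (E x)]
  [FiberBundle F E] [VectorBundle ℝ F E] [ContMDiffVectorBundle ∞ F E I]

/-- A function on `E*` which is linear on every fibre. -/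
def IsFiberLinear (g : DualTotal F E → ℝ) : Prop :=
  ∀ x : M, ∃ L : DualFiber E x →ₗ[ℝ] ℝ, ∀ w : DualFiber E x, g ⟨x, w⟩ = L w

theorem isFiberLinear_hat (s : Cₛ^∞⟮I; F, E⟯) : IsFiberLinear (hat s) := fun x =>
  ⟨{ toFun := fun w => w (s x), map_add' := fun _ _ => rfl, map_smul' := fun _ _ => rfl },
    fun _ => rfl⟩

theorem IsFiberLinear.dilate {g : DualTotal F E → ℝ} (hg : IsFiberLinear g) (c : ℝ)
    (v : DualTotal F E) : g (dilate c v) = c * g v := by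
  obtain ⟨L, hL⟩ := hg v.1
  exact (hL (c • v.2)).trans ((L.map_smul c v.2).trans (congrArg (c * ·) (hL v.2).symm))

/-- Fibrewise linear functions are eigenfunctions of the Euler vector field. -/
theorem evalOn_euler_of_fiberLinear {g : C^∞⟮dualModel I F, DualTotal F E; 𝓘(ℝ, ℝ), ℝ⟯}
    (hg : IsFiberLinear g) (v : DualTotal F E) : evalOn euler (fun _ => g) v = g v := by
  have h1 := hasDerivAt_euler (fun _ => g) v 0
  rw [Real.exp_zero, dilate_one] at h1
  have h2 : HasDerivAt (fun u : ℝ => Real.exp u * g v) (g v) 0 := by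
    simpa using (Real.hasDerivAt_exp 0).mul_const (g v)
  refine h1.unique (h2.congr_of_eventuallyEq (Filter.Eventually.of_forall fun u => ?_))
  exact hg.dilate _ v

/-- A smooth eigenfunction `g` of the Euler vector field is linear on the fibres: it is positively
homogeneous, hence equal to its derivative at the origin of the fibre. -/
theorem isFiberLinear_of_evalOn_euler {g : C^∞⟮dualModel I F, DualTotal F E; 𝓘(ℝ, ℝ), ℝ⟯}
    (hg : ∀ v, evalOn euler (fun _ => g) v = g v) : IsFiberLinear g := by
  have hexp : ∀ (v : DualTotal F E) (t : ℝ), g (dilate (Real.exp t) v) = Real.exp t * g v := by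
    intro v t
    have h1 : ∀ u, HasDerivAt (fun u => Real.exp (-u) * g (dilate (Real.exp u) v)) 0 u := by
      intro u
      have h2 := hasDerivAt_euler (fun _ => g) v u
      rw [hg] at h2
      have h3 := HasDerivAt.fun_mul (hasDerivAt_neg u).exp h2
      have h4 : Real.exp (-u) * -1 * g (dilate (Real.exp u) v) +
          Real.exp (-u) * g (dilate (Real.exp u) v) = 0 := by ring
      rwa [h4] at h3
    have h4 := is_const_of_deriv_eq_zero (fun u => (h1 u).differentiableAt)
      (fun u => (h1 u).deriv) t 0
    rw [neg_zero, Real.exp_zero, dilate_one, one_mul, Real.exp_neg] at h4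
    have h5 := Real.exp_pos t
    field_simp at h4
    linarith
  have hpos : ∀ (v : DualTotal F E) (c : ℝ), 0 < c → g (dilate c v) = c * g v := by
    intro v c hc
    have := hexp v (Real.log c)
    rwa [Real.exp_log hc] at this
  intro x
  let G : (F →L[ℝ] ℝ) → ℝ := fun ψ => g (fiberIncl x ψ)
  have hG : ContDiff ℝ ∞ G := (g.contMDiff.comp (contMDiff_fiberIncl x)).contDiff
  have hGpos : ∀ (ψ : F →L[ℝ] ℝ) (c : ℝ), 0 < c → G (c • ψ) = c * G ψ := fun ψ c hc => by
    change g _ = c * g _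
    rw [← hpos _ c hc, dilate_fiberIncl]
  have hG0 : G 0 = 0 := by
    have := hGpos 0 2 two_pos
    rw [smul_zero] at this
    linarith
  have hd : HasFDerivAt G (fderiv ℝ G 0) 0 := (hG.differentiable (by simp) 0).hasFDerivAt
  -- the right derivative at zero of `t ↦ G (t ψ)` is `G ψ` by homogeneity, and `G'(0) ψ`
  have hlin : ∀ ψ, G ψ = fderiv ℝ G 0 ψ := fun ψ => by
    have hline : HasDerivAt (fun t : ℝ => t • ψ) ψ 0 := by
      simpa using (hasDerivAt_id (0 : ℝ)).smul_const ψ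
    have hd' : HasFDerivAt G (fderiv ℝ G 0) ((fun t : ℝ => t • ψ) 0) := by
      simpa only [zero_smul] using hd
    have h1 : HasDerivWithinAt (fun t : ℝ => G (t • ψ)) (fderiv ℝ G 0 ψ) (Set.Ioi 0) 0 := by
      have h0 := hd'.comp_hasDerivAt (0 : ℝ) hline
      exact HasDerivAt.hasDerivWithinAt h0
    have h2 : HasDerivWithinAt (fun t : ℝ => G (t • ψ)) (G ψ) (Set.Ioi 0) 0 := by
      have h3 : HasDerivWithinAt (fun t : ℝ => t * G ψ) (G ψ) (Set.Ioi 0) 0 := by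
        simpa using ((hasDerivAt_id (0 : ℝ)).mul_const (G ψ)).hasDerivWithinAt
      refine h3.congr (fun t ht => hGpos ψ t ht) ?_
      simp [hG0]
    exact (uniqueDiffWithinAt_Ioi 0).eq_deriv _ h2 h1
  refine ⟨(fderiv ℝ G 0).toLinearMap ∘ₗ
    (fiberEquiv (F →L[ℝ] ℝ) (E := DualFiber E) x).toLinearEquiv.toLinearMap, fun w => ?_⟩
  refine Eq.trans ?_ (hlin _)
  exact congrArg g (fiberIncl_eq (E := E) (w := w) rfl).symm

theorem dualOf_apply (x : M) (ψ : F →L[ℝ] ℝ) (w : E x) :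
    dualOf x ψ w = ψ (fiberEquiv F x w) := rfl

theorem dualOf_comp_symm (x : M) (v : DualFiber E x) :
    dualOf (F := F) x (v.comp (fiberEquiv F (E := E) x).symm.toContinuousLinearMap) = v := by
  ext w
  rw [dualOf_apply]
  exact congrArg v ((fiberEquiv F x).symm_apply_apply w)

/-- The double dual of `E` is `E`: a smooth fibrewise linear function on `E*` is given by a
section of `E`. -/
theorem exists_hat_eq {g : C^∞⟮dualModel I F, DualTotal F E; 𝓘(ℝ, ℝ), ℝ⟯}
    (hg : IsFiberLinear g) : ∃ s : Cₛ^∞⟮I; F, E⟯, hat s = g := by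
  have hb : ∀ x : M, ∃ b : F, ∀ ψ : F →L[ℝ] ℝ, ψ b = g ⟨x, dualOf x ψ⟩ := fun x => by
    obtain ⟨L, hL⟩ := hg x
    obtain ⟨b, hb⟩ := exists_eval_eq (V := F)
      { toFun := fun ψ => L (dualOf x ψ)
        map_add' := fun ψ φ => L.map_add (dualOf x ψ) (dualOf x φ)
        map_smul' := fun c ψ => L.map_smul c (dualOf x ψ) }
    exact ⟨b, fun ψ => (hb ψ).trans (hL _).symm⟩
  choose b hb using hb
  let s : ∀ x, E x := fun x => (fiberEquiv F x).symm (b x)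
  have hs : ∀ (x : M) (v : DualFiber E x), v (s x) = g ⟨x, v⟩ := fun x v => by
    conv_rhs => rw [← dualOf_comp_symm (F := F) x v]
    rw [← hb]
    rfl
  refine ⟨⟨s, fun x₀ => ?_⟩, by ext v; exact hs v.1 v.2⟩
  -- near `x₀`, the coordinates of `s` are the values of `g` on sections of the dual bundle which are
  -- constant in the trivialization
  rw [Bundle.contMDiffAt_section]
  refine contMDiffAt_of_dual fun ψ => ?_
  let e := trivializationAt F E x₀
  let v : M → DualTotal F E := fun x => ⟨x, ψ.comp (e.continuousLinearMapAt ℝ x)⟩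
  have hnhds := e.open_baseSet.mem_nhds (FiberBundle.mem_baseSet_trivializationAt' x₀)
  have hv : ContMDiffAt I (dualModel I F) ∞ v x₀ := by
    rw [Bundle.contMDiffAt_totalSpace]
    refine ⟨contMDiffAt_id, (contMDiffAt_const (c := ψ)).congr_of_eventuallyEq ?_⟩
    filter_upwards [hnhds] with x hx
    ext b
    rw [dual_trivialization_apply _ _ hx]
    change ψ (e.continuousLinearMapAt ℝ x (e.symm x b)) = ψ b
    rw [← Bundle.Trivialization.symmL_apply (R := ℝ),
      Bundle.Trivialization.continuousLinearMapAt_symmL _ hx]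
    exact hx
  refine (g.contMDiff.contMDiffAt.comp x₀ hv).congr_of_eventuallyEq ?_
  filter_upwards [hnhds] with x hx
  change ψ (e ⟨x, s x⟩).2 = g ⟨x, ψ.comp (e.continuousLinearMapAt ℝ x)⟩
  rw [← hs]
  change _ = ψ (e.continuousLinearMapAt ℝ x (s x))
  rw [Bundle.Trivialization.continuousLinearMapAt_apply, Bundle.Trivialization.linearMapAt_apply,
    if_pos hx]

/-- On the functions `ŝ`, the bracket with the Euler vector field is `ξ ∘ P - k P`. -/
theorem bracketAlt_euler_hat {k : ℕ} {P : MultivectorField (dualModel I F) (DualTotal F E) k}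
    (hP : IsSmoothMultivector P) (s : Fin k → Cₛ^∞⟮I; F, E⟯) (v : DualTotal F E) :
    bracketAlt (Nat.add_comm k 1) isSmoothMultivector_euler hP (fun i => hat (s i)) v =
      evalOn euler (fun _ => toAlt hP fun i => hat (s i)) v -
        k * evalOn P (fun i => hat (s i)) v := by
  rw [bracketAlt_apply, insertion_one_left]
  have h1 : (-1 : ℝ) ^ ((1 + 1) * (k + 1)) = 1 := by rw [pow_mul]; norm_num
  rw [h1, one_mul]
  congr 1
  cases k with
  | zero => simp [insertion_zero_left]
  | succ m =>
    rw [insertion_one_right (by omega) (by omega)]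
    · rfl
    · intro i
      ext w
      exact evalOn_euler_hat _ (s i) rfl w

/-- A smooth multivector field on `E*` is linear if and only if it maps fibrewise linear functions
to fibrewise linear functions. -/
theorem mem_linearMultivector_iff [Nontrivial F] {k : ℕ}
    {P : MultivectorField (dualModel I F) (DualTotal F E) k} (hP : IsSmoothMultivector P) :
    P ∈ linearMultivector I F E k ↔
      ∀ s : Fin k → Cₛ^∞⟮I; F, E⟯, IsFiberLinear (evalOn P fun i => hat (s i)) := by
  have hiff := isSchoutenBracket_iff_evalOn (Nat.add_comm k 1)
    (isSmoothMultivector_euler (I := I) (F := F) (E := E)) hP ((1 - k : ℝ) • P)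
  constructor
  · intro h s
    refine isFiberLinear_of_evalOn_euler (g := toAlt hP fun i => hat (s i)) fun v => ?_
    have h1 := hiff.1 h.2 (fun i => hat (s i)) v
    rw [bracketAlt_euler_hat, evalOn_smul] at h1
    rw [toAlt_apply]
    linarith
  · intro h
    obtain ⟨R, hRs, hR, hRe⟩ := exists_isSchoutenBracket (Nat.add_comm k 1)
      (isSmoothMultivector_euler (I := I) (F := F) (E := E)) hP
    have h0 : R + (-1 : ℝ) • (1 - k : ℝ) • P = 0 := by
      refine multivector_eq_zero_of_hat (hRs.add ((hP.smul _).smul _)) fun s v => ?_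
      rw [evalOn_add, evalOn_smul, evalOn_smul, congrFun (hRe _) v, bracketAlt_euler_hat,
        evalOn_euler_of_fiberLinear (g := toAlt hP fun i => hat (s i)) (h s), toAlt_apply]
      ring
    rw [neg_one_smul, ← sub_eq_add_neg, sub_eq_zero] at h0
    exact ⟨hP, h0 ▸ hR⟩

end FiberLinear

/-! ### The multiderivation of a linear multivector field -/

/-- Moving the last argument to the front. -/
theorem alternating_snoc {R W X : Type*} [CommRing R] [AddCommGroup W] [Module R W]
    [AddCommGroup X] [Module R X]
    {n : ℕ} (B : W [⋀^Fin (n + 1)]→ₗ[R] X) (a : Fin n → W) (b : W) :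
    B (Fin.snoc a b) = (-1 : ℤˣ) ^ n • B (Matrix.vecCons b a) := by
  have h : (Fin.snoc a b : Fin (n + 1) → W) = (Matrix.vecCons b a) ∘ finRotate (n + 1) := by
    rw [Fin.snoc_eq_cons_rotate]
    rfl
  rw [h, B.map_perm, sign_finRotate, Nat.add_sub_cancel]

theorem alternating_snoc_add_smul {R W X : Type*} [CommRing R] [AddCommGroup W] [Module R W]
    [AddCommGroup X] [Module R X] {n : ℕ} (B : W [⋀^Fin (n + 1)]→ₗ[R] X) (a : Fin n → W)
    (c d : R) (b b' : W) :
    B (Fin.snoc a (c • b + d • b')) = c • B (Fin.snoc a b) + d • B (Fin.snoc a b') := by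
  refine (B.toMultilinearMap.snoc_add a _ _).trans ?_
  exact congrArg₂ (· + ·) (B.toMultilinearMap.snoc_smul a c b)
    (B.toMultilinearMap.snoc_smul a d b')

/-- An alternating map, with all but the last covector fixed, is the evaluation at a vector. -/
theorem exists_eval_eq_snoc {V W : Type*} [AddCommGroup V] [Module ℝ V] [TopologicalSpace V]
    [IsTopologicalAddGroup V] [ContinuousSMul ℝ V] [T2Space V] [FiniteDimensional ℝ V]
    [AddCommGroup W] [Module ℝ W] [TopologicalSpace W] {n : ℕ}
    (B : (W →L[ℝ] ℝ) [⋀^Fin (n + 1)]→ₗ[ℝ] ℝ) (a : Fin n → W →L[ℝ] ℝ) (T : W →L[ℝ] V) :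
    ∃ Y : V, ∀ α : V →L[ℝ] ℝ, α Y = B (Fin.snoc a (α.comp T)) :=
  exists_eval_eq
    { toFun := fun α => B (Fin.snoc a (α.comp T))
      map_add' := fun α β => B.toMultilinearMap.snoc_add a (α.comp T) (β.comp T)
      map_smul' := fun c α => B.toMultilinearMap.snoc_smul a c (α.comp T) }

section Multiderivation

variable {EM : Type*} [NormedAddCommGroup EM] [NormedSpace ℝ EM] [FiniteDimensional ℝ EM]
  {HM : Type*} [TopologicalSpace HM] {I : ModelWithCorners ℝ EM HM} [I.Boundaryless]
  {M : Type*} [TopologicalSpace M] [ChartedSpace HM M] [IsManifold I ∞ M] [T2Space M]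
  {F : Type*} [NormedAddCommGroup F] [NormedSpace ℝ F] [FiniteDimensional ℝ F] [Nontrivial F]
  {E : M → Type*} [∀ x, AddCommGroup (E x)] [∀ x, Module ℝ (E x)]
  [TopologicalSpace (Bundle.TotalSpace F E)] [∀ x, TopologicalSpace (E x)]
  [FiberBundle F E] [VectorBundle ℝ F E] [ContMDiffVectorBundle ∞ F E I]

theorem exists_hat_eq_toAlt {k : ℕ} (P : linearMultivector I F E k) (s : Fin k → Cₛ^∞⟮I; F, E⟯) :
    ∃ u : Cₛ^∞⟮I; F, E⟯, hat u = toAlt P.2.1 (hatLM ∘ s) :=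
  exists_hat_eq ((mem_linearMultivector_iff P.2.1).1 P.2 s)

theorem hatLM_injective : Function.Injective (hatLM : Cₛ^∞⟮I; F, E⟯ →ₗ[ℝ] _) :=
  fun _ _ h => section_ext_of_hat h

/-- The alternating map of sections given by a linear multivector field. -/
def toSectionAlt {k : ℕ} (P : linearMultivector I F E k) :
    Cₛ^∞⟮I; F, E⟯ [⋀^Fin k]→ₗ[ℝ] Cₛ^∞⟮I; F, E⟯ where
  toFun s := (exists_hat_eq_toAlt P s).choose
  map_update_add' s i t u := by
    apply hatLM_injective
    rw [map_add]
    refine (exists_hat_eq_toAlt P _).choose_spec.trans ?_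
    refine Eq.trans ?_ (congrArg₂ (· + ·) (exists_hat_eq_toAlt P _).choose_spec
      (exists_hat_eq_toAlt P _).choose_spec).symm
    exact ((toAlt P.2.1).compLinearMap hatLM).map_update_add s i t u
  map_update_smul' s i c t := by
    apply hatLM_injective
    rw [map_smul]
    refine (exists_hat_eq_toAlt P _).choose_spec.trans ?_
    refine Eq.trans ?_ (congrArg (c • ·) (exists_hat_eq_toAlt P _).choose_spec).symm
    exact ((toAlt P.2.1).compLinearMap hatLM).map_update_smul s i c t
  map_eq_zero_of_eq' s i j h hij := by
    apply hatLM_injective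
    rw [map_zero]
    refine (exists_hat_eq_toAlt P _).choose_spec.trans ?_
    exact ((toAlt P.2.1).compLinearMap hatLM).map_eq_zero_of_eq s h hij

theorem hat_toSectionAlt {k : ℕ} (P : linearMultivector I F E k) (s : Fin k → Cₛ^∞⟮I; F, E⟯) :
    hatLM (toSectionAlt P s) = toAlt P.2.1 (hatLM ∘ s) :=
  (exists_hat_eq_toAlt P s).choose_spec

theorem hat_toSectionAlt_apply {k : ℕ} (P : linearMultivector I F E k)
    (s : Fin k → Cₛ^∞⟮I; F, E⟯) (v : DualTotal F E) :
    hat (toSectionAlt P s) v = evalOn P.1 (fun i => hat (s i)) v :=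
  DFunLike.congr_fun (hat_toSectionAlt P s) v

/-- The differentials at `v` of the functions `ŝ`. -/
def differentialHat (v : DualTotal F E) :
    Cₛ^∞⟮I; F, E⟯ →ₗ[ℝ] (TangentSpace (dualModel I F) v →L[ℝ] ℝ) :=
  differentialAt v ∘ₗ hatLM

variable (F E) in
/-- The zero of the fibre of `E*` over `x`. -/
def zeroAt (x : M) : DualTotal F E := ⟨x, 0⟩

theorem contMDiff_zeroAt : ContMDiff I (dualModel I F) ∞ (zeroAt F E) :=
  Bundle.contMDiff_zeroSection ℝ (DualFiber E)

/-- On the zero section, `s ↦ dŝ` is tensorial, as `ŝ` vanishes there. -/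
theorem differentialHat_zeroAt_smul (x : M) (f : C^∞⟮I, M; 𝓘(ℝ, ℝ), ℝ⟯) (s : Cₛ^∞⟮I; F, E⟯) :
    differentialHat (zeroAt F E x) (f • s) = f x • differentialHat (zeroAt F E x) s := by
  refine (differentialAt_hat_smul f s (zeroAt F E x)).trans ?_
  have : (zeroAt F E x).2 (s x) = 0 := rfl
  change _ + (zeroAt F E x).2 (s x) • _ = _
  rw [this, zero_smul, add_zero]
  rfl

/-- The function `i_P (dŝ₁ ∧ … ∧ dŝₙ ∧ d(π^* f))`, which represents the symbol. -/
def symbolFun {n : ℕ} (P : linearMultivector I F E (n + 1)) (s : Fin n → Cₛ^∞⟮I; F, E⟯)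
    (f : C^∞⟮I, M; 𝓘(ℝ, ℝ), ℝ⟯) : C^∞⟮dualModel I F, DualTotal F E; 𝓘(ℝ, ℝ), ℝ⟯ :=
  toAlt P.2.1 (Fin.snoc (hatLM ∘ s) (basic f))

/-- The symbol function in terms of the pairing of `P` with covectors. -/
theorem symbolFun_apply {n : ℕ} (P : linearMultivector I F E (n + 1))
    (s : Fin n → Cₛ^∞⟮I; F, E⟯) (f : C^∞⟮I, M; 𝓘(ℝ, ℝ), ℝ⟯) (v : DualTotal F E) :
    symbolFun P s f v =
      pairAlt (P.1 v : ExteriorAlgebra ℝ (TangentSpace (dualModel I F) v)) (n + 1)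
        (Fin.snoc (differentialHat v ∘ s) (differentialAt v (basic f))) := by
  refine (evalOn_eq_pair P.1 _ v).trans ?_
  exact congrArg (pairAlt (P.1 v : ExteriorAlgebra ℝ (TangentSpace (dualModel I F) v)) (n + 1))
    (Fin.comp_snoc (differentialAt v) (hatLM ∘ s) (basic f))

theorem hat_toSectionAlt_snoc {n : ℕ} (P : linearMultivector I F E (n + 1))
    (s : Fin n → Cₛ^∞⟮I; F, E⟯) (t : Cₛ^∞⟮I; F, E⟯) (v : DualTotal F E) :
    hat (toSectionAlt P (Fin.snoc s t)) v =
      pairAlt (P.1 v : ExteriorAlgebra ℝ (TangentSpace (dualModel I F) v)) (n + 1)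
        (Fin.snoc (differentialHat v ∘ s) (differentialHat v t)) := by
  refine (hat_toSectionAlt_apply P _ v).trans ((evalOn_eq_pair P.1 _ v).trans ?_)
  exact congrArg (pairAlt (P.1 v : ExteriorAlgebra ℝ (TangentSpace (dualModel I F) v)) (n + 1))
    (Fin.comp_snoc (differentialHat v) s t)

/-- The Leibniz rule over `E*`. -/
theorem hat_toSectionAlt_snoc_smul {n : ℕ} (P : linearMultivector I F E (n + 1))
    (s : Fin n → Cₛ^∞⟮I; F, E⟯) (f : C^∞⟮I, M; 𝓘(ℝ, ℝ), ℝ⟯) (t : Cₛ^∞⟮I; F, E⟯)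
    (v : DualTotal F E) :
    hat (toSectionAlt P (Fin.snoc s (f • t))) v =
      f v.1 * hat (toSectionAlt P (Fin.snoc s t)) v + v.2 (t v.1) * symbolFun P s f v := by
  rw [hat_toSectionAlt_snoc, hat_toSectionAlt_snoc, symbolFun_apply]
  have h : differentialHat v (f • t) =
      f v.1 • differentialHat v t + v.2 (t v.1) • differentialAt v (basic f) :=
    differentialAt_hat_smul f t v
  rw [h]
  exact alternating_snoc_add_smul _ _ _ _ _ _

/-- The symbol is the restriction of `i_P (dŝ₁ ∧ … ∧ dŝₙ ∧ d(π^* f))` to the zero section. -/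
theorem toSectionAlt_snoc_smul {n : ℕ} (P : linearMultivector I F E (n + 1))
    (s : Fin n → Cₛ^∞⟮I; F, E⟯) (f : C^∞⟮I, M; 𝓘(ℝ, ℝ), ℝ⟯) (t : Cₛ^∞⟮I; F, E⟯) (x : M) :
    toSectionAlt P (Fin.snoc s (f • t)) x = f x • toSectionAlt P (Fin.snoc s t) x +
      symbolFun P s f (zeroAt F E x) • t x := by
  rw [← sub_eq_zero]
  by_contra hne
  obtain ⟨ψ, hψ⟩ := exists_dualOf_ne_zero (F := F) (E := E) hne
  apply hψ
  set w : DualFiber E x := dualOf x ψ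
  set φ := fiberEquiv (F →L[ℝ] ℝ) (E := DualFiber E) x w
  -- at `c w`, the Leibniz rule over `E*` is divisible by `c`; the quotient extends to `c = 0`
  have hline : ∀ c : ℝ, fiberIncl (E := E) x (c • φ) = ⟨x, c • w⟩ := fun c =>
    fiberIncl_eq (map_smul _ c w)
  have hc : Continuous fun c : ℝ => symbolFun P s f (fiberIncl (E := E) x (c • φ)) :=
    (symbolFun P s f).contMDiff.continuous.comp
      ((contMDiff_fiberIncl (I := I) x).continuous.comp (by fun_prop))
  have hz : ∀ c : ℝ, c ≠ 0 → w (t x) * symbolFun P s f (fiberIncl (E := E) x (c • φ)) =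
      w (toSectionAlt P (Fin.snoc s (f • t)) x) - f x * w (toSectionAlt P (Fin.snoc s t) x) := by
    intro c hc0
    have h := hat_toSectionAlt_snoc_smul P s f t ⟨x, c • w⟩
    rw [hat_apply, hat_apply] at h
    change c * w (toSectionAlt P (Fin.snoc s (f • t)) x) =
      f x * (c * w (toSectionAlt P (Fin.snoc s t) x)) + c * w (t x) * symbolFun P s f _ at h
    rw [hline]
    apply mul_left_cancel₀ hc0
    linear_combination -h
  have h1 : (fun c : ℝ => w (t x) * symbolFun P s f (fiberIncl (E := E) x (c • φ))) = fun _ =>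
      w (toSectionAlt P (Fin.snoc s (f • t)) x) - f x * w (toSectionAlt P (Fin.snoc s t) x) :=
    (continuous_const.mul hc).ext_on (dense_compl_singleton (0 : ℝ)) continuous_const hz
  have h2 := congrFun h1 0
  have h3 : fiberIncl (E := E) x ((0 : ℝ) • φ) = zeroAt F E x := by
    rw [hline, zero_smul]
    rfl
  simp only [h3] at h2
  rw [map_sub, map_add, map_smul, map_smul, smul_eq_mul, smul_eq_mul]
  linear_combination -h2

/-- The differential at a point of `E*` of the pullback of `f` is the pullback of the differential
of `f`. -/
theorem differentialAt_basic (f : C^∞⟮I, M; 𝓘(ℝ, ℝ), ℝ⟯) (v : DualTotal F E) :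
    differentialAt v (basic f) = (differentialAt v.1 f).comp
      (mfderiv (dualModel I F) I (Bundle.TotalSpace.proj : DualTotal F E → M) v) :=
  mfderiv_comp v (f.contMDiff.mdifferentiableAt (x := v.1) (by simp))
    ((Bundle.contMDiff_proj (n := ∞) (DualFiber E)).mdifferentiableAt (x := v) (by simp))

/-- At the zero of a fibre, `f ↦ P(ŝ₁, …, ŝₙ, π^* f)` is a tangent vector of the base. -/
theorem exists_symbolAt {n : ℕ} (P : linearMultivector I F E (n + 1))
    (s : Fin n → Cₛ^∞⟮I; F, E⟯) (x : M) : ∃ X : TangentSpace I x,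
      ∀ f : C^∞⟮I, M; 𝓘(ℝ, ℝ), ℝ⟯, differentialAt x f X = symbolFun P s f (zeroAt F E x) := by
  let B := pairAlt (P.1 (zeroAt F E x) :
    ExteriorAlgebra ℝ (TangentSpace (dualModel I F) (zeroAt F E x))) (n + 1)
  let a := differentialHat (zeroAt F E x) ∘ s
  let dp : TangentSpace (dualModel I F) (zeroAt F E x) →L[ℝ] EM :=
    mfderiv (dualModel I F) I (Bundle.TotalSpace.proj : DualTotal F E → M) (zeroAt F E x)
  obtain ⟨X, hX⟩ := exists_eval_eq_snoc (V := EM) B a dp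
  refine ⟨X, fun f => (hX (differentialAt x f)).trans ?_⟩
  rw [symbolFun_apply, differentialAt_basic]
  rfl

/-- The value at `x` of the symbol of the multiderivation of a linear multivector field. -/
def symbolAt {n : ℕ} (P : linearMultivector I F E (n + 1)) (s : Fin n → Cₛ^∞⟮I; F, E⟯) (x : M) :
    TangentSpace I x :=
  (exists_symbolAt P s x).choose

theorem differentialAt_symbolAt {n : ℕ} (P : linearMultivector I F E (n + 1))
    (s : Fin n → Cₛ^∞⟮I; F, E⟯) (x : M) (f : C^∞⟮I, M; 𝓘(ℝ, ℝ), ℝ⟯) :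
    differentialAt x f (symbolAt P s x) = symbolFun P s f (zeroAt F E x) :=
  (exists_symbolAt P s x).choose_spec f

/-- The alternating map whose value at sections `s` is the value at the zero of the fibre over `x`
of the function representing the symbol. -/
def symbolFunAt {n : ℕ} (P : linearMultivector I F E (n + 1)) (x : M)
    (f : C^∞⟮I, M; 𝓘(ℝ, ℝ), ℝ⟯) :
    (TangentSpace (dualModel I F) (zeroAt F E x) →L[ℝ] ℝ) [⋀^Fin n]→ₗ[ℝ] ℝ :=
  (-1 : ℤˣ) ^ n • (pairAlt (P.1 (zeroAt F E x) :
    ExteriorAlgebra ℝ (TangentSpace (dualModel I F) (zeroAt F E x))) (n + 1)).curryLeft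
      (differentialAt (zeroAt F E x) (basic f))

theorem symbolFun_zeroAt {n : ℕ} (P : linearMultivector I F E (n + 1))
    (s : Fin n → Cₛ^∞⟮I; F, E⟯) (x : M) (f : C^∞⟮I, M; 𝓘(ℝ, ℝ), ℝ⟯) :
    symbolFun P s f (zeroAt F E x) =
      symbolFunAt P x f (differentialHat (zeroAt F E x) ∘ s) :=
  (symbolFun_apply P s f _).trans (alternating_snoc _ _ _)

/-- The symbol of the multiderivation of a linear multivector field. -/
def multivectorSymbol {n : ℕ} (P : linearMultivector I F E (n + 1)) :
    Cₛ^∞⟮I; F, E⟯ [⋀^Fin n]→ₗ[C^∞⟮I, M; 𝓘(ℝ, ℝ), ℝ⟯]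
      Cₛ^∞⟮I; EM, (TangentSpace I : M → Type _)⟯ where
  toFun s := ⟨symbolAt P s, contMDiff_of_differentialAt fun f =>
    ((symbolFun P s f).contMDiff.comp contMDiff_zeroAt).congr fun x =>
      differentialAt_symbolAt P s x f⟩
  map_update_add' s i t u := by
    ext x
    refine tangent_ext (I := I) fun f => ?_
    refine (differentialAt_symbolAt P _ x f).trans ?_
    refine Eq.trans ?_ (map_add (differentialAt x f) (symbolAt P _ x) (symbolAt P _ x)).symm
    rw [differentialAt_symbolAt, differentialAt_symbolAt, symbolFun_zeroAt, symbolFun_zeroAt,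
      symbolFun_zeroAt]
    exact ((symbolFunAt P x f).compLinearMap
      (differentialHat (zeroAt F E x))).map_update_add s i t u
  map_update_smul' s i c t := by
    ext x
    refine tangent_ext (I := I) fun f => ?_
    refine (differentialAt_symbolAt P _ x f).trans ?_
    refine Eq.trans ?_ (map_smul (differentialAt x f) (c x) (symbolAt P _ x)).symm
    rw [differentialAt_symbolAt, symbolFun_zeroAt, symbolFun_zeroAt, Function.comp_update,
      Function.comp_update, differentialHat_zeroAt_smul]
    exact (symbolFunAt P x f).map_update_smul _ i (c x) _
  map_eq_zero_of_eq' s i j h hij := by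
    ext x
    refine tangent_ext (I := I) fun f => ?_
    refine (differentialAt_symbolAt P _ x f).trans ?_
    refine Eq.trans ?_ (map_zero (differentialAt x f)).symm
    rw [symbolFun_zeroAt]
    exact ((symbolFunAt P x f).compLinearMap
      (differentialHat (zeroAt F E x))).map_eq_zero_of_eq s h hij

theorem isSymbol_multivectorSymbol {n : ℕ} (P : linearMultivector I F E (n + 1)) :
    IsSymbol (toSectionAlt P) (multivectorSymbol P) := fun s f t x => by
  rw [toSectionAlt_snoc_smul, ← differentialAt_symbolAt]
  rfl

theorem toSectionAlt_mem_multiDer {k : ℕ} (P : linearMultivector I F E k) :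
    toSectionAlt P ∈ multiDer I F E k := by
  cases k with
  | zero => exact Submodule.mem_top
  | succ n => exact ⟨_, isSymbol_multivectorSymbol P⟩

variable (I F E) in
/-- The map from linear multivector fields to multiderivations. -/
def toMultiDer (k : ℕ) : linearMultivector I F E k →ₗ[ℝ] multiDer I F E k where
  toFun P := ⟨toSectionAlt P, toSectionAlt_mem_multiDer P⟩
  map_add' P Q := by
    refine Subtype.ext (AlternatingMap.ext fun s => hatLM_injective ?_)
    ext v
    refine (hat_toSectionAlt_apply _ s v).trans ((evalOn_add P.1 Q.1 _ v).trans ?_)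
    rw [← hat_toSectionAlt_apply, ← hat_toSectionAlt_apply]
    exact (map_add v.2 _ _).symm
  map_smul' c P := by
    refine Subtype.ext (AlternatingMap.ext fun s => hatLM_injective ?_)
    ext v
    refine (hat_toSectionAlt_apply _ s v).trans ((evalOn_smul c P.1 _ v).trans ?_)
    rw [← hat_toSectionAlt_apply]
    exact (map_smul v.2 c _).symm

theorem toMultiDer_injective (k : ℕ) : Function.Injective (toMultiDer I F E k) := by
  rw [injective_iff_map_eq_zero]
  intro P hP
  refine Subtype.ext (multivector_eq_zero_of_hat P.2.1 fun s v => ?_)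
  have h : toSectionAlt P = 0 := congrArg Subtype.val hP
  rw [← hat_toSectionAlt_apply, h]
  exact map_zero v.2

end Multiderivation

/-! ### The linear multivector field of a multiderivation -/

section Reconstruction

variable {EM : Type*} [NormedAddCommGroup EM] [NormedSpace ℝ EM] [FiniteDimensional ℝ EM]
  {HM : Type*} [TopologicalSpace HM] {I : ModelWithCorners ℝ EM HM} [I.Boundaryless]
  {M : Type*} [TopologicalSpace M] [ChartedSpace HM M] [IsManifold I ∞ M] [T2Space M]
  {F : Type*} [NormedAddCommGroup F] [NormedSpace ℝ F] [FiniteDimensional ℝ F] [Nontrivial F]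
  {E : M → Type*} [∀ x, AddCommGroup (E x)] [∀ x, Module ℝ (E x)]
  [TopologicalSpace (Bundle.TotalSpace F E)] [∀ x, TopologicalSpace (E x)]
  [FiberBundle F E] [VectorBundle ℝ F E] [ContMDiffVectorBundle ∞ F E I]

/-- The map `(s, f) ↦ d(ŝ + π^* f)` at a point of `E*`. -/
def affineDifferential (v : DualTotal F E) :
    Cₛ^∞⟮I; F, E⟯ × C^∞⟮I, M; 𝓘(ℝ, ℝ), ℝ⟯ →ₗ[ℝ] (TangentSpace (dualModel I F) v →L[ℝ] ℝ) :=
  differentialAt v ∘ₗ hatLM.coprod basicLM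

theorem affineDifferential_apply (v : DualTotal F E)
    (a : Cₛ^∞⟮I; F, E⟯ × C^∞⟮I, M; 𝓘(ℝ, ℝ), ℝ⟯) :
    affineDifferential v a = differentialAt v (hat a.1) + differentialAt v (basic a.2) :=
  map_add (differentialAt v) _ _

theorem affineDifferential_surjective (v : DualTotal F E) :
    Function.Surjective (affineDifferential (I := I) v) := by
  rw [← LinearMap.range_eq_top, ← top_le_iff, ← span_affineFunctions v, Submodule.span_le]
  rintro _ ⟨_, ⟨a, rfl⟩, rfl⟩
  exact ⟨a, rfl⟩

/-- An alternating map `D` of sections comes from a linear multivector field if it extends, at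
every point of `E*`, to an alternating map of covectors, depending smoothly on the point. -/
theorem exists_toSectionAlt_eq {k : ℕ} (D : Cₛ^∞⟮I; F, E⟯ [⋀^Fin k]→ₗ[ℝ] Cₛ^∞⟮I; F, E⟯)
    (G : DualTotal F E → (Cₛ^∞⟮I; F, E⟯ × C^∞⟮I, M; 𝓘(ℝ, ℝ), ℝ⟯) [⋀^Fin k]→ₗ[ℝ] ℝ)
    (hG : ∀ v a, (∃ i, affineDifferential v (a i) = 0) → G v a = 0)
    (hsmooth : ∀ a, ContMDiff (dualModel I F) 𝓘(ℝ, ℝ) ∞ fun v => G v a)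
    (hD : ∀ v s, G v (fun i => (s i, 0)) = hat (D s) v) :
    ∃ P : linearMultivector I F E k, toSectionAlt P = D := by
  have hP : ∀ v : DualTotal F E, ∃ P : ⋀[ℝ]^k (TangentSpace (dualModel I F) v),
      ∀ a, pair (P : ExteriorAlgebra ℝ (TangentSpace (dualModel I F) v))
        (affineDifferential v ∘ a) = G v a := fun v => by
    obtain ⟨B, hB⟩ := exists_descend (G v) (affineDifferential v)
      (affineDifferential_surjective v) (hG v)
    obtain ⟨P, hP⟩ := exists_pair_eq B
    exact ⟨P, fun a => (hP _).trans (hB a)⟩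
  choose P hP using hP
  have heval : ∀ v a, evalOn (J := dualModel I F) (N := DualTotal F E) P
      (fun i => hatLM.coprod basicLM (a i)) v = G v a := fun v a => hP v a
  have hhat : ∀ v s, evalOn (J := dualModel I F) (N := DualTotal F E) P
      (fun i => hat (s i)) v = hat (D s) v := fun v s => by
    rw [← hD, ← heval]
    refine congrArg (fun g => evalOn (J := dualModel I F) (N := DualTotal F E) P g v)
      (funext fun i => ?_)
    rw [LinearMap.coprod_apply, map_zero, add_zero]
    rfl
  have hPs : IsSmoothMultivector (J := dualModel I F) (N := DualTotal F E) P := by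
    refine isSmoothMultivector_of_span (affineFunctions I F E) span_affineFunctions
      fun g hg => ?_
    choose a ha using hg
    refine (hsmooth a).congr fun v => ?_
    rw [← heval]
    exact congrArg (fun g => evalOn (J := dualModel I F) (N := DualTotal F E) P g v)
      (funext fun i => (ha i).symm)
  have hPl : P ∈ linearMultivector I F E k := by
    refine (mem_linearMultivector_iff hPs).2 fun s x => ?_
    obtain ⟨L, hL⟩ := isFiberLinear_hat (D s) x
    exact ⟨L, fun w => (hhat _ s).trans (hL w)⟩
  refine ⟨⟨P, hPl⟩, AlternatingMap.ext fun s => hatLM_injective ?_⟩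
  ext v
  exact (hat_toSectionAlt_apply _ s v).trans (hhat v s)

/-- The value at a point of an alternating map with values in the vector fields. -/
def symbolValue {n : ℕ} (σ : Cₛ^∞⟮I; F, E⟯ [⋀^Fin n]→ₗ[C^∞⟮I, M; 𝓘(ℝ, ℝ), ℝ⟯]
      Cₛ^∞⟮I; EM, (TangentSpace I : M → Type _)⟯) (x : M) :
    Cₛ^∞⟮I; F, E⟯ [⋀^Fin n]→ₗ[ℝ] TangentSpace I x where
  toFun s := σ s x
  map_update_add' s i t u := congrArg (fun X : Cₛ^∞⟮I; EM, (TangentSpace I : M → Type _)⟯ => X x)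
    (σ.map_update_add s i t u)
  map_update_smul' s i c t := congrArg
    (fun X : Cₛ^∞⟮I; EM, (TangentSpace I : M → Type _)⟯ => X x)
    (σ.map_update_smul s i (algebraMap ℝ C^∞⟮I, M; 𝓘(ℝ, ℝ), ℝ⟯ c) t)
  map_eq_zero_of_eq' s _ _ h hij := congrArg
    (fun X : Cₛ^∞⟮I; EM, (TangentSpace I : M → Type _)⟯ => X x) (σ.map_eq_zero_of_eq s h hij)

theorem symbolValue_apply {n : ℕ} (σ : Cₛ^∞⟮I; F, E⟯ [⋀^Fin n]→ₗ[C^∞⟮I, M; 𝓘(ℝ, ℝ), ℝ⟯]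
      Cₛ^∞⟮I; EM, (TangentSpace I : M → Type _)⟯) (x : M) (s : Fin n → Cₛ^∞⟮I; F, E⟯) :
    symbolValue σ x s = σ s x := rfl

/-- A symbol is tensorial: its value at `x` depends on the values of its arguments at `x` only. -/
theorem symbolValue_eq_zero {n : ℕ} (σ : Cₛ^∞⟮I; F, E⟯ [⋀^Fin n]→ₗ[C^∞⟮I, M; 𝓘(ℝ, ℝ), ℝ⟯]
      Cₛ^∞⟮I; EM, (TangentSpace I : M → Type _)⟯) (x : M) (s : Fin n → Cₛ^∞⟮I; F, E⟯)
    (i : Fin n) (hs : s i x = 0) : symbolValue σ x s = 0 := by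
  have key : ∀ u ∈ Submodule.span ℝ {u : Cₛ^∞⟮I; F, E⟯ |
      ∃ (h : C^∞⟮I, M; 𝓘(ℝ, ℝ), ℝ⟯) (t : Cₛ^∞⟮I; F, E⟯), h x = 0 ∧ u = h • t},
      symbolValue σ x (Function.update s i u) = 0 := by
    intro u hu
    induction hu using Submodule.span_induction with
    | mem u hu =>
      obtain ⟨h, t, hh, rfl⟩ := hu
      rw [symbolValue_apply, σ.map_update_smul]
      change h x • (σ (Function.update s i t) x) = 0
      rw [hh, zero_smul]
    | zero => exact (symbolValue σ x).map_update_zero s i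
    | add u u' _ _ hu hu' => rw [AlternatingMap.map_update_add, hu, hu', add_zero]
    | smul c u _ hu => rw [AlternatingMap.map_update_smul, hu, smul_zero]
  have h := key (s i) (mem_span_of_apply_eq_zero x (s i) hs)
  rwa [Function.update_eq_self] at h

/-- The Leibniz rule in the first argument. -/
theorem IsSymbol.cons_smul {n : ℕ} {D : Cₛ^∞⟮I; F, E⟯ [⋀^Fin (n + 1)]→ₗ[ℝ] Cₛ^∞⟮I; F, E⟯}
    {σ : Cₛ^∞⟮I; F, E⟯ [⋀^Fin n]→ₗ[C^∞⟮I, M; 𝓘(ℝ, ℝ), ℝ⟯]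
      Cₛ^∞⟮I; EM, (TangentSpace I : M → Type _)⟯} (hσ : IsSymbol D σ)
    (f : C^∞⟮I, M; 𝓘(ℝ, ℝ), ℝ⟯) (t : Cₛ^∞⟮I; F, E⟯) (s : Fin n → Cₛ^∞⟮I; F, E⟯) (x : M) :
    D (Matrix.vecCons (f • t) s) x = f x • D (Matrix.vecCons t s) x +
      ((-1 : ℝ) ^ n * differentialAt x f (symbolValue σ x s)) • t x := by
  have h := hσ s f t x
  rw [alternating_snoc, alternating_snoc] at h
  rcases n.even_or_odd with hn | hn
  · rw [hn.neg_one_pow, one_smul, one_smul] at h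
    rw [hn.neg_one_pow, one_mul]
    exact h
  · rw [hn.neg_one_pow, Units.neg_smul, Units.neg_smul, one_smul, one_smul] at h
    rw [hn.neg_one_pow, neg_one_mul, neg_smul]
    change -(D (Matrix.vecCons (f • t) s) x) = f x • -(D (Matrix.vecCons t s) x) + _ at h
    rw [← neg_inj, h, smul_neg, neg_add, neg_neg]
    rfl

/-- For sections `s` vanishing at `x`, the value of `D (s, …)` at `x` is given by the derivative of
`s` along the symbol. -/
theorem IsSymbol.cons_of_apply_eq_zero {n : ℕ}
    {D : Cₛ^∞⟮I; F, E⟯ [⋀^Fin (n + 1)]→ₗ[ℝ] Cₛ^∞⟮I; F, E⟯}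
    {σ : Cₛ^∞⟮I; F, E⟯ [⋀^Fin n]→ₗ[C^∞⟮I, M; 𝓘(ℝ, ℝ), ℝ⟯]
      Cₛ^∞⟮I; EM, (TangentSpace I : M → Type _)⟯} (hσ : IsSymbol D σ)
    (s : Fin n → Cₛ^∞⟮I; F, E⟯) (v : DualTotal F E)
    {A : TangentSpace I v.1 →L[ℝ] TangentSpace (dualModel I F) v}
    (hA : ∀ (f : C^∞⟮I, M; 𝓘(ℝ, ℝ), ℝ⟯) (X : TangentSpace I v.1),
        differentialAt v (basic f) (A X) = differentialAt v.1 f X)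
    (u : Cₛ^∞⟮I; F, E⟯) (hu : u v.1 = 0) :
    v.2 (D (Matrix.vecCons u s) v.1) =
      (-1 : ℝ) ^ n * differentialAt v (hat u) (A (symbolValue σ v.1 s)) := by
  have hu' := mem_span_of_apply_eq_zero v.1 u hu
  clear hu
  have hcons : ∀ u, D (Matrix.vecCons u s) = D.curryLeft u s := fun _ => rfl
  have hhat : ∀ u : Cₛ^∞⟮I; F, E⟯, differentialAt v (hat u) = differentialHat v u := fun _ => rfl
  induction hu' using Submodule.span_induction with
  | mem u hu =>
    obtain ⟨h, t, hh, rfl⟩ := hu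
    rw [hσ.cons_smul, hh, zero_smul, zero_add, map_smul, differentialAt_hat_smul, hh, zero_smul,
      zero_add, smul_apply, hA]
    simp only [smul_eq_mul]
    ring
  | zero =>
    rw [hcons, hhat, map_zero, map_zero, AlternatingMap.zero_apply, zero_apply, mul_zero]
    exact map_zero v.2
  | add u u' _ _ hu hu' =>
    rw [hhat, map_add, add_apply, mul_add, ← hhat, ← hhat, ← hu, ← hu', hcons, map_add]
    exact map_add v.2 _ _
  | smul c u _ hu =>
    rw [hhat, map_smul, smul_apply, smul_eq_mul, mul_left_comm, ← hhat, ← hu, hcons, map_smul]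
    exact map_smul v.2 c _

/-- The map `((s, f), a₁, …, aₙ) ↦ σ(a₁, …, aₙ)(f)` at a point `x`, depending on the sections in the
pairs `aᵢ` only. -/
def symbolTerm {n : ℕ} (σ : Cₛ^∞⟮I; F, E⟯ [⋀^Fin n]→ₗ[C^∞⟮I, M; 𝓘(ℝ, ℝ), ℝ⟯]
      Cₛ^∞⟮I; EM, (TangentSpace I : M → Type _)⟯) (x : M) :
    Cₛ^∞⟮I; F, E⟯ × C^∞⟮I, M; 𝓘(ℝ, ℝ), ℝ⟯ →ₗ[ℝ]
      (Cₛ^∞⟮I; F, E⟯ × C^∞⟮I, M; 𝓘(ℝ, ℝ), ℝ⟯) [⋀^Fin n]→ₗ[ℝ] ℝ where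
  toFun a := ((differentialAt x a.2).toLinearMap.compAlternatingMap (symbolValue σ x)).compLinearMap
    (LinearMap.fst ℝ _ _)
  map_add' a b := by
    ext c
    exact DFunLike.congr_fun ((differentialAt x).map_add a.2 b.2) (symbolValue σ x fun i => (c i).1)
  map_smul' r a := by
    ext c
    exact DFunLike.congr_fun ((differentialAt x).map_smul r a.2) (symbolValue σ x fun i => (c i).1)

/-- The map `s ↦ ŝ(v)`. -/
def sectionEval (v : DualTotal F E) : Cₛ^∞⟮I; F, E⟯ →ₗ[ℝ] ℝ where
  toFun s := hat s v
  map_add' s t := map_add v.2 (s v.1) (t v.1)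
  map_smul' c s := map_smul v.2 c (s v.1)

/-- The extension of a multiderivation `D` with symbol `σ` to pairs `(s, f)`, which stand for the
functions `ŝ + π^* f`: it is `D` on sections, `σ` if one of the arguments is a function, and zero if
two of them are. -/
def extendedAlt {n : ℕ} (D : Cₛ^∞⟮I; F, E⟯ [⋀^Fin (n + 1)]→ₗ[ℝ] Cₛ^∞⟮I; F, E⟯)
    (σ : Cₛ^∞⟮I; F, E⟯ [⋀^Fin n]→ₗ[C^∞⟮I, M; 𝓘(ℝ, ℝ), ℝ⟯]
      Cₛ^∞⟮I; EM, (TangentSpace I : M → Type _)⟯) (v : DualTotal F E) :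
    (Cₛ^∞⟮I; F, E⟯ × C^∞⟮I, M; 𝓘(ℝ, ℝ), ℝ⟯) [⋀^Fin (n + 1)]→ₗ[ℝ] ℝ :=
  ((sectionEval v).compAlternatingMap D).compLinearMap (LinearMap.fst ℝ _ _) +
    (-1 : ℝ) ^ n • AlternatingMap.alternatizeUncurryFin (symbolTerm σ v.1)

theorem extendedAlt_apply {n : ℕ} (D : Cₛ^∞⟮I; F, E⟯ [⋀^Fin (n + 1)]→ₗ[ℝ] Cₛ^∞⟮I; F, E⟯)
    (σ : Cₛ^∞⟮I; F, E⟯ [⋀^Fin n]→ₗ[C^∞⟮I, M; 𝓘(ℝ, ℝ), ℝ⟯]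
      Cₛ^∞⟮I; EM, (TangentSpace I : M → Type _)⟯) (v : DualTotal F E)
    (a : Fin (n + 1) → Cₛ^∞⟮I; F, E⟯ × C^∞⟮I, M; 𝓘(ℝ, ℝ), ℝ⟯) :
    extendedAlt D σ v a = hat (D fun i => (a i).1) v + (-1 : ℝ) ^ n *
      ∑ i : Fin (n + 1), (-1 : ℝ) ^ (i : ℕ) *
        differentialAt v.1 (a i).2 (σ (fun j => (a (i.succAbove j)).1) v.1) := by
  change hat (D fun i => (a i).1) v + (-1 : ℝ) ^ n *
    AlternatingMap.alternatizeUncurryFin (symbolTerm σ v.1) a = _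
  rw [AlternatingMap.alternatizeUncurryFin_apply]
  congr 2
  refine Finset.sum_congr rfl fun i _ => ?_
  rw [zsmul_eq_mul]
  push_cast
  rfl

/-- The extension depends on the covectors `dŝ + d(π^* f)` only: the term of `D` and the term of
the symbol in which `f` is differentiated cancel each other, and the remaining terms vanish since the
symbol is tensorial. -/
theorem extendedAlt_cons_eq_zero {n : ℕ}
    {D : Cₛ^∞⟮I; F, E⟯ [⋀^Fin (n + 1)]→ₗ[ℝ] Cₛ^∞⟮I; F, E⟯}
    {σ : Cₛ^∞⟮I; F, E⟯ [⋀^Fin n]→ₗ[C^∞⟮I, M; 𝓘(ℝ, ℝ), ℝ⟯]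
      Cₛ^∞⟮I; EM, (TangentSpace I : M → Type _)⟯} (hσ : IsSymbol D σ) (v : DualTotal F E)
    (u : Cₛ^∞⟮I; F, E⟯ × C^∞⟮I, M; 𝓘(ℝ, ℝ), ℝ⟯)
    (a : Fin n → Cₛ^∞⟮I; F, E⟯ × C^∞⟮I, M; 𝓘(ℝ, ℝ), ℝ⟯) (hu : affineDifferential v u = 0) :
    extendedAlt D σ v (Matrix.vecCons u a) = 0 := by
  rw [affineDifferential_apply] at hu
  have hu1 : u.1 v.1 = 0 := apply_eq_zero_of_differentialAt v u.1 u.2 hu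
  obtain ⟨A, hA⟩ := exists_lift (I := I) v
  have hfst : (fun i => (Matrix.vecCons u a i).1) = Matrix.vecCons u.1 fun i => (a i).1 := by
    funext i
    refine Fin.cases rfl (fun j => rfl) i
  have h1 := hσ.cons_of_apply_eq_zero (fun i => (a i).1) v hA u.1 hu1
  -- if a function is inserted for one of the `a i`, the section vanishing at the base point is an
  -- argument of the symbol
  have h2 : ∀ i : Fin n, σ (fun j => (Matrix.vecCons u a (i.succ.succAbove j)).1) v.1 = 0 := by
    intro i
    have hn : 0 < n := i.pos
    refine symbolValue_eq_zero σ v.1 _ ⟨0, hn⟩ ?_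
    have : i.succ.succAbove ⟨0, hn⟩ = 0 := by
      have : NeZero n := ⟨hn.ne'⟩
      exact Fin.succ_succAbove_zero i
    rw [this]
    exact hu1
  have h3 : differentialAt v (hat u.1) (A (symbolValue σ v.1 fun i => (a i).1)) =
      - differentialAt v.1 u.2 (symbolValue σ v.1 fun i => (a i).1) := by
    rw [← hA, eq_neg_iff_add_eq_zero, ← add_apply, hu]
    rfl
  rw [extendedAlt_apply, hfst, Fin.sum_univ_succ, hat_apply, h1, h3]
  have h4 : ∀ i : Fin n, (-1 : ℝ) ^ (i.succ : ℕ) * differentialAt v.1 (Matrix.vecCons u a i.succ).2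
      (σ (fun j => (Matrix.vecCons u a (i.succ.succAbove j)).1) v.1) = 0 := fun i => by
    rw [h2, map_zero, mul_zero]
  rw [Finset.sum_eq_zero fun i _ => h4 i]
  change (-1 : ℝ) ^ n * -(differentialAt v.1 u.2 (symbolValue σ v.1 fun i => (a i).1)) +
    (-1 : ℝ) ^ n * ((-1 : ℝ) ^ 0 * differentialAt v.1 u.2 (symbolValue σ v.1 fun i => (a i).1) + 0)
      = 0
  ring

theorem contMDiff_extendedAlt {n : ℕ} (D : Cₛ^∞⟮I; F, E⟯ [⋀^Fin (n + 1)]→ₗ[ℝ] Cₛ^∞⟮I; F, E⟯)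
    (σ : Cₛ^∞⟮I; F, E⟯ [⋀^Fin n]→ₗ[C^∞⟮I, M; 𝓘(ℝ, ℝ), ℝ⟯]
      Cₛ^∞⟮I; EM, (TangentSpace I : M → Type _)⟯)
    (a : Fin (n + 1) → Cₛ^∞⟮I; F, E⟯ × C^∞⟮I, M; 𝓘(ℝ, ℝ), ℝ⟯) :
    ContMDiff (dualModel I F) 𝓘(ℝ, ℝ) ∞ fun v : DualTotal F E => extendedAlt D σ v a := by
  have h1 : ∀ i : Fin (n + 1), ContMDiff (dualModel I F) 𝓘(ℝ, ℝ) ∞ fun v : DualTotal F E =>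
      (-1 : ℝ) ^ (i : ℕ) *
        differentialAt v.1 (a i).2 (σ (fun j => (a (i.succAbove j)).1) v.1) := fun i =>
    contMDiff_const.mul ((contMDiff_differentialAt_apply
      (σ fun j => (a (i.succAbove j)).1) (a i).2).comp (Bundle.contMDiff_proj (DualFiber E)))
  exact ((hat (D fun i => (a i).1)).contMDiff.add
    (contMDiff_const.mul (contMDiff_finsetSum fun i _ => h1 i))).congr
      fun v => extendedAlt_apply D σ v a

theorem toMultiDer_surjective (k : ℕ) : Function.Surjective (toMultiDer I F E k) := by
  rintro ⟨D, hD⟩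
  suffices H : ∃ P : linearMultivector I F E k, toSectionAlt P = D by
    obtain ⟨P, hP⟩ := H
    exact ⟨P, Subtype.ext hP⟩
  cases k with
  | zero =>
    refine exists_toSectionAlt_eq D
      (fun v => ((sectionEval v).compAlternatingMap D).compLinearMap (LinearMap.fst ℝ _ _))
      (fun v a ⟨i, _⟩ => i.elim0) (fun a => (hat (D fun i => (a i).1)).contMDiff)
      fun v s => rfl
  | succ n =>
    obtain ⟨σ, hσ⟩ := hD
    refine exists_toSectionAlt_eq D (extendedAlt D σ) (fun v a h => ?_)
      (contMDiff_extendedAlt D σ) fun v s => ?_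
    · refine alternating_eq_zero_of_first _ (LinearMap.ker (affineDifferential v))
        (fun u b hu => extendedAlt_cons_eq_zero hσ v u b hu) a h
    · rw [extendedAlt_apply, Finset.sum_eq_zero fun i _ => ?_, mul_zero, add_zero]
      rw [map_zero, zero_apply, mul_zero]

end Reconstruction

/-! ### The brackets and the cohomology -/

section Comparison

variable {EM : Type*} [NormedAddCommGroup EM] [NormedSpace ℝ EM] [FiniteDimensional ℝ EM]
  {HM : Type*} [TopologicalSpace HM] {I : ModelWithCorners ℝ EM HM} [I.Boundaryless]
  {M : Type*} [TopologicalSpace M] [ChartedSpace HM M] [IsManifold I ∞ M] [T2Space M]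
  {F : Type*} [NormedAddCommGroup F] [NormedSpace ℝ F] [FiniteDimensional ℝ F] [Nontrivial F]
  {E : M → Type*} [∀ x, AddCommGroup (E x)] [∀ x, Module ℝ (E x)]
  [TopologicalSpace (Bundle.TotalSpace F E)] [∀ x, TopologicalSpace (E x)]
  [FiberBundle F E] [VectorBundle ℝ F E] [ContMDiffVectorBundle ∞ F E I]

variable (I F E) in
/-- Linear multivector fields are multiderivations. -/
def multiDerEquiv (k : ℕ) : linearMultivector I F E k ≃ₗ[ℝ] multiDer I F E k :=
  LinearEquiv.ofBijective (toMultiDer I F E k) ⟨toMultiDer_injective k, toMultiDer_surjective k⟩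

theorem toSectionAlt_injective {k : ℕ} {P Q : linearMultivector I F E k}
    (h : toSectionAlt P = toSectionAlt Q) : P = Q :=
  toMultiDer_injective k (Subtype.ext h)

theorem neg_one_pow_smul_cmBracket {V : Type*} [AddCommGroup V] [Module ℝ V] {a b r : ℕ}
    (h : r + 1 = a + b) (f : V [⋀^Fin a]→ₗ[ℝ] V) (g : V [⋀^Fin b]→ₗ[ℝ] V) :
    (-1 : ℝ) ^ ((a + 1) * (b + 1)) • cmBracket h f g =
      insertion h f g - (-1 : ℝ) ^ ((a + 1) * (b + 1)) • insertion (by omega) g f := by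
  rw [cmBracket, smul_sub, smul_smul, ← mul_pow]
  norm_num

/-- Since `s ↦ ŝ` intertwines the two insertion products, the Schouten bracket of linear multivector
fields is linear, and it corresponds to the bracket of multiderivations. -/
theorem exists_schouten_linear {p q r : ℕ} (h : r + 1 = p + q) (P : linearMultivector I F E p)
    (Q : linearMultivector I F E q) :
    ∃ R : linearMultivector I F E r, IsSchoutenBracket P.1 Q.1 R.1 ∧
      toSectionAlt R =
        (-1 : ℝ) ^ ((p + 1) * (q + 1)) • cmBracket h (toSectionAlt P) (toSectionAlt Q) := by
  obtain ⟨R, hRs, hR, hRe⟩ := exists_isSchoutenBracket h P.2.1 Q.2.1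
  have key : ∀ (s : Fin r → Cₛ^∞⟮I; F, E⟯) (v : DualTotal F E), evalOn R (fun i => hat (s i)) v =
      hat (((-1 : ℝ) ^ ((p + 1) * (q + 1)) •
        cmBracket h (toSectionAlt P) (toSectionAlt Q)) s) v := fun s v => by
    refine (congrFun (hRe _) v).trans ?_
    rw [bracketAlt_apply, neg_one_pow_smul_cmBracket]
    have h1 := DFunLike.congr_fun
      (map_insertion hatLM h (hat_toSectionAlt P) (hat_toSectionAlt Q) s) v
    have h2 := DFunLike.congr_fun (map_insertion hatLM (by omega : r + 1 = q + p)
      (hat_toSectionAlt Q) (hat_toSectionAlt P) s) v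
    refine (congrArg₂ (fun x y : ℝ => x - (-1 : ℝ) ^ ((p + 1) * (q + 1)) * y) h1 h2).symm.trans ?_
    rw [← smul_eq_mul]
    exact (((sectionEval v).map_sub _ _).trans
      (congrArg (_ - ·) ((sectionEval v).map_smul _ _))).symm
  have hRl : R ∈ linearMultivector I F E r := (mem_linearMultivector_iff hRs).2 fun s x => by
    obtain ⟨L, hL⟩ := isFiberLinear_hat (((-1 : ℝ) ^ ((p + 1) * (q + 1)) •
        cmBracket h (toSectionAlt P) (toSectionAlt Q)) s) x
    exact ⟨L, fun w => (key s _).trans (hL w)⟩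
  refine ⟨⟨R, hRl⟩, hR, AlternatingMap.ext fun s => hatLM_injective ?_⟩
  ext v
  exact (hat_toSectionAlt_apply _ s v).trans (key s v)

/-- A linear multivector field is the Schouten bracket of two others if and only if the
multiderivations are in this relation. -/
theorem isSchoutenBracket_iff_toSectionAlt {p q r : ℕ} (h : r + 1 = p + q)
    (P : linearMultivector I F E p) (Q : linearMultivector I F E q)
    (R : linearMultivector I F E r) :
    IsSchoutenBracket P.1 Q.1 R.1 ↔ toSectionAlt R =
      (-1 : ℝ) ^ ((p + 1) * (q + 1)) • cmBracket h (toSectionAlt P) (toSectionAlt Q) := by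
  obtain ⟨R', hR', e⟩ := exists_schouten_linear h P Q
  rw [← e]
  constructor
  · intro hR
    exact congrArg toSectionAlt (Subtype.ext (hR.unique h P.2.1 Q.2.1 hR'))
  · intro hR
    exact toSectionAlt_injective hR ▸ hR'

theorem toSectionAlt_zero {k : ℕ} : toSectionAlt (0 : linearMultivector I F E k) = 0 :=
  congrArg Subtype.val (toMultiDer I F E k).map_zero

theorem isSchoutenBracket_zero_iff {p q r : ℕ} (h : r + 1 = p + q)
    (P : linearMultivector I F E p) (Q : linearMultivector I F E q) :
    IsSchoutenBracket P.1 Q.1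
        (0 : MultivectorField (dualModel I F) (DualTotal F E) r) ↔
      cmBracket h (toSectionAlt P) (toSectionAlt Q) = 0 := by
  refine (isSchoutenBracket_iff_toSectionAlt h P Q 0).trans ?_
  rw [toSectionAlt_zero, eq_comm, smul_eq_zero]
  exact or_iff_right (pow_ne_zero _ (by norm_num))

/-- With one of the fields of degree two, the sign is `(-1)^(p-1)`. -/
theorem cmBracket_toSectionAlt_two {p : ℕ} (π₀ : linearMultivector I F E 2)
    (P : linearMultivector I F E p) (R : linearMultivector I F E (p + 1)) :
    IsSchoutenBracket π₀.1 P.1 R.1 ↔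
      cmBracket (by omega) (toSectionAlt π₀) (toSectionAlt P) =
        (-1 : ℝ) ^ (p + 1) • toSectionAlt R := by
  rw [isSchoutenBracket_iff_toSectionAlt (by omega : p + 1 + 1 = 2 + p)]
  have h1 : (-1 : ℝ) ^ ((2 + 1) * (p + 1)) = (-1) ^ (p + 1) := by rw [pow_mul]; norm_num
  have h2 : (-1 : ℝ) ^ (p + 1) * (-1) ^ (p + 1) = 1 := by rw [← mul_pow]; norm_num
  rw [h1]
  constructor
  · intro h
    rw [h, smul_smul, h2, one_smul]
  · intro h
    rw [h, smul_smul, h2, one_smul]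

theorem mem_cmCocycles_iff (π₀ : linearMultivector I F E 2) {k : ℕ}
    (P : linearMultivector I F E k) :
    toSectionAlt P ∈ cmCocycles (multiDerEquiv I F E 2 π₀) k ↔ P ∈ poissonCocycles π₀ k :=
  Iff.trans ⟨fun h => h.2, fun h => ⟨toSectionAlt_mem_multiDer P, h⟩⟩
    (isSchoutenBracket_zero_iff (by omega : k + 1 + 1 = 2 + k) π₀ P).symm

/-- The isomorphism on cocycles. -/
def cocycleEquiv (π₀ : linearMultivector I F E 2) (k : ℕ) :
    poissonCocycles π₀ k ≃ₗ[ℝ] cmCocycles (multiDerEquiv I F E 2 π₀) k :=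
  LinearEquiv.ofBijective
    (((multiDer I F E k).subtype ∘ₗ toMultiDer I F E k).restrict
      fun P hP => (mem_cmCocycles_iff π₀ P).2 hP)
    ⟨fun _ _ h => Subtype.ext (toSectionAlt_injective (congrArg Subtype.val h)), fun D => by
      obtain ⟨P, hP⟩ := toMultiDer_surjective k ⟨D.1, D.2.1⟩
      have hP' : toSectionAlt P = D.1 := congrArg Subtype.val hP
      exact ⟨⟨P, (mem_cmCocycles_iff π₀ P).1 (hP' ▸ D.2)⟩, Subtype.ext hP'⟩⟩

/-- The sign between the two differentials is absorbed by the potentials. -/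
theorem mem_cmCoboundaries_iff (π₀ : linearMultivector I F E 2) {k : ℕ}
    (R : linearMultivector I F E k) :
    toSectionAlt R ∈ cmCoboundaries (multiDerEquiv I F E 2 π₀) k ↔
      R ∈ poissonCoboundaries π₀ k := by
  cases k with
  | zero =>
    change toSectionAlt R = 0 ↔ R = 0
    rw [← toSectionAlt_zero]
    exact ⟨toSectionAlt_injective, congrArg _⟩
  | succ k =>
    have h2 : (-1 : ℝ) ^ (k + 1) * (-1) ^ (k + 1) = 1 := by rw [← mul_pow]; norm_num
    change (∃ D, D ∈ multiDer I F E k ∧ cmBracket _ (toSectionAlt π₀) D = toSectionAlt R) ↔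
      ∃ P : linearMultivector I F E k, IsSchoutenBracket π₀.1 P.1 R.1
    constructor
    · rintro ⟨D, hD, h⟩
      obtain ⟨P, hP⟩ := toMultiDer_surjective k ⟨(-1 : ℝ) ^ (k + 1) • D, Submodule.smul_mem _ _ hD⟩
      have hP' : toSectionAlt P = (-1 : ℝ) ^ (k + 1) • D := congrArg Subtype.val hP
      refine ⟨P, (cmBracket_toSectionAlt_two π₀ P R).2 ?_⟩
      rw [hP', cmBracket_smul_right, h]
    · rintro ⟨P, hP⟩
      refine ⟨(-1 : ℝ) ^ (k + 1) • toSectionAlt P,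
        Submodule.smul_mem _ _ (toSectionAlt_mem_multiDer P), ?_⟩
      rw [cmBracket_smul_right, (cmBracket_toSectionAlt_two π₀ P R).1 hP, smul_smul, h2, one_smul]

/-- The isomorphism on cohomology. -/
def cohomologyEquiv (π₀ : linearMultivector I F E 2) (k : ℕ) :
    PoissonCohomology π₀ k ≃ₗ[ℝ] CMCohomology (multiDerEquiv I F E 2 π₀) k :=
  Submodule.Quotient.equiv _ _ (cocycleEquiv π₀ k) (by
    ext D
    obtain ⟨z, rfl⟩ := (cocycleEquiv π₀ k).surjective D
    constructor
    · rintro ⟨w, hw, h⟩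
      obtain rfl := (cocycleEquiv π₀ k).injective h
      exact (mem_cmCoboundaries_iff π₀ w.1).2 hw
    · exact fun h => ⟨z, (mem_cmCoboundaries_iff π₀ z.1).1 h, rfl⟩)

end Comparison

end LinearPoisson

end

theorem mainTheorem7
    {EM : Type*} [NormedAddCommGroup EM] [NormedSpace ℝ EM] [FiniteDimensional ℝ EM]
    {HM : Type*} [TopologicalSpace HM] (J : ModelWithCorners ℝ EM HM) [J.Boundaryless]
    {M : Type*} [TopologicalSpace M] [ChartedSpace HM M] [IsManifold J ∞ M]
    [T2Space M] [SecondCountableTopology M]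
    (F : Type*) [NormedAddCommGroup F] [NormedSpace ℝ F] [FiniteDimensional ℝ F] [Nontrivial F]
    (E : M → Type*) [∀ x, AddCommGroup (E x)] [∀ x, Module ℝ (E x)]
    [TopologicalSpace (Bundle.TotalSpace F E)] [∀ x, TopologicalSpace (E x)]
    [FiberBundle F E] [VectorBundle ℝ F E] [ContMDiffVectorBundle ∞ F E J] :
    ∃ I : ∀ k : ℕ,
        LinearPoisson.linearMultivector J F E k ≃ₗ[ℝ] LinearPoisson.multiDer J F E k,
      (∀ (k : ℕ) (P : LinearPoisson.linearMultivector J F E k)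
          (s : Fin k → Cₛ^∞⟮J; F, E⟯) (v : LinearPoisson.DualTotal F E),
        LinearPoisson.hat ((I k P).1 s) v =
          LinearPoisson.interior P.1
            (LinearPoisson.exactForm fun i => LinearPoisson.hat (s i)) 0 v ![]) ∧
      (∀ (p q r : ℕ) (h : r + 1 = p + q) (P : LinearPoisson.linearMultivector J F E p)
          (Q : LinearPoisson.linearMultivector J F E q),
        ∃ R : LinearPoisson.linearMultivector J F E r,
          (∀ R' : LinearPoisson.MultivectorField (LinearPoisson.dualModel J F)
              (LinearPoisson.DualTotal F E) r,
            LinearPoisson.IsSchoutenBracket P.1 Q.1 R' ↔ R' = R.1) ∧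
          (I r R).1 =
            (-1 : ℝ) ^ ((p + 1) * (q + 1)) • LinearPoisson.cmBracket h (I p P).1 (I q Q).1) ∧
      ∀ π₀ : LinearPoisson.linearMultivector J F E 2,
        LinearPoisson.IsSchoutenBracket π₀.1 π₀.1
            (0 : LinearPoisson.MultivectorField (LinearPoisson.dualModel J F)
              (LinearPoisson.DualTotal F E) 3) →
          LinearPoisson.cmBracket (a := 2) (b := 2) (r := 3) rfl (I 2 π₀).1 (I 2 π₀).1 = 0 ∧
          (∀ (p : ℕ) (P : LinearPoisson.linearMultivector J F E p)
              (R : LinearPoisson.linearMultivector J F E (p + 1)),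
            LinearPoisson.IsSchoutenBracket π₀.1 P.1 R.1 →
              LinearPoisson.cmBracket (a := 2) (b := p) (r := p + 1) (by omega)
                  (I 2 π₀).1 (I p P).1 =
                (-1 : ℝ) ^ (p + 1) • (I (p + 1) R).1) ∧
          ∀ k : ℕ, ∃ Φ : LinearPoisson.PoissonCohomology π₀ k ≃ₗ[ℝ]
              LinearPoisson.CMCohomology (I 2 π₀) k,
            ∀ z : LinearPoisson.poissonCocycles π₀ k,
              ∃ z' : LinearPoisson.cmCocycles (I 2 π₀) k,
                z'.1 = (I k z.1).1 ∧ Φ (Submodule.Quotient.mk z) = Submodule.Quotient.mk z' := by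
  open LinearPoisson in
  refine ⟨multiDerEquiv J F E, fun k P s v => hat_toSectionAlt_apply P s v,
    fun p q r h P Q => ?_, fun π₀ hπ₀ => ⟨?_,
      fun p P R => (cmBracket_toSectionAlt_two π₀ P R).1,
      fun k => ⟨cohomologyEquiv π₀ k, fun z => ⟨cocycleEquiv π₀ k z, rfl, rfl⟩⟩⟩⟩
  · obtain ⟨R, hR, e⟩ := exists_schouten_linear h P Q
    exact ⟨R, fun R' => ⟨fun hR' => hR'.unique h P.2.1 Q.2.1 hR, fun h' => h' ▸ hR⟩, e⟩
  · have e := isSchoutenBracket_zero_iff (p := 2) (q := 2) (r := 3) rfl π₀ π₀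
    exact e.1 hπ₀
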